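/- Let $(M,g)$ be a spacetime of dimension $n+1\ge 2$: a Hausdorff paracompact manifold of class at least $C^4$ with a time oriented $C^3$ Lorentzian metric $g$ of signature $(-,+,\dots,+)$. For an open set $U\subset M$ and a set $H\subset M$, $H$ is *achronal in $U$* if no two (possibly equal) points of $H\cap U$ are joined by a piecewise $C^1$ timelike curve contained in $U$; $J^{+}(p,U)$ (resp. $J^-(p,U)$) is the set consisting of $p$ and of the points reached from $p$ by a future-directed (resp. past-directed) piecewise $C^1$ causal curve contained in $U$. A *past horizon* is a topological embedded hypersurface $H\subset M$ (without boundary, i.e. near each of its points it is mapped to a hyperplane by a local homeomorphism of $M$ with $\mathbb{R}^{n+1}$) which is locally achronal (each $p\in H$ has an open neighborhood in which $H$ is achronal) and such that for every $p\in H$ and every open neighborhood $U$ of $p$ in which $H$ is achronal there is $q\in J^+(p,U)\cap H$ with $q\neq p$. A *future horizon* is defined dually, with $J^-$ in place of $J^+$, and a *horizon* is a past or a future horizon. A *generator* of $H$ is a future-directed lightlike geodesic, defined on an interval with more than one point and contained in $H$, which is not the restriction of such a geodesic defined on a larger interval. A point is an *endpoint* of $H$ if it is the initial or the final point of a generator.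 Near each of its points a horizon is a graph $x^0=h(\mathbf{x})$, $\mathbf{x}=(x^1,\dots,x^n)$, of a continuous function $h$ on an open subset of $\mathbb{R}^n$, in some $C^4$ chart $(x^0,\mathbf{x})$ of $M$ whose coordinate field $\partial_0$ is future-directed timelike. The horizon is *differentiable at $p$* (resp. $C^{1,1}$ *near* $p$) if in all such charts around $p$ the function $h$ is differentiable at the point corresponding to $p$ (resp. is differentiable with Lipschitz differential on a neighborhood of that point). It is $C^{1,1}_{\rm loc}$ on an open subset of $H$ if it is $C^{1,1}$ near each point of that subset. **Theorem.** Let $H$ be a horizon. 1. Let $O\subset M$ be open. Then $H$ is differentiable at every point of $H\cap O$ if and only if $H\cap O$ contains no endpoint of $H$; and in this case $H$ is $C^{1,1}_{\rm loc}$ on $H\cap O$. 2. Let $D\subset H$ be the set of the points at which $H$ is differentiable, $\Sigma=H\setminus D$, and let $\mathrm{Int}\, D$ be the interior of $D$ relative to $H$. Then $\mathrm{Int}\, D=H\setminus\overline{\Sigma}$, and $H$ is $C^{1,1}_{\rm loc}$ on $\mathrm{Int}\, D$. -/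

import Mathlib

open Set Filter Topology Manifold ContDiff Bundle

namespace NullHorizon

/-- The coordinate space `ℝ × ℝⁿ` of an `n + 1` dimensional manifold; coordinate `0` plays the
role of time, the coordinates `1, …, n` are the spatial ones. -/
abbrev Coord (n : ℕ) : Type := EuclideanSpace ℝ (Fin (n + 1))

/-- The spatial coordinate space `ℝⁿ`. -/
abbrev Space (n : ℕ) : Type := EuclideanSpace ℝ (Fin n)

/-- The spatial part `(x¹, …, xⁿ)` of `(x⁰, x¹, …, xⁿ)`. -/
def spatial {n : ℕ} (y : Coord n) : Space n := WithLp.toLp 2 (fun i : Fin n => y i.succ)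

/-- The coordinate vector `∂₀`. -/
noncomputable def e₀ (n : ℕ) : Coord n := EuclideanSpace.single 0 1

instance isManifold_three_of_four {n : ℕ} {M : Type*} [TopologicalSpace M]
    [ChartedSpace (Coord n) M] [h : IsManifold 𝓘(ℝ, Coord n) 4 M] :
    IsManifold 𝓘(ℝ, Coord n) 3 M :=
  IsManifold.of_le (n := 4) (by norm_cast)

/-- A time oriented Lorentzian structure on an `n + 1` dimensional manifold `M` of class `C⁴`:
a `C³` metric `g` of signature `(-, +, …, +)` and a `C³` timelike vector field `V`, which is
declared to be future-directed. (A manifold of class `C^k`, `4 ≤ k ≤ ∞` or `k = ω`, is in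
particular of class `C⁴`.) -/
structure Spacetime (n : ℕ) (M : Type*) [TopologicalSpace M] [ChartedSpace (Coord n) M]
    [IsManifold 𝓘(ℝ, Coord n) 4 M] where
  /-- the metric -/
  g : ∀ x : M, TangentSpace 𝓘(ℝ, Coord n) x →L[ℝ] TangentSpace 𝓘(ℝ, Coord n) x →L[ℝ] ℝ
  symm : ∀ x v w, g x v w = g x w v
  /-- signature `(-, +, …, +)`: some vector is timelike, and the metric is positive definite on
  its orthogonal complement -/
  signature : ∀ x, ∃ u, g x u u < 0 ∧ ∀ w, w ≠ 0 → g x u w = 0 → 0 < g x w w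
  contMDiff_g : ContMDiff 𝓘(ℝ, Coord n)
    (𝓘(ℝ, Coord n).prod 𝓘(ℝ, Coord n →L[ℝ] Coord n →L[ℝ] ℝ)) 3
    (fun x => TotalSpace.mk' (Coord n →L[ℝ] Coord n →L[ℝ] ℝ) x (g x))
  /-- the time orientation -/
  V : ∀ x : M, TangentSpace 𝓘(ℝ, Coord n) x
  timelike_V : ∀ x, g x (V x) (V x) < 0
  contMDiff_V : ContMDiff 𝓘(ℝ, Coord n) 𝓘(ℝ, Coord n).tangent 3
    (fun x => (⟨x, V x⟩ : TangentBundle 𝓘(ℝ, Coord n) M))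

variable {n : ℕ} {M : Type*} [TopologicalSpace M] [ChartedSpace (Coord n) M]
  [IsManifold 𝓘(ℝ, Coord n) 4 M]

namespace Spacetime

/-! ### Causality -/

/-- `v` is a future-directed timelike vector at `x`. -/
def FutureTimelike (S : Spacetime n M) (x : M) (v : TangentSpace 𝓘(ℝ, Coord n) x) : Prop :=
  S.g x v v < 0 ∧ S.g x v (S.V x) < 0

/-- `v` is a future-directed causal (in particular non-zero) vector at `x`. -/
def FutureCausal (S : Spacetime n M) (x : M) (v : TangentSpace 𝓘(ℝ, Coord n) x) : Prop :=
  v ≠ 0 ∧ S.g x v v ≤ 0 ∧ S.g x v (S.V x) < 0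

/-- `v` is a future-directed lightlike (in particular non-zero) vector at `x`. -/
def FutureLightlike (S : Spacetime n M) (x : M) (v : TangentSpace 𝓘(ℝ, Coord n) x) : Prop :=
  v ≠ 0 ∧ S.g x v v = 0 ∧ S.g x v (S.V x) < 0

end Spacetime

/-- The velocity at time `t` of a curve defined on the set `s` of times. -/
noncomputable def velocity (n : ℕ) {M : Type*} [TopologicalSpace M] [ChartedSpace (Coord n) M]
    (γ : ℝ → M) (s : Set ℝ) (t : ℝ) : TangentSpace 𝓘(ℝ, Coord n) (γ t) :=
  mfderivWithin 𝓘(ℝ, ℝ) 𝓘(ℝ, Coord n) γ s t (1 : ℝ)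

namespace Spacetime

/-- A future-directed causal curve of class `C¹` inside `U` goes from `p` to `q`. -/
def CausalStep (S : Spacetime n M) (U : Set M) (p q : M) : Prop :=
  ∃ γ : ℝ → M, ContMDiffOn 𝓘(ℝ, ℝ) 𝓘(ℝ, Coord n) 1 γ (Icc 0 1) ∧ γ 0 = p ∧ γ 1 = q ∧
    ∀ t ∈ Icc (0 : ℝ) 1, γ t ∈ U ∧ S.FutureCausal (γ t) (velocity n γ (Icc 0 1) t)

/-- A future-directed timelike curve of class `C¹` inside `U` goes from `p` to `q`. -/
def TimelikeStep (S : Spacetime n M) (U : Set M) (p q : M) : Prop :=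
  ∃ γ : ℝ → M, ContMDiffOn 𝓘(ℝ, ℝ) 𝓘(ℝ, Coord n) 1 γ (Icc 0 1) ∧ γ 0 = p ∧ γ 1 = q ∧
    ∀ t ∈ Icc (0 : ℝ) 1, γ t ∈ U ∧ S.FutureTimelike (γ t) (velocity n γ (Icc 0 1) t)

/-- `q ∈ J⁺(p, U)`: either `q = p` or a piecewise `C¹` future-directed causal curve inside `U`
goes from `p` to `q`. -/
def CausalRel (S : Spacetime n M) (U : Set M) : M → M → Prop :=
  Relation.ReflTransGen (S.CausalStep U)

/-- `q ∈ I⁺(p, U)`: a piecewise `C¹` future-directed timelike curve inside `U` goes from `p`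
to `q`. -/
def ChronRel (S : Spacetime n M) (U : Set M) : M → M → Prop :=
  Relation.TransGen (S.TimelikeStep U)

/-- `H` is achronal in `U`: no two points of `H ∩ U` (equal or not) are joined by a timelike curve
contained in `U`. -/
def AchronalIn (S : Spacetime n M) (H U : Set M) : Prop :=
  ∀ p ∈ H ∩ U, ∀ q ∈ H ∩ U, ¬ S.ChronRel U p q

/-! ### Horizons -/

/-- `H` is a topological embedded hypersurface (without boundary): near each of its points it is
mapped to the hyperplane `{x⁰ = 0}` by some homeomorphism between an open set of `M` and an open
set of `ℝ × ℝⁿ`. -/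
def _root_.NullHorizon.IsTopologicalHypersurface (n : ℕ) {M : Type*} [TopologicalSpace M]
    (H : Set M) : Prop :=
  ∀ p ∈ H, ∃ e : OpenPartialHomeomorph M (Coord n), p ∈ e.source ∧
    ∀ x ∈ e.source, x ∈ H ↔ e x 0 = 0

/-- Every point of `H` has an open neighbourhood in which `H` is achronal. -/
def LocallyAchronal (S : Spacetime n M) (H : Set M) : Prop :=
  ∀ p ∈ H, ∃ U : Set M, IsOpen U ∧ p ∈ U ∧ S.AchronalIn H U

/-- `H` is a past horizon, that is, a future null hypersurface of class `C⁰`. -/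
def IsPastHorizon (S : Spacetime n M) (H : Set M) : Prop :=
  IsTopologicalHypersurface n H ∧ S.LocallyAchronal H ∧
    ∀ p ∈ H, ∀ U : Set M, IsOpen U → p ∈ U → S.AchronalIn H U →
      ∃ q ∈ H, q ≠ p ∧ S.CausalRel U p q

/-- The time-dual notion: `H` is a future horizon, that is, a past null hypersurface of
class `C⁰`. -/
def IsFutureHorizon (S : Spacetime n M) (H : Set M) : Prop :=
  IsTopologicalHypersurface n H ∧ S.LocallyAchronal H ∧
    ∀ p ∈ H, ∀ U : Set M, IsOpen U → p ∈ U → S.AchronalIn H U →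
      ∃ q ∈ H, q ≠ p ∧ S.CausalRel U q p

/-- A horizon is a null hypersurface of class `C⁰`, future or past. -/
def IsHorizon (S : Spacetime n M) (H : Set M) : Prop :=
  S.IsPastHorizon H ∨ S.IsFutureHorizon H

/-! ### Generators and endpoints -/

/-- The metric in the chart `e`, at the coordinate point `y`, on the coordinate vectors `u`,
`w`: it is `∑ g_{ij}(y) uⁱ wʲ`. -/
noncomputable def chartMetric (S : Spacetime n M) (e : OpenPartialHomeomorph M (Coord n))
    (y u w : Coord n) : ℝ :=
  S.g (e.symm y) (mfderiv 𝓘(ℝ, Coord n) 𝓘(ℝ, Coord n) e.symm y u)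
    (mfderiv 𝓘(ℝ, Coord n) 𝓘(ℝ, Coord n) e.symm y w)

/-- `γ`, defined on the interval `s`, is an (affinely parametrized) geodesic: in every `C⁴` chart
it is of class `C²` and satisfies the geodesic equation with lowered index,
`g_{kj} c''ʲ + ∂ᵢ g_{jk} c'ⁱ c'ʲ - ½ ∂ₖ g_{ij} c'ⁱ c'ʲ = 0` for all `k`, contracted here with an
arbitrary vector `wᵏ`. -/
def IsGeodesicOn (S : Spacetime n M) (γ : ℝ → M) (s : Set ℝ) : Prop :=
  ContinuousOn γ s ∧
    ∀ t ∈ s, ∀ e ∈ IsManifold.maximalAtlas 𝓘(ℝ, Coord n) 4 M, γ t ∈ e.source →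
      ContDiffWithinAt ℝ 2 (fun τ => e (γ τ)) s t ∧
      ∀ w : Coord n,
        let c : Coord n := e (γ t)
        let c' : Coord n := derivWithin (fun τ => e (γ τ)) s t
        let c'' : Coord n := derivWithin (derivWithin (fun τ => e (γ τ)) s) s t
        S.chartMetric e c c'' w
          + fderiv ℝ (fun y => S.chartMetric e y c' w) c c'
          - (1 / 2) * fderiv ℝ (fun y => S.chartMetric e y c' c') c w = 0

/-- `γ`, defined on the interval `s`, is a future-directed lightlike geodesic (segment, of positive
length) contained in `H`. -/
def IsLightlikeGeodesicIn (S : Spacetime n M) (H : Set M) (γ : ℝ → M) (s : Set ℝ) : Prop :=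
  s.OrdConnected ∧ s.Nontrivial ∧ S.IsGeodesicOn γ s ∧
    ∀ t ∈ s, γ t ∈ H ∧ S.FutureLightlike (γ t) (velocity n γ s t)

/-- A generator of `H`: a future-directed lightlike geodesic contained in `H` which cannot be
prolonged, as such, to a larger interval. -/
def IsGenerator (S : Spacetime n M) (H : Set M) (γ : ℝ → M) (s : Set ℝ) : Prop :=
  S.IsLightlikeGeodesicIn H γ s ∧
    ∀ (η : ℝ → M) (s' : Set ℝ), s ⊆ s' → EqOn η γ s → S.IsLightlikeGeodesicIn H η s' → s' = s

/-- `p` is an endpoint of `H`: it is the initial point or the final point of a generator. -/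
def IsEndpoint (S : Spacetime n M) (H : Set M) (p : M) : Prop :=
  ∃ (γ : ℝ → M) (s : Set ℝ) (t : ℝ), S.IsGenerator H γ s ∧ (IsLeast s t ∨ IsGreatest s t) ∧
    γ t = p

/-! ### Regularity of a horizon -/

/-- `(e, Ω, h)` is a graph chart of `H` at `p`: `e` is a `C⁴` chart of `M` around `p` whose
coordinate vector `∂₀` is future-directed timelike, and in which `H` is the graph `x⁰ = h(𝐱)` of
a continuous function `h` on an open set `Ω` of `ℝⁿ`. -/
def IsGraphChart (S : Spacetime n M) (H : Set M) (p : M)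
    (e : OpenPartialHomeomorph M (Coord n)) (Ω : Set (Space n)) (h : Space n → ℝ) : Prop :=
  e ∈ IsManifold.maximalAtlas 𝓘(ℝ, Coord n) 4 M ∧ p ∈ e.source ∧
    (∀ y ∈ e.target, S.FutureTimelike (e.symm y)
      (mfderiv 𝓘(ℝ, Coord n) 𝓘(ℝ, Coord n) e.symm y (e₀ n))) ∧
    IsOpen Ω ∧ ContinuousOn h Ω ∧
    e '' (H ∩ e.source) = {y | spatial y ∈ Ω ∧ y 0 = h (spatial y)}

/-- `H` is differentiable at `p`: it has graph charts at `p`, and in each of them the local graph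
function is differentiable at the point corresponding to `p`. -/
def DifferentiableAtPoint (S : Spacetime n M) (H : Set M) (p : M) : Prop :=
  (∃ e Ω h, S.IsGraphChart H p e Ω h) ∧
    ∀ e Ω h, S.IsGraphChart H p e Ω h → DifferentiableAt ℝ h (spatial (e p))

/-- A function is of class `C^{1,1}` near `x`: on some neighbourhood of `x` it is differentiable
with Lipschitz differential. -/
def _root_.NullHorizon.IsC11Near {F : Type*} [NormedAddCommGroup F] [NormedSpace ℝ F]
    (h : F → ℝ) (x : F) : Prop :=
  ∃ W : Set F, IsOpen W ∧ x ∈ W ∧ (∀ y ∈ W, DifferentiableAt ℝ h y) ∧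
    ∃ K, LipschitzOnWith K (fderiv ℝ h) W

/-- `H` is of class `C^{1,1}` near `p`: it has graph charts at `p`, and in each of them the local
graph function is of class `C^{1,1}` near the point corresponding to `p`. -/
def IsC11NearPoint (S : Spacetime n M) (H : Set M) (p : M) : Prop :=
  (∃ e Ω h, S.IsGraphChart H p e Ω h) ∧
    ∀ e Ω h, S.IsGraphChart H p e Ω h → IsC11Near h (spatial (e p))

/-- `H` is of class `C^{1,1}_loc` on its subset `A` (open in `H`). -/
def IsC11LocOn (S : Spacetime n M) (H A : Set M) : Prop :=
  ∀ p ∈ A, S.IsC11NearPoint H p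

/-- The set of the points at which `H` is differentiable. -/
def differentiabilitySet (S : Spacetime n M) (H : Set M) : Set M :=
  {p ∈ H | S.DifferentiableAtPoint H p}

/-- The interior of `A ∩ H` relative to `H`, as a subset of `M`. -/
def _root_.NullHorizon.relInterior {M : Type*} [TopologicalSpace M] (H A : Set M) : Set M :=
  (Subtype.val : H → M) '' interior ((Subtype.val : H → M) ⁻¹' A)

end Spacetime

end NullHorizon

/-!
The proof works in a graph chart around a point of the horizon `H`. There `H` is the zero set of a
continuous function `height`, the coordinate vector `∂₀` is timelike, and achronality says that no
future-directed timelike curve goes from a point on or above `H` to a point on or below `H`. Such a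
picture is an `AchronalGraph`; a horizon has one around each of its points, because vertical lines
are timelike and hence meet `H` at most once (`exists_isGraphChart`, `exists_achronalGraph`).

Everything rests on one variational fact: a causal curve along which the first variation of the
energy `g(v, v)` is negative becomes timelike under a small variation
(`AchronalGraph.exists_timelike_variation`). Vertical variations show that a causal curve which has
left `H` to the future does not come back, so that the beginning of a causal curve joining two
points of `H` lies in `H`. Variations with free vertical part show that a causal curve contained in
`H` satisfies the geodesic equation up to a positive multiplier (`AchronalGraph.exists_multiplier`),
which a reparametrization removes. Thus from each point of a past horizon a null geodesic contained
in `H` departs to the future, and from each point of a future horizon one departs to the past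
(`IsPicture.exists_starts`). Varying such a geodesic with fixed final point bounds `H` near its
initial point on one side of the null hyperplane orthogonal to it, up to an error which is quadratic
(`AchronalGraph.exists_quadratic_bound`), with uniform constants as long as geodesics in `H` extend
(`AchronalGraph.exists_uniform_time`).

Where `H` has no endpoints, null geodesics in `H` extend in both time directions, since each of them
is part of a generator (`exists_isGenerator`, by Zorn's lemma). The two quadratic bounds then
combine to a two-sided one with uniform constants, and a function with such bounds is of class
`C^{1,1}` (`isC11Near_of_extends`). In particular it is differentiable.

Conversely, where `H` is differentiable, the quadratic bound forces every null geodesic in `H` to be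
orthogonal to the tangent hyperplane, so its direction is determined by its position. Hence a
geodesic arriving at a point and one departing from it fit together without a corner
(`AchronalGraph.extends_of_differentiable`), and the bounds hold with uniform constants. These are
closed conditions, so the normalized null direction is continuous. By Peano's theorem it has an
integral curve running in the opposite time direction, which is a causal curve in `H`, hence a null
geodesic (`AchronalGraph.starts_neg_of_differentiable`). So null geodesics depart from each point in
both time directions, and no generator ends there (`IsPicture.not_isEndpoint`).
-/

set_option maxSynthPendingDepth 3
set_option linter.unusedSectionVars false

namespace NullHorizon

/-! ### Coordinate pictures of horizons -/

variable {E : Type*} [NormedAddCommGroup E] [NormedSpace ℝ E]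

/-- `c` is a `C¹` curve on the interval `[a, b]`, with velocity `v`. -/
def C1Curve (c v : ℝ → E) (a b : ℝ) : Prop :=
  (∀ t ∈ Icc a b, HasDerivWithinAt c (v t) (Icc a b) t) ∧ ContinuousOn v (Icc a b)

lemma C1Curve.continuousOn {c v : ℝ → E}
    {a b : ℝ} (h : C1Curve c v a b) : ContinuousOn c (Icc a b) :=
  fun t ht => (h.1 t ht).continuousWithinAt

lemma C1Curve.mono {c v : ℝ → E}
    {a b a' b' : ℝ} (h : C1Curve c v a b) (hs : Icc a' b' ⊆ Icc a b) : C1Curve c v a' b' :=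
  ⟨fun t ht => (h.1 t (hs ht)).mono hs, h.2.mono hs⟩

lemma C1Curve.add_smul {c v η w : ℝ → E}
    {a b : ℝ} (h : C1Curve c v a b) (h' : C1Curve η w a b) (ε : ℝ) :
    C1Curve (fun t => c t + ε • η t) (fun t => v t + ε • w t) a b :=
  ⟨fun t ht => (h.1 t ht).add ((h'.1 t ht).const_smul ε), h.2.add (h'.2.const_smul ε)⟩

/-- The picture of an achronal hypersurface in a graph chart of a Lorentzian manifold: on the ball
with centre `ctr` and radius `r` a metric `G` of class `C²`, with bounds on its size and its first
two derivatives, and with a unit vector `e₀` to which no causal vector is orthogonal, uniformly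
(`cone`); the number `height y`, the signed vertical distance of `y` from the hypersurface
`{height = 0}`; and the achronality of that hypersurface, in the form that no future-directed
timelike curve goes from a point on or above it to a point on or below it, and dually. The sign `σ`
distinguishes future-directed (`σ = 1`) from past-directed (`σ = -1`) vectors. -/
structure AchronalGraph (E : Type*) [NormedAddCommGroup E] [NormedSpace ℝ E] where
  e₀ : E
  norm_e₀ : ‖e₀‖ = 1
  ctr : E
  r : ℝ
  r_pos : 0 < r
  G : E → E →L[ℝ] E →L[ℝ] ℝ
  height : E → ℝ
  K : ℝ
  κ : ℝ
  K_pos : 0 < K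
  κ_pos : 0 < κ
  symm : ∀ y ∈ Metric.ball ctr r, ∀ u v, G y u v = G y v u
  smooth : ∀ y ∈ Metric.ball ctr r, ContDiffAt ℝ 2 G y
  bound : ∀ y ∈ Metric.ball ctr r, ‖G y‖ ≤ K
  bound' : ∀ y ∈ Metric.ball ctr r, ‖fderiv ℝ G y‖ ≤ K
  lip : ∀ y ∈ Metric.ball ctr r, ∀ z ∈ Metric.ball ctr r, ‖G z - G y‖ ≤ K * ‖z - y‖
  taylor : ∀ y ∈ Metric.ball ctr r, ∀ z ∈ Metric.ball ctr r,
    ‖G z - G y - fderiv ℝ G y (z - y)‖ ≤ K * ‖z - y‖ ^ 2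
  cone : ∀ y ∈ Metric.ball ctr r, ∀ v, G y v v ≤ 0 → κ * ‖v‖ ≤ |G y e₀ v|
  continuousOn_height : ContinuousOn height (Metric.ball ctr r)
  height_add : ∀ y (s : ℝ), height (y + s • e₀) = height y + s
  achronal : ∀ (σ : ℝ) (c v : ℝ → E) (a b : ℝ), (σ = 1 ∨ σ = -1) → a < b → C1Curve c v a b →
    (∀ t ∈ Icc a b, c t ∈ Metric.ball ctr r ∧ G (c t) (v t) (v t) < 0 ∧
      σ * G (c t) e₀ (v t) < 0) →
    0 ≤ σ * height (c a) → 0 < σ * height (c b)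

namespace AchronalGraph

variable (A : AchronalGraph E)

/-- The coordinate ball on which the picture lives. -/
abbrev ball : Set E := Metric.ball A.ctr A.r

/-- `v` is a causal vector at `y`, future-directed if `σ = 1` and past-directed if `σ = -1`. -/
def Causal (σ : ℝ) (y v : E) : Prop := v ≠ 0 ∧ A.G y v v ≤ 0 ∧ σ * A.G y A.e₀ v < 0

/-- The derivative of the metric. -/
noncomputable def G' (y : E) : E →L[ℝ] E →L[ℝ] E →L[ℝ] ℝ := fderiv ℝ A.G y

variable {A}

lemma hasFDerivAt_G {y : E} (hy : y ∈ A.ball) : HasFDerivAt A.G (A.G' y) y :=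
  ((A.smooth y hy).differentiableAt (by norm_num)).hasFDerivAt

lemma continuousOn_G : ContinuousOn A.G A.ball :=
  fun y hy => (A.smooth y hy).continuousAt.continuousWithinAt

lemma continuousOn_G' : ContinuousOn A.G' A.ball := by
  intro y hy
  exact ((A.smooth y hy).fderiv_right (m := 1) (by norm_num)).continuousAt.continuousWithinAt

lemma abs_G_le {y : E} (hy : y ∈ A.ball) (u v : E) :
    |A.G y u v| ≤ A.K * ‖u‖ * ‖v‖ := by
  have := (A.G y).le_opNorm₂ u v
  rw [Real.norm_eq_abs] at this
  refine this.trans ?_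
  gcongr
  exact A.bound y hy

lemma abs_G'_le {y : E} (hy : y ∈ A.ball) (x u v : E) :
    |A.G' y x u v| ≤ A.K * ‖x‖ * ‖u‖ * ‖v‖ := by
  have := (A.G' y x).le_opNorm₂ u v
  rw [Real.norm_eq_abs] at this
  refine this.trans ?_
  gcongr
  exact ((A.G' y).le_opNorm x).trans (by gcongr; exact A.bound' y hy)

lemma G'_symm {y : E} (hy : y ∈ A.ball) (x u v : E) :
    A.G' y x u v = A.G' y x v u := by
  have h0 := hasFDerivAt_G hy
  have h1 := (h0.clm_apply (hasFDerivAt_const u y)).clm_apply (hasFDerivAt_const v y)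
  have h2 := (h0.clm_apply (hasFDerivAt_const v y)).clm_apply (hasFDerivAt_const u y)
  have h3 : (fun z => A.G z u v) =ᶠ[𝓝 y] fun z => A.G z v u := by
    filter_upwards [Metric.isOpen_ball.mem_nhds hy] with z hz using A.symm z hz u v
  have := (h1.congr_of_eventuallyEq h3.symm).unique h2
  simpa using DFunLike.congr_fun this x

/-- Second order expansion of the energy `G(v, v)` when base point and vector vary. -/
lemma abs_energy_sub_le {y η v w : E} {M : ℝ} (hy : y ∈ A.ball) (hyη : y + η ∈ A.ball)
    (hv : ‖v‖ ≤ M) (hw : ‖w‖ ≤ 1) :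
    |A.G (y + η) (v + w) (v + w) - (A.G y v v + (2 * A.G y v w + A.G' y η v v))| ≤
      A.K * (‖w‖ + (M + 1) * ‖η‖) ^ 2 := by
  have hK := A.K_pos
  have hM : 0 ≤ M := (norm_nonneg v).trans hv
  set R : E →L[ℝ] E →L[ℝ] ℝ := A.G (y + η) - A.G y - A.G' y η with hR
  have hRn : ‖R‖ ≤ A.K * ‖η‖ ^ 2 := by
    have := A.taylor y hy (y + η) hyη
    rwa [add_sub_cancel_left] at this
  have hu : ‖v + w‖ ≤ M + 1 := (norm_add_le _ _).trans (add_le_add hv hw)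
  have e1 : |R (v + w) (v + w)| ≤ A.K * ‖η‖ ^ 2 * (M + 1) ^ 2 := by
    have := R.le_opNorm₂ (v + w) (v + w)
    rw [Real.norm_eq_abs] at this
    refine this.trans ?_
    rw [mul_assoc, ← sq]
    gcongr
  have e2 : |A.G y w w| ≤ A.K * ‖w‖ ^ 2 := by
    have := abs_G_le hy w w; rw [mul_assoc, ← sq] at this; exact this
  have e3 : |A.G' y η v w| ≤ A.K * ‖η‖ * M * ‖w‖ :=
    (abs_G'_le hy η v w).trans (by gcongr)
  have e4 : |A.G' y η w w| ≤ A.K * ‖η‖ * 1 * ‖w‖ :=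
    (abs_G'_le hy η w w).trans (by gcongr)
  have key : A.G (y + η) (v + w) (v + w) - (A.G y v v + (2 * A.G y v w + A.G' y η v v)) =
      R (v + w) (v + w) + A.G y w w + 2 * A.G' y η v w + A.G' y η w w := by
    have h1 := A.symm y hy w v
    have h2 := G'_symm hy η w v
    simp only [hR, sub_apply, map_add, add_apply]
    rw [h1, h2]; ring
  rw [key]
  have p0 : 0 ≤ A.K * ‖η‖ * ‖w‖ := by positivity
  rw [abs_le] at *
  constructor <;> nlinarith

/-- A causal curve whose first variation of energy is negative becomes timelike under a small
variation. -/
lemma exists_timelike_variation {σ : ℝ} (hσ : σ = 1 ∨ σ = -1) {c v η w : ℝ → E} {a b : ℝ}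
    (hab : a ≤ b) (hc : C1Curve c v a b) (hη : C1Curve η w a b)
    (hcau : ∀ t ∈ Icc a b, c t ∈ A.ball ∧ A.Causal σ (c t) (v t))
    (hneg : ∀ t ∈ Icc a b, 2 * A.G (c t) (v t) (w t) + A.G' (c t) (η t) (v t) (v t) < 0) :
    ∃ ε₀ > 0, ∀ ε : ℝ, 0 < ε → ε ≤ ε₀ → ∀ t ∈ Icc a b, c t + ε • η t ∈ A.ball ∧
      A.G (c t + ε • η t) (v t + ε • w t) (v t + ε • w t) < 0 ∧
      σ * A.G (c t + ε • η t) A.e₀ (v t + ε • w t) < 0 := by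
  have hne : (Icc a b).Nonempty := nonempty_Icc.2 hab
  have hK := A.K_pos
  have hmaps : MapsTo c (Icc a b) A.ball := fun t ht => (hcau t ht).1
  have cG : ContinuousOn (fun t => A.G (c t)) (Icc a b) := continuousOn_G.comp hc.continuousOn hmaps
  have cG' : ContinuousOn (fun t => A.G' (c t)) (Icc a b) :=
    continuousOn_G'.comp hc.continuousOn hmaps
  have cη := hη.continuousOn
  obtain ⟨M, hM⟩ := isCompact_Icc.exists_bound_of_continuousOn hc.2
  obtain ⟨N₁, hN₁⟩ := isCompact_Icc.exists_bound_of_continuousOn cη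
  obtain ⟨N₂, hN₂⟩ := isCompact_Icc.exists_bound_of_continuousOn hη.2
  have hM0 : 0 ≤ M := (norm_nonneg _).trans (hM a (left_mem_Icc.2 hab))
  set N := max (max N₁ N₂) 1 with hN
  have hN1 : 1 ≤ N := le_max_right _ _
  have cq : ContinuousOn (fun t => 2 * A.G (c t) (v t) (w t) + A.G' (c t) (η t) (v t) (v t))
      (Icc a b) :=
    (continuousOn_const.mul ((cG.clm_apply hc.2).clm_apply hη.2)).add
      (((cG'.clm_apply cη).clm_apply hc.2).clm_apply hc.2)
  have cp : ContinuousOn (fun t => σ * A.G (c t) A.e₀ (v t)) (Icc a b) :=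
    continuousOn_const.mul ((cG.clm_apply continuousOn_const).clm_apply hc.2)
  have cd : ContinuousOn (fun t => dist (c t) A.ctr) (Icc a b) :=
    (Continuous.dist continuous_id continuous_const).comp_continuousOn hc.continuousOn
  -- by compactness, the first variation, the time orientation and the membership in the ball hold
  -- with margins `δ₁`, `δ₂`, `δ₃`; a short variation respects all three
  obtain ⟨t₁, ht₁, h₁⟩ := isCompact_Icc.exists_isMaxOn hne cq
  obtain ⟨t₂, ht₂, h₂⟩ := isCompact_Icc.exists_isMaxOn hne cp
  obtain ⟨t₃, ht₃, h₃⟩ := isCompact_Icc.exists_isMaxOn hne cd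
  set δ₁ := -(2 * A.G (c t₁) (v t₁) (w t₁) + A.G' (c t₁) (η t₁) (v t₁) (v t₁)) with hδ₁
  set δ₂ := -(σ * A.G (c t₂) A.e₀ (v t₂)) with hδ₂
  set δ₃ := A.r - dist (c t₃) A.ctr with hδ₃
  have p₁ : 0 < δ₁ := by have := hneg t₁ ht₁; linarith
  have p₂ : 0 < δ₂ := by have := (hcau t₂ ht₂).2.2.2; linarith
  have p₃ : 0 < δ₃ := by have := (hcau t₃ ht₃).1; rw [Metric.mem_ball] at this; linarith
  set L := A.K * (N + (M + 1) * N) ^ 2 with hL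
  set L' := A.K * N * (M + 1) + A.K * N with hL'
  have pL : 0 < L := by positivity
  have pL' : 0 < L' := by positivity
  refine ⟨min (min (δ₁ / (2 * L)) (δ₂ / (2 * L'))) (min (δ₃ / (2 * N)) (1 / N)), by positivity, ?_⟩
  intro ε hε hε' t ht
  simp only [le_min_iff] at hε'
  obtain ⟨⟨h1, h2⟩, h3, h4⟩ := hε'
  rw [le_div_iff₀ (by positivity)] at h1 h2 h3 h4
  have nη : ‖ε • η t‖ ≤ ε * N := by
    rw [norm_smul, Real.norm_eq_abs, abs_of_pos hε]
    gcongr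
    exact (hN₁ t ht).trans ((le_max_left _ _).trans (le_max_left _ _))
  have nw : ‖ε • w t‖ ≤ ε * N := by
    rw [norm_smul, Real.norm_eq_abs, abs_of_pos hε]
    gcongr
    exact (hN₂ t ht).trans ((le_max_right _ _).trans (le_max_left _ _))
  have hvM := hM t ht
  have hy := (hcau t ht).1
  have hyη : c t + ε • η t ∈ A.ball := by
    have hd : dist (c t) A.ctr ≤ dist (c t₃) A.ctr := h₃ ht
    rw [Metric.mem_ball, dist_eq_norm] at *
    calc ‖c t + ε • η t - A.ctr‖ = ‖(c t - A.ctr) + ε • η t‖ := by congr 1; abel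
      _ ≤ ‖c t - A.ctr‖ + ‖ε • η t‖ := norm_add_le _ _
      _ < A.r := by rw [dist_eq_norm] at hd; nlinarith
  have nw1 : ‖ε • w t‖ ≤ 1 := nw.trans (by linarith)
  refine ⟨hyη, ?_, ?_⟩
  · have hE := abs_energy_sub_le hy hyη hvM nw1
    have hq : 2 * A.G (c t) (v t) (w t) + A.G' (c t) (η t) (v t) (v t) ≤ -δ₁ := by
      rw [hδ₁, neg_neg]; exact h₁ ht
    have e : 2 * A.G (c t) (v t) (ε • w t) + A.G' (c t) (ε • η t) (v t) (v t) =
        ε * (2 * A.G (c t) (v t) (w t) + A.G' (c t) (η t) (v t) (v t)) := by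
      simp only [map_smul, smul_apply, smul_eq_mul]; ring
    rw [e] at hE
    have hb : A.K * (‖ε • w t‖ + (M + 1) * ‖ε • η t‖) ^ 2 ≤ ε ^ 2 * L := by
      calc _ ≤ A.K * (ε * N + (M + 1) * (ε * N)) ^ 2 := by gcongr
        _ = _ := by rw [hL]; ring
    have h0 := (hcau t ht).2.2.1
    have h5 : ε * (2 * A.G (c t) (v t) (w t) + A.G' (c t) (η t) (v t) (v t)) ≤ ε * (-δ₁) := by
      gcongr
    have h6 := (abs_le.1 hE).2
    have h7 : ε ^ 2 * L ≤ ε * (δ₁ / 2) := by nlinarith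
    have h8 : 0 < ε * δ₁ := by positivity
    linarith
  · have hq : σ * A.G (c t) A.e₀ (v t) ≤ -δ₂ := by rw [hδ₂, neg_neg]; exact h₂ ht
    have b1 : |(A.G (c t + ε • η t) - A.G (c t)) A.e₀ (v t + ε • w t)| ≤
        A.K * (ε * N) * (M + 1) := by
      have := (A.G (c t + ε • η t) - A.G (c t)).le_opNorm₂ A.e₀ (v t + ε • w t)
      rw [Real.norm_eq_abs, A.norm_e₀, mul_one] at this
      refine this.trans ?_
      gcongr
      · have h := A.lip (c t) hy _ hyη
        rw [add_sub_cancel_left] at h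
        exact h.trans (by gcongr)
      · exact (norm_add_le _ _).trans (add_le_add hvM nw1)
    have b2 : |A.G (c t) A.e₀ (ε • w t)| ≤ A.K * (ε * N) := by
      refine (abs_G_le hy _ _).trans ?_
      rw [A.norm_e₀, mul_one]; gcongr
    have e : A.G (c t + ε • η t) A.e₀ (v t + ε • w t) = A.G (c t) A.e₀ (v t) +
        (A.G (c t + ε • η t) - A.G (c t)) A.e₀ (v t + ε • w t) + A.G (c t) A.e₀ (ε • w t) := by
      simp only [sub_apply, map_add]; ring
    rw [e]
    have : ε * L' ≤ δ₂ / 2 := by linarith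
    have e3 : A.K * (ε * N) * (M + 1) + A.K * (ε * N) = ε * L' := by rw [hL']; ring
    rw [abs_le] at b1 b2
    rcases hσ with rfl | rfl <;> linarith

/-- Vertical variations of a causal curve, directed according to `σ τ` and growing (`τ = 1`) or
decaying (`τ = -1`) exponentially along it, make it timelike. -/
lemma exists_vertical_variation {σ : ℝ} (hσ : σ = 1 ∨ σ = -1) {τ : ℝ} (hτ : τ = 1 ∨ τ = -1)
    {c v : ℝ → E} {a b : ℝ} (hab : a ≤ b) (hc : C1Curve c v a b)
    (hcau : ∀ t ∈ Icc a b, c t ∈ A.ball ∧ A.Causal σ (c t) (v t)) :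
    ∃ ε₀ > 0, ∃ m : ℝ, ∀ ε : ℝ, 0 < ε → ε ≤ ε₀ → ∃ c' v' : ℝ → E, C1Curve c' v' a b ∧
      (∀ t, c' t = c t + (σ * τ * ε * Real.exp (τ * m * t)) • A.e₀) ∧
      ∀ t ∈ Icc a b, c' t ∈ A.ball ∧ A.G (c' t) (v' t) (v' t) < 0 ∧
        σ * A.G (c' t) A.e₀ (v' t) < 0 := by
  have hne : (Icc a b).Nonempty := nonempty_Icc.2 hab
  have hmaps : MapsTo c (Icc a b) A.ball := fun t ht => (hcau t ht).1
  have cG : ContinuousOn (fun t => A.G (c t)) (Icc a b) := continuousOn_G.comp hc.continuousOn hmaps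
  have cp : ContinuousOn (fun t => σ * A.G (c t) A.e₀ (v t)) (Icc a b) :=
    continuousOn_const.mul ((cG.clm_apply continuousOn_const).clm_apply hc.2)
  obtain ⟨M, hM⟩ := isCompact_Icc.exists_bound_of_continuousOn hc.2
  obtain ⟨t₂, ht₂, h₂⟩ := isCompact_Icc.exists_isMaxOn hne cp
  set δ := -(σ * A.G (c t₂) A.e₀ (v t₂)) with hδ
  have pδ : 0 < δ := by have := (hcau t₂ ht₂).2.2.2; linarith
  have hM0 : 0 ≤ M := (norm_nonneg _).trans (hM a (left_mem_Icc.2 hab))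
  have hK := A.K_pos
  -- the rate `m` makes the growth of the vertical variation dominate the derivative of the metric
  set m := A.K * M ^ 2 / δ + 1 with hm
  have hη : C1Curve (fun t => (σ * τ * Real.exp (τ * m * t)) • A.e₀)
      (fun t => (σ * m * Real.exp (τ * m * t)) • A.e₀) a b := by
    constructor
    · intro t _
      have h1 : HasDerivAt (fun t : ℝ => τ * m * t) (τ * m) t := by
        simpa using (hasDerivAt_id t).const_mul (τ * m)
      have h2 := ((h1.exp.const_mul (σ * τ)).smul_const A.e₀).hasDerivWithinAt (s := Icc a b)
      convert h2 using 2
      have : τ * τ = 1 := by rcases hτ with rfl | rfl <;> norm_num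
      linear_combination (-σ * m * Real.exp (τ * m * t)) * this
    · fun_prop
  obtain ⟨ε₀, hε₀, H⟩ := exists_timelike_variation hσ hab hc hη hcau (by
    intro t ht
    have hy := (hcau t ht).1
    have hq : σ * A.G (c t) A.e₀ (v t) ≤ -δ := by rw [hδ, neg_neg]; exact h₂ ht
    have hs := A.symm (c t) hy A.e₀ (v t)
    have hb := abs_G'_le hy A.e₀ (v t) (v t)
    rw [A.norm_e₀, mul_one, mul_assoc, ← sq] at hb
    have hb2 : A.K * ‖v t‖ ^ 2 ≤ A.K * M ^ 2 := by gcongr; exact hM t ht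
    have hx := Real.exp_pos (τ * m * t)
    simp only [map_smul, smul_apply, smul_eq_mul]
    rw [← hs]
    have hmd : δ * m = A.K * M ^ 2 + δ := by rw [hm]; field_simp
    have : 2 * (m * (σ * A.G (c t) A.e₀ (v t))) + σ * τ * A.G' (c t) A.e₀ (v t) (v t) < 0 := by
      have h1 : σ * τ * A.G' (c t) A.e₀ (v t) (v t) ≤ A.K * M ^ 2 := by
        rw [abs_le] at hb
        rcases hσ with rfl | rfl <;> rcases hτ with rfl | rfl <;> linarith
      have hm0 : 0 < m := by positivity
      have : m * (σ * A.G (c t) A.e₀ (v t)) ≤ m * (-δ) := by gcongr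
      nlinarith [mul_nonneg hK.le (sq_nonneg M)]
    nlinarith)
  refine ⟨ε₀, hε₀, m, fun ε hε hε' => ⟨_, _, hc.add_smul hη ε, fun t => ?_, H ε hε hε'⟩⟩
  rw [smul_smul]; congr 2; ring

/-- A causal curve starting on or above the hypersurface (below, if `σ = -1`) stays there. -/
lemma height_nonneg_of_causal {σ : ℝ} (hσ : σ = 1 ∨ σ = -1) {c v : ℝ → E} {a b : ℝ}
    (hab : a < b) (hc : C1Curve c v a b)
    (hcau : ∀ t ∈ Icc a b, c t ∈ A.ball ∧ A.Causal σ (c t) (v t))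
    (ha : 0 ≤ σ * A.height (c a)) : 0 ≤ σ * A.height (c b) := by
  by_contra! hb
  -- a timelike curve close to `c` would start above the hypersurface and end on or below it
  obtain ⟨ε₀, hε₀, m, H⟩ := exists_vertical_variation hσ (Or.inl rfl) hab.le hc hcau
  have hx := Real.exp_pos (1 * m * b)
  set ε := min ε₀ (-(σ * A.height (c b)) / Real.exp (1 * m * b)) with hε
  have pε : 0 < ε := lt_min hε₀ (div_pos (by linarith) hx)
  obtain ⟨c', v', hC, hc', hT⟩ := H ε pε (min_le_left _ _)
  have hσ2 : σ * σ = 1 := by rcases hσ with rfl | rfl <;> norm_num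
  have h1 := A.achronal σ c' v' a b hσ hab hC hT (by
    rw [hc', A.height_add]
    have := Real.exp_pos (1 * m * a)
    have e : σ * (A.height (c a) + σ * 1 * ε * Real.exp (1 * m * a)) =
      σ * A.height (c a) + σ * σ * (ε * Real.exp (1 * m * a)) := by ring
    rw [e, hσ2]; positivity)
  rw [hc', A.height_add] at h1
  have h2 : ε * Real.exp (1 * m * b) ≤ -(σ * A.height (c b)) := by
    rw [← le_div_iff₀ hx]; exact min_le_right _ _
  have e : σ * (A.height (c b) + σ * 1 * ε * Real.exp (1 * m * b)) =
      σ * A.height (c b) + σ * σ * (ε * Real.exp (1 * m * b)) := by ring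
  rw [e, hσ2] at h1
  linarith

/-- A causal curve starting strictly above the hypersurface (below, if `σ = -1`) stays there. -/
lemma height_pos_of_causal {σ : ℝ} (hσ : σ = 1 ∨ σ = -1) {c v : ℝ → E} {a b : ℝ}
    (hab : a < b) (hc : C1Curve c v a b)
    (hcau : ∀ t ∈ Icc a b, c t ∈ A.ball ∧ A.Causal σ (c t) (v t))
    (ha : 0 < σ * A.height (c a)) : 0 < σ * A.height (c b) := by
  -- a timelike curve slightly below `c` still starts on or above the hypersurface, so it ends
  -- above it, and so does `c`
  obtain ⟨ε₀, hε₀, m, H⟩ := exists_vertical_variation hσ (Or.inr rfl) hab.le hc hcau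
  have hx := Real.exp_pos (-1 * m * a)
  set ε := min ε₀ ((σ * A.height (c a)) / Real.exp (-1 * m * a)) with hε
  have pε : 0 < ε := lt_min hε₀ (div_pos ha hx)
  obtain ⟨c', v', hC, hc', hT⟩ := H ε pε (min_le_left _ _)
  have hσ2 : σ * σ = 1 := by rcases hσ with rfl | rfl <;> norm_num
  have h2 : ε * Real.exp (-1 * m * a) ≤ (σ * A.height (c a)) := by
    rw [← le_div_iff₀ hx]; exact min_le_right _ _
  have h1 := A.achronal σ c' v' a b hσ hab hC hT (by
    rw [hc', A.height_add]
    have e : σ * (A.height (c a) + σ * -1 * ε * Real.exp (-1 * m * a)) =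
      σ * A.height (c a) - σ * σ * (ε * Real.exp (-1 * m * a)) := by ring
    rw [e, hσ2]; linarith)
  rw [hc', A.height_add] at h1
  have e : σ * (A.height (c b) + σ * -1 * ε * Real.exp (-1 * m * b)) =
      σ * A.height (c b) - σ * σ * (ε * Real.exp (-1 * m * b)) := by ring
  rw [e, hσ2] at h1
  have := mul_pos pε (Real.exp_pos (-1 * m * b))
  linarith

/-- A `C¹` causal curve, directed according to `σ`, goes inside the coordinate ball from `y`
to `z`. -/
def Step (A : AchronalGraph E) (σ : ℝ) (y z : E) : Prop :=
  ∃ c v : ℝ → E, C1Curve c v 0 1 ∧ c 0 = y ∧ c 1 = z ∧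
    ∀ t ∈ Icc (0 : ℝ) 1, c t ∈ A.ball ∧ A.Causal σ (c t) (v t)

lemma Step.height_pos {σ : ℝ} (hσ : σ = 1 ∨ σ = -1) {y z : E} (h : A.Step σ y z)
    (hy : 0 < σ * A.height y) : 0 < σ * A.height z := by
  obtain ⟨c, v, hC, rfl, rfl, hcau⟩ := h
  exact height_pos_of_causal hσ zero_lt_one hC hcau hy

/-- The beginning of a broken causal curve between two points of an achronal hypersurface lies in
the hypersurface. -/
lemma exists_causal_curve_of_reflTransGen {σ : ℝ} (hσ : σ = 1 ∨ σ = -1) {y z : E}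
    (h : Relation.ReflTransGen (A.Step σ) y z) (hyz : y ≠ z) (hy : A.height y = 0)
    (hz : A.height z = 0) :
    ∃ c v : ℝ → E, C1Curve c v 0 1 ∧ c 0 = y ∧
      ∀ t ∈ Icc (0 : ℝ) 1, c t ∈ A.ball ∧ A.Causal σ (c t) (v t) ∧ A.height (c t) = 0 := by
  -- once the curve has left the hypersurface upwards, it cannot come back to `z`
  have up : ∀ x, Relation.ReflTransGen (A.Step σ) x z → ¬ 0 < σ * A.height x := by
    intro x hx hpos
    induction hx using Relation.ReflTransGen.head_induction_on with
    | refl => rw [hz] at hpos; simp at hpos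
    | head h _ ih => exact ih (h.height_pos hσ hpos)
  rcases Relation.ReflTransGen.cases_head h with h | ⟨x, hx, hxz⟩
  · exact absurd h hyz
  obtain ⟨c, v, hC, h0, h1, hcau⟩ := hx
  refine ⟨c, v, hC, h0, fun t ht => ⟨(hcau t ht).1, (hcau t ht).2, ?_⟩⟩
  have hlo : 0 ≤ σ * A.height (c t) := by
    rcases eq_or_lt_of_le ht.1 with rfl | hpos
    · rw [h0, hy]; simp
    · have hs : Icc 0 t ⊆ Icc (0 : ℝ) 1 := Icc_subset_Icc_right ht.2
      exact height_nonneg_of_causal hσ hpos (hC.mono hs) (fun s hs' => hcau s (hs hs'))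
        (by rw [h0, hy]; simp)
  have hhi : ¬ 0 < σ * A.height (c t) := by
    intro hpos
    refine up x hxz ?_
    rw [← h1]
    rcases eq_or_lt_of_le ht.2 with rfl | hlt
    · exact hpos
    · have hs : Icc t 1 ⊆ Icc (0 : ℝ) 1 := Icc_subset_Icc_left ht.1
      exact height_pos_of_causal hσ hlt (hC.mono hs) (fun s hs' => hcau s (hs hs')) hpos
  rcases hσ with rfl | rfl <;> linarith

end AchronalGraph

end NullHorizon

namespace NullHorizon

variable {E : Type*} [NormedAddCommGroup E] [NormedSpace ℝ E]

/-! ### Causal curves in achronal hypersurfaces are null geodesics -/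

lemma exists_antiderivative {f : ℝ → ℝ} {a b : ℝ} (hab : a ≤ b) (hf : ContinuousOn f (Icc a b)) :
    ∃ F : ℝ → ℝ, F a = 0 ∧ ∀ t ∈ Icc a b, HasDerivWithinAt F (f t) (Icc a b) t := by
  have hg : Continuous (IccExtend hab ((Icc a b).domRestrict f)) :=
    (continuousOn_iff_continuous_domRestrict.1 hf).Icc_extend'
  refine ⟨fun t => ∫ s in a..t, IccExtend hab ((Icc a b).domRestrict f) s, by simp, fun t ht => ?_⟩
  have := (hg.integral_hasStrictDerivAt a t).hasDerivAt.hasDerivWithinAt (s := Icc a b)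
  rwa [IccExtend_of_mem _ _ ht] at this

lemma eq_of_hasDerivWithinAt_zero {f : ℝ → ℝ} {a b : ℝ}
    (hf : ∀ t ∈ Icc a b, HasDerivWithinAt f 0 (Icc a b) t) : ∀ t ∈ Icc a b, f t = f a := by
  rcases lt_or_ge a b with hab | hab
  · refine constant_of_derivWithin_zero (fun t ht => (hf t ht).differentiableWithinAt) ?_
    intro t ht
    exact (hf t (Ico_subset_Icc_self ht)).derivWithin
      (uniqueDiffOn_Icc hab t (Ico_subset_Icc_self ht))
  · intro t ht
    rw [le_antisymm (ht.2.trans hab) ht.1]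

/-- The fundamental lemma of the calculus of variations, for inequalities: if `∫ (p ζ' + q ζ) ≤ 0`
for all `C¹` functions `ζ` which vanish at both ends, then `p' = q`. The integral is expressed by
an antiderivative `W` of the integrand. -/
lemma hasDerivWithinAt_of_first_variation {p q : ℝ → ℝ} {a b : ℝ} (hab : a < b)
    (hp : ContinuousOn p (Icc a b)) (hq : ContinuousOn q (Icc a b))
    (H : ∀ f ζ W : ℝ → ℝ, ContinuousOn f (Icc a b) → ζ a = 0 → ζ b = 0 → W a = 0 →
      (∀ t ∈ Icc a b, HasDerivWithinAt ζ (f t) (Icc a b) t) →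
      (∀ t ∈ Icc a b, HasDerivWithinAt W (p t * f t + q t * ζ t) (Icc a b) t) → W b ≤ 0) :
    ∀ t ∈ Icc a b, HasDerivWithinAt p (q t) (Icc a b) t := by
  have ha : a ∈ Icc a b := left_mem_Icc.2 hab.le
  have hb : b ∈ Icc a b := right_mem_Icc.2 hab.le
  -- test with the primitive `ζ` of the deviation `f` of `p - ∫ q` from its mean `m`
  obtain ⟨I, I0, hI⟩ := exists_antiderivative hab.le hq
  have cI : ContinuousOn I (Icc a b) := fun t ht => (hI t ht).continuousWithinAt
  have cR : ContinuousOn (fun t => p t - I t) (Icc a b) := hp.sub cI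
  obtain ⟨J, J0, hJ⟩ := exists_antiderivative hab.le cR
  set m := J b / (b - a) with hm
  have hba : 0 < b - a := sub_pos.2 hab
  set f : ℝ → ℝ := fun t => p t - I t - m with hf
  have cf : ContinuousOn f (Icc a b) := cR.sub continuousOn_const
  set ζ : ℝ → ℝ := fun t => J t - m * (t - a) with hζ
  have dζ : ∀ t ∈ Icc a b, HasDerivWithinAt ζ (f t) (Icc a b) t := by
    intro t ht
    have h2 : HasDerivAt (fun t => m * (t - a)) m t := by
      simpa using ((hasDerivAt_id t).sub_const a).const_mul m
    exact (hJ t ht).sub h2.hasDerivWithinAt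
  have cζ : ContinuousOn ζ (Icc a b) := fun t ht => (dζ t ht).continuousWithinAt
  have ζa : ζ a = 0 := by simp [hζ, J0]
  have ζb : ζ b = 0 := by simp only [hζ, hm]; field_simp; ring
  obtain ⟨W, W0, hW⟩ := exists_antiderivative hab.le ((hp.mul cf).add (hq.mul cζ))
  obtain ⟨S, S0, hS⟩ := exists_antiderivative hab.le (cf.mul cf)
  have hWb := H f ζ W cf ζa ζb W0 dζ hW
  -- integration by parts turns the first variation into `∫ f²`
  have hWS : W b = S b := by
    have := eq_of_hasDerivWithinAt_zero (f := fun t => W t - S t - m * ζ t - I t * ζ t)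
      (a := a) (b := b) (by
        intro t ht
        have := (((hW t ht).sub (hS t ht)).sub ((dζ t ht).const_mul m)).sub
          ((hI t ht).mul (dζ t ht))
        refine HasDerivWithinAt.congr_deriv this ?_
        simp only [Pi.add_apply, Pi.mul_apply, hf]; ring) b hb
    simp only [W0, S0, ζa, ζb, mul_zero, sub_zero] at this
    linarith
  have mono : MonotoneOn S (Icc a b) := by
    refine monotoneOn_of_deriv_nonneg (convex_Icc a b)
      (fun t ht => (hS t ht).continuousWithinAt) ?_ ?_
    · intro t ht
      rw [interior_Icc] at ht
      exact ((hS t (Ioo_subset_Icc_self ht)).hasDerivAt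
        (Icc_mem_nhds ht.1 ht.2)).differentiableAt.differentiableWithinAt
    · intro t ht
      rw [interior_Icc] at ht
      rw [((hS t (Ioo_subset_Icc_self ht)).hasDerivAt (Icc_mem_nhds ht.1 ht.2)).deriv]
      exact mul_self_nonneg _
  have Sz : ∀ t ∈ Icc a b, S t = 0 := by
    intro t ht
    have h1 := mono ha ht ht.1
    have h2 := mono ht hb ht.2
    linarith
  have fz : ∀ t ∈ Icc a b, f t = 0 := by
    intro t ht
    have h1 : HasDerivWithinAt S 0 (Icc a b) t :=
      (hasDerivWithinAt_const t (Icc a b) (0 : ℝ)).congr Sz (Sz t ht)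
    have h2 := (uniqueDiffOn_Icc hab t ht).eq_deriv (Icc a b) (hS t ht) h1
    exact mul_self_eq_zero.1 h2
  intro t ht
  refine ((hI t ht).add_const m).congr (fun s hs => ?_) ?_
  · have := fz s hs; simp only [hf] at this; linarith
  · have := fz t ht; simp only [hf] at this; linarith

namespace AchronalGraph

variable {A : AchronalGraph E}

/-- A causal curve in an achronal hypersurface is null. -/
lemma null_of_causal {σ : ℝ} (hσ : σ = 1 ∨ σ = -1) {c v : ℝ → E} {a b : ℝ}
    (hab : a < b) (hc : C1Curve c v a b)
    (hcau : ∀ t ∈ Icc a b, c t ∈ A.ball ∧ A.Causal σ (c t) (v t) ∧ A.height (c t) = 0) :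
    ∀ t ∈ Icc a b, A.G (c t) (v t) (v t) = 0 := by
  intro t ht
  by_contra hne
  have hneg := lt_of_le_of_ne (hcau t ht).2.1.2.1 hne
  have cont : ContinuousWithinAt (fun s => A.G (c s) (v s) (v s)) (Icc a b) t :=
    (((continuousOn_G.comp hc.continuousOn (fun s hs => (hcau s hs).1)).clm_apply hc.2).clm_apply
      hc.2) t ht
  have hev := cont (Iio_mem_nhds hneg)
  rw [mem_map, mem_nhdsWithin] at hev
  obtain ⟨u, hu, htu, hsub⟩ := hev
  obtain ⟨ε, hε, hball⟩ := Metric.isOpen_iff.1 hu t htu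
  -- near `t` the curve is timelike, so a short piece of it contradicts achronality
  obtain ⟨a', b', hab', hs1, hs2⟩ : ∃ a' b', a' < b' ∧ Icc a' b' ⊆ Icc a b ∧
      Icc a' b' ⊆ Metric.ball t ε := by
    rcases eq_or_lt_of_le ht.2 with h | h
    · refine ⟨max a (t - ε / 2), t, ?_, ?_, ?_⟩
      · exact max_lt (h ▸ hab) (by linarith)
      · exact Icc_subset_Icc (le_max_left _ _) ht.2
      · intro s hs
        have := (le_max_right _ _).trans hs.1
        rw [Real.ball_eq_Ioo]; exact ⟨by linarith, by linarith [hs.2]⟩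
    · refine ⟨t, min b (t + ε / 2), ?_, ?_, ?_⟩
      · exact lt_min h (by linarith)
      · exact Icc_subset_Icc ht.1 (min_le_left _ _)
      · intro s hs
        have := hs.2.trans (min_le_right _ _)
        rw [Real.ball_eq_Ioo]; exact ⟨by linarith [hs.1], by linarith⟩
  have := A.achronal σ c v a' b' hσ hab' (hc.mono hs1)
    (fun s hs => ⟨(hcau s (hs1 hs)).1, hsub ⟨hball (hs2 hs), hs1 hs⟩, (hcau s (hs1 hs)).2.1.2.2⟩)
    (by rw [(hcau a' (hs1 (left_mem_Icc.2 hab'.le))).2.2]; simp)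
  rw [(hcau b' (hs1 (right_mem_Icc.2 hab'.le))).2.2] at this
  simp at this

/-- A causal curve `c` in an achronal hypersurface satisfies, up to a positive multiplier `μ`, the
Euler–Lagrange equation of the energy: otherwise some variation of it, fixing its initial point and
moving its final point below the hypersurface, would have negative first variation of energy. -/
lemma exists_multiplier {σ : ℝ} (hσ : σ = 1 ∨ σ = -1) {c v : ℝ → E} {a b : ℝ}
    (hab : a < b) (hc : C1Curve c v a b)
    (hcau : ∀ t ∈ Icc a b, c t ∈ A.ball ∧ A.Causal σ (c t) (v t) ∧ A.height (c t) = 0) :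
    ∃ μ : ℝ → ℝ, ContinuousOn μ (Icc a b) ∧ (∀ t ∈ Icc a b, 0 < μ t) ∧ ∀ x, ∀ t ∈ Icc a b,
      HasDerivWithinAt (fun t => μ t * A.G (c t) (v t) x)
        (μ t * (1 / 2 * A.G' (c t) x (v t) (v t))) (Icc a b) t := by
  have ha : a ∈ Icc a b := left_mem_Icc.2 hab.le
  have hb : b ∈ Icc a b := right_mem_Icc.2 hab.le
  have hσ2 : σ * σ = 1 := by rcases hσ with rfl | rfl <;> norm_num
  have hmaps : MapsTo c (Icc a b) A.ball := fun t ht => (hcau t ht).1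
  have cG : ContinuousOn (fun t => A.G (c t)) (Icc a b) := continuousOn_G.comp hc.continuousOn hmaps
  have cG' : ContinuousOn (fun t => A.G' (c t)) (Icc a b) :=
    continuousOn_G'.comp hc.continuousOn hmaps
  have cP : ∀ x, ContinuousOn (fun t => A.G (c t) (v t) x) (Icc a b) := fun x =>
    (cG.clm_apply hc.2).clm_apply continuousOn_const
  have cQ : ∀ x, ContinuousOn (fun t => 1 / 2 * A.G' (c t) x (v t) (v t)) (Icc a b) := fun x =>
    continuousOn_const.mul (((cG'.clm_apply continuousOn_const).clm_apply hc.2).clm_apply hc.2)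
  set P₀ : ℝ → ℝ := fun t => A.G (c t) (v t) A.e₀ with hP₀
  set Q₀ : ℝ → ℝ := fun t => 1 / 2 * A.G' (c t) A.e₀ (v t) (v t) with hQ₀
  have sP : ∀ t ∈ Icc a b, 0 < -σ * P₀ t := by
    intro t ht
    have h1 := (hcau t ht).2.1.2.2
    rw [A.symm _ (hmaps ht)] at h1
    simp only [hP₀]; linarith
  have nP : ∀ t ∈ Icc a b, P₀ t ≠ 0 := by
    intro t ht h0
    have := sP t ht; rw [h0] at this; simp at this
  -- the multiplier is determined by the equation in the direction of `e₀`
  obtain ⟨L, L0, hL⟩ := exists_antiderivative hab.le ((cQ A.e₀).div (cP A.e₀) nP)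
  have dX : ∀ t ∈ Icc a b, HasDerivWithinAt (fun t => Real.exp (L t))
      (Real.exp (L t) * (Q₀ t / P₀ t)) (Icc a b) t := fun t ht => (hL t ht).exp
  have cX : ContinuousOn (fun t => Real.exp (L t)) (Icc a b) :=
    fun t ht => (dX t ht).continuousWithinAt
  set μ : ℝ → ℝ := fun t => Real.exp (L t) / (-σ * P₀ t) with hμ
  have μpos : ∀ t ∈ Icc a b, 0 < μ t := fun t ht => div_pos (Real.exp_pos _) (sP t ht)
  have cμ : ContinuousOn μ (Icc a b) :=
    cX.div (continuousOn_const.mul (cP A.e₀)) (fun t ht => (sP t ht).ne')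
  refine ⟨μ, cμ, μpos, fun x => ?_⟩
  refine hasDerivWithinAt_of_first_variation hab (cμ.mul (cP x)) (cμ.mul (cQ x)) ?_
  intro f ζ W cf ζa ζb W0 dζ dW
  by_contra! hWb
  -- The variation `α e₀ - ζ x` has first variation of energy `-2 δ / μ < 0` for a suitable vertical
  -- part `α`; this `α` vanishes at `a`, and at `b` it moves the curve to the wrong side.
  set δ := W b / (2 * (b - a)) with hδ
  have hba : 0 < b - a := sub_pos.2 hab
  have pδ : 0 < δ := by positivity
  set Y : ℝ → ℝ := fun t => W t - δ * (t - a) with hY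
  set Y' : ℝ → ℝ := fun t => μ t * A.G (c t) (v t) x * f t +
    μ t * (1 / 2 * A.G' (c t) x (v t) (v t)) * ζ t - δ with hY'
  have dY : ∀ t ∈ Icc a b, HasDerivWithinAt Y (Y' t) (Icc a b) t := by
    intro t ht
    have h2 : HasDerivAt (fun t => δ * (t - a)) δ t := by
      simpa using ((hasDerivAt_id t).sub_const a).const_mul δ
    exact (dW t ht).sub h2.hasDerivWithinAt
  have cY : ContinuousOn Y (Icc a b) := fun t ht => (dY t ht).continuousWithinAt
  have cζ : ContinuousOn ζ (Icc a b) := fun t ht => (dζ t ht).continuousWithinAt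
  have cY' : ContinuousOn Y' (Icc a b) :=
    (((cμ.mul (cP x)).mul cf).add ((cμ.mul (cQ x)).mul cζ)).sub continuousOn_const
  set α : ℝ → ℝ := fun t => -σ * (Y t / Real.exp (L t)) with hα
  set α' : ℝ → ℝ := fun t => -σ * ((Y' t * Real.exp (L t) -
    Y t * (Real.exp (L t) * (Q₀ t / P₀ t))) / Real.exp (L t) ^ 2) with hα'
  have dα : ∀ t ∈ Icc a b, HasDerivWithinAt α (α' t) (Icc a b) t := fun t ht =>
    ((dY t ht).div (dX t ht) (Real.exp_pos _).ne').const_mul (-σ)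
  have cα' : ContinuousOn α' (Icc a b) := by
    refine continuousOn_const.mul (ContinuousOn.div ?_ (cX.pow 2)
      (fun t _ => (pow_pos (Real.exp_pos _) 2).ne'))
    exact (cY'.mul cX).sub (cY.mul (cX.mul ((cQ A.e₀).div (cP A.e₀) nP)))
  have hη : C1Curve (fun t => α t • A.e₀ - ζ t • x) (fun t => α' t • A.e₀ - f t • x) a b :=
    ⟨fun t ht => ((dα t ht).smul_const _).sub ((dζ t ht).smul_const _),
      (cα'.smul continuousOn_const).sub (cf.smul continuousOn_const)⟩
  obtain ⟨ε₀, hε₀, H⟩ := exists_timelike_variation hσ hab.le hc hη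
    (fun t ht => ⟨(hcau t ht).1, (hcau t ht).2.1⟩) (by
      intro t ht
      have e : 2 * A.G (c t) (v t) (α' t • A.e₀ - f t • x) +
          A.G' (c t) (α t • A.e₀ - ζ t • x) (v t) (v t) = -2 * δ / μ t := by
        simp only [map_sub, map_smul, sub_apply, smul_apply, smul_eq_mul]
        have e1 : A.G (c t) (v t) A.e₀ = P₀ t := rfl
        have e2 : A.G' (c t) A.e₀ (v t) (v t) = 2 * Q₀ t := by simp only [hQ₀]; ring
        rw [e1, e2]
        have hX := (Real.exp_pos (L t)).ne'
        have hσ0 : σ ≠ 0 := by rcases hσ with rfl | rfl <;> norm_num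
        have hP := nP t ht
        simp only [hα, hα', hY', hμ]
        field_simp
        ring_nf
      rw [e]
      have := μpos t ht
      rw [div_neg_iff]; right; constructor <;> linarith)
  have := A.achronal σ _ _ a b hσ hab (hc.add_smul hη ε₀) (H ε₀ hε₀ le_rfl) (by
    have : α a = 0 := by simp [hα, hY, W0]
    simp only [this, ζa, zero_smul, sub_zero, smul_zero, add_zero]
    rw [(hcau a ha).2.2]; simp)
  simp only [ζb, zero_smul, sub_zero, smul_smul] at this
  rw [A.height_add, (hcau b hb).2.2, zero_add] at this
  have hYb : 0 < Y b := by
    simp only [hY, hδ]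
    have : W b / (2 * (b - a)) * (b - a) = W b / 2 := by field_simp
    rw [this]; linarith
  have e : σ * (ε₀ * α b) = -(ε₀ * (Y b / Real.exp (L b))) := by
    simp only [hα]; linear_combination (-ε₀ * (Y b / Real.exp (L b))) * hσ2
  rw [e] at this
  have : 0 < ε₀ * (Y b / Real.exp (L b)) := by positivity
  linarith

end AchronalGraph

end NullHorizon

namespace NullHorizon

variable {E : Type*} [NormedAddCommGroup E] [NormedSpace ℝ E]

/-! ### The geodesic equation -/

/-- A positive continuous function on `[a, b]` is the speed, as a function of position, of an
increasing parametrization of `[a, b]`. -/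
lemma exists_reparametrization {μ : ℝ → ℝ} {a b : ℝ} (hab : a < b) (hμ : ContinuousOn μ (Icc a b))
    (hpos : ∀ t ∈ Icc a b, 0 < μ t) :
    ∃ T > 0, ∃ θ : ℝ → ℝ, θ 0 = a ∧ θ T = b ∧
      ∀ t ∈ Icc 0 T, θ t ∈ Icc a b ∧ HasDerivWithinAt θ (μ (θ t)) (Icc 0 T) t := by
  set g : ℝ → ℝ := IccExtend hab.le ((Icc a b).domRestrict fun t => (μ t)⁻¹) with hg
  have cg : Continuous g := (continuousOn_iff_continuous_domRestrict.1
    (hμ.inv₀ fun t ht => (hpos t ht).ne')).Icc_extend'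
  obtain ⟨t₀, ht₀, hmin⟩ := isCompact_Icc.exists_isMinOn (nonempty_Icc.2 hab.le)
    (hμ.inv₀ fun t ht => (hpos t ht).ne')
  set m := (μ t₀)⁻¹ with hm
  have pm : 0 < m := inv_pos.2 (hpos t₀ ht₀)
  have gm : ∀ t, m ≤ g t := by
    intro t
    simp only [hg, IccExtend, Function.comp, Set.domRestrict_apply]
    exact hmin (projIcc a b hab.le t).2
  -- the parametrization is the inverse of the primitive `τ` of `1 / μ`, extended to the line
  set τ : ℝ → ℝ := fun t => ∫ s in a..t, g s with hτ
  have dτ : ∀ t, HasDerivAt τ (g t) t := fun t => (cg.integral_hasStrictDerivAt a t).hasDerivAt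
  have τa : τ a = 0 := by simp [hτ]
  have cτ : Continuous τ := continuous_iff_continuousAt.2 fun t => (dτ t).continuousAt
  have mono : StrictMono τ := strictMono_of_deriv_pos fun t => by
    rw [(dτ t).deriv]; exact pm.trans_le (gm t)
  have mono' : Monotone fun t => τ t - m * t := by
    have hd : ∀ t, HasDerivAt (fun t => τ t - m * t) (g t - m) t := fun t =>
      ((dτ t).sub ((hasDerivAt_id t).const_mul m)).congr_deriv (by simp)
    exact monotone_of_deriv_nonneg (fun t => (hd t).differentiableAt) fun t => by
      rw [(hd t).deriv]; linarith [gm t]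
  have surj : Function.Surjective τ := by
    refine cτ.surjective ?_ ?_
    · refine tendsto_atTop_mono' atTop (f₁ := fun t => m * t + (τ 0 - m * 0)) ?_ ?_
      · filter_upwards [eventually_ge_atTop 0] with t ht
        have := mono' ht; simp only at this; linarith
      · exact tendsto_atTop_add_const_right _ _ (tendsto_id.const_mul_atTop pm)
    · refine tendsto_atBot_mono' atBot (f₁ := fun t => m * t + (τ 0 - m * 0)) ?_ ?_
      · filter_upwards [eventually_le_atBot 0] with t ht
        have := mono' ht; simp only at this; linarith
      · exact tendsto_atBot_add_const_right _ _ (tendsto_id.const_mul_atBot pm)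
  set Θ := mono.orderIsoOfSurjective τ surj with hΘ
  have hΘτ : ∀ t, Θ.symm (τ t) = t := fun t => Θ.symm_apply_apply t
  have hτΘ : ∀ t, τ (Θ.symm t) = t := fun t => Θ.apply_symm_apply t
  refine ⟨τ b, by rw [← τa]; exact mono hab, Θ.symm, by rw [← τa, hΘτ], hΘτ b, ?_⟩
  intro t ht
  have hmem : Θ.symm t ∈ Icc a b := by
    constructor
    · rw [← hΘτ a, τa]; exact Θ.symm.monotone ht.1
    · rw [← hΘτ b]; exact Θ.symm.monotone ht.2
  refine ⟨hmem, HasDerivAt.hasDerivWithinAt ?_⟩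
  have h1 : g (Θ.symm t) = (μ (Θ.symm t))⁻¹ := by
    rw [hg, IccExtend_of_mem _ _ hmem]; rfl
  have h2 := HasDerivAt.of_local_left_inverse (f := τ) (g := Θ.symm) (a := t)
    Θ.symm.continuous.continuousAt (dτ _) (by rw [h1]; exact (inv_pos.2 (hpos _ hmem)).ne')
    (Eventually.of_forall hτΘ)
  rwa [h1, inv_inv] at h2

/-- Differentiability of a curve of covectors is tested on vectors. -/
lemma hasDerivWithinAt_of_apply [FiniteDimensional ℝ E] {p : ℝ → E →L[ℝ] ℝ} {p' : E →L[ℝ] ℝ}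
    {s : Set ℝ} {t : ℝ} (h : ∀ x, HasDerivWithinAt (fun t => p t x) (p' x) s t) :
    HasDerivWithinAt p p' s t := by
  set b := Module.finBasis ℝ E
  have key : ∀ q : E →L[ℝ] ℝ, q = ∑ i, q (b i) • (b.coord i).toContinuousLinearMap := by
    intro q
    ext x
    conv_lhs => rw [← b.sum_repr x]
    simp only [map_sum, map_smul, FunLike.coe_sum, Finset.sum_apply, smul_apply,
      smul_eq_mul, LinearMap.coe_toContinuousLinearMap', Module.Basis.coord_apply, mul_comm]
  rw [key p', show p = fun t => ∑ i, p t (b i) • (b.coord i).toContinuousLinearMap from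
    funext fun t => key (p t)]
  exact HasDerivWithinAt.fun_sum fun i _ => (h (b i)).smul_const _

namespace AchronalGraph

/-- The right-hand side of the geodesic equation with lowered index,
`½ ∂ₖ g_{ij} vⁱ vʲ - ∂ᵢ g_{jk} vⁱ vʲ`, as a covector. -/
noncomputable def force (A : AchronalGraph E) (y v : E) : E →L[ℝ] ℝ :=
  (1 / 2 : ℝ) • ((A.G' y).flip v).flip v - A.G' y v v

/-- The acceleration `-Γ(v, v)` of a geodesic with velocity `v`. -/
noncomputable def acc (A : AchronalGraph E) (y v : E) : E := (A.G y).inverse (A.force y v)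

variable {A : AchronalGraph E}

lemma force_apply (y v x : E) : A.force y v x = 1 / 2 * A.G' y x v v - A.G' y v v x := by
  simp [force]

lemma eq_zero_of_forall {y v : E} (hy : y ∈ A.ball) (h : ∀ x, A.G y v x = 0) : v = 0 := by
  have h1 := A.cone y hy v (h v).le
  rw [A.symm y hy, h, abs_zero] at h1
  have := A.κ_pos
  have : ‖v‖ ≤ 0 := by nlinarith
  exact norm_le_zero_iff.1 this

lemma exists_equiv [FiniteDimensional ℝ E] {y : E} (hy : y ∈ A.ball) :
    ∃ L : E ≃L[ℝ] (E →L[ℝ] ℝ), (L : E →L[ℝ] E →L[ℝ] ℝ) = A.G y := by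
  have hinj : Function.Injective (A.G y : E →ₗ[ℝ] E →L[ℝ] ℝ) := by
    rw [← LinearMap.ker_eq_bot, LinearMap.ker_eq_bot']
    intro v hv
    exact eq_zero_of_forall hy fun x => by
      have := DFunLike.congr_fun hv x; simpa using this
  have hdim : Module.finrank ℝ E = Module.finrank ℝ (E →L[ℝ] ℝ) := by
    rw [← (LinearMap.toContinuousLinearMap (𝕜 := ℝ) (E := E) (F' := ℝ)).finrank_eq]
    exact Subspace.dual_finrank_eq.symm
  refine ⟨((A.G y : E →ₗ[ℝ] E →L[ℝ] ℝ).linearEquivOfInjective hinj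
    hdim).toContinuousLinearEquiv, ?_⟩
  ext v x
  simp

lemma G_acc [FiniteDimensional ℝ E] {y : E} (hy : y ∈ A.ball) (v x : E) :
    A.G y (A.acc y v) x = A.force y v x := by
  obtain ⟨L, hL⟩ := exists_equiv hy
  rw [acc, ← hL, ContinuousLinearMap.inverse_equiv]
  simp

lemma contDiffAt_acc [FiniteDimensional ℝ E] [CompleteSpace E] {y : E} (hy : y ∈ A.ball) (v : E) :
    ContDiffAt ℝ 1 (fun z : E × E => A.acc z.1 z.2) (y, v) := by
  obtain ⟨L, hL⟩ := exists_equiv hy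
  have hG : ContDiffAt ℝ 1 (fun z : E × E => A.G z.1) (y, v) :=
    ((A.smooth y hy).of_le (by norm_num)).comp (y, v) contDiffAt_fst
  have hG' : ContDiffAt ℝ 1 (fun z : E × E => A.G' z.1) (y, v) := by
    have : ContDiffAt ℝ 1 A.G' y := (A.smooth y hy).fderiv_right (m := 1) (by norm_num)
    exact this.comp (y, v) contDiffAt_fst
  have h2 : ContDiffAt ℝ 1 (fun z : E × E => z.2) (y, v) := contDiffAt_snd
  have hF : ContDiffAt ℝ 1 (fun z : E × E => A.force z.1 z.2) (y, v) := by
    have hfl : ContDiffAt ℝ 1 (fun z : E × E => (A.G' z.1).flip) (y, v) :=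
      (ContinuousLinearMap.flipₗᵢ ℝ E E (E →L[ℝ] ℝ)).contDiff.contDiffAt.comp (y, v) hG'
    have hfl2 : ContDiffAt ℝ 1 (fun z : E × E => ((A.G' z.1).flip z.2).flip) (y, v) :=
      (ContinuousLinearMap.flipₗᵢ ℝ E E ℝ).contDiff.contDiffAt.comp (y, v) (hfl.clm_apply h2)
    exact ((hfl2.clm_apply h2).const_smul (1 / 2 : ℝ)).sub ((hG'.clm_apply h2).clm_apply h2)
  have hinv : ContDiffAt ℝ 1 (fun z : E × E => (A.G z.1).inverse) (y, v) := by
    have : ContDiffAt ℝ 1 (ContinuousLinearMap.inverse : (E →L[ℝ] (E →L[ℝ] ℝ)) → _) (A.G y) := by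
      rw [← hL]; exact contDiffAt_map_inverse L
    exact ContDiffAt.comp (y, v) (g := ContinuousLinearMap.inverse) this hG
  exact hinv.clm_apply hF

lemma acc_smul (y v : E) (k : ℝ) : A.acc y (k • v) = (k ^ 2) • A.acc y v := by
  have : A.force y (k • v) = (k ^ 2) • A.force y v := by
    ext x; simp only [force_apply, smul_apply, map_smul, smul_eq_mul]; ring
  rw [acc, acc, this, map_smul]

/-- `(c, v)` is on `s` a solution of the geodesic equation which is null, lies in the hypersurface,
and is future-directed if `σ = 1`, past-directed if `σ = -1`. -/
def IsNullGeodesic (A : AchronalGraph E) (σ : ℝ) (c v : ℝ → E) (s : Set ℝ) : Prop :=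
  ∀ t ∈ s, HasDerivWithinAt c (v t) s t ∧ HasDerivWithinAt v (A.acc (c t) (v t)) s t ∧
    c t ∈ A.ball ∧ A.height (c t) = 0 ∧ v t ≠ 0 ∧ A.G (c t) (v t) (v t) = 0 ∧
    σ * A.G (c t) (A.e₀) (v t) < 0

/-- A differentiable curve with `(g v)' = ½ ∂g(v, v)` satisfies the geodesic equation. -/
lemma hasDerivWithinAt_acc [FiniteDimensional ℝ E] [CompleteSpace E] {c v : ℝ → E} {s : Set ℝ}
    {t : ℝ} (ht : t ∈ s) (hs : UniqueDiffWithinAt ℝ s t) (hball : ∀ t ∈ s, c t ∈ A.ball)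
    (hc : HasDerivWithinAt c (v t) s t)
    (hP : ∀ x, HasDerivWithinAt (fun t => A.G (c t) (v t) x)
      (1 / 2 * A.G' (c t) x (v t) (v t)) s t) :
    HasDerivWithinAt v (A.acc (c t) (v t)) s t := by
  have hy := hball t ht
  set p' : E →L[ℝ] ℝ := (1 / 2 : ℝ) • ((A.G' (c t)).flip (v t)).flip (v t) with hp'
  have hp : HasDerivWithinAt (fun t => A.G (c t) (v t)) p' s t :=
    hasDerivWithinAt_of_apply fun x => by
      convert hP x using 1
      simp [hp']
  have hGc : HasDerivWithinAt (fun t => A.G (c t)) (A.G' (c t) (v t)) s t :=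
    (hasFDerivAt_G hy).comp_hasDerivWithinAt t hc
  have hv : DifferentiableWithinAt ℝ v s t := by
    obtain ⟨L, hL⟩ := exists_equiv hy
    have hinv : DifferentiableWithinAt ℝ (fun t => (A.G (c t)).inverse) s t := by
      have : DifferentiableAt ℝ (ContinuousLinearMap.inverse : (E →L[ℝ] (E →L[ℝ] ℝ)) → _)
          (A.G (c t)) := by
        rw [← hL]; exact (contDiffAt_map_inverse (n := 1) L).differentiableAt (by norm_num)
      exact this.comp_differentiableWithinAt t hGc.differentiableWithinAt
    refine (hinv.clm_apply hp.differentiableWithinAt).congr (fun r hr => ?_) ?_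
    · obtain ⟨L, hL⟩ := exists_equiv (hball r hr)
      rw [← hL, ContinuousLinearMap.inverse_equiv]; simp
    · rw [← hL, ContinuousLinearMap.inverse_equiv]; simp
  have h1 := hGc.clm_apply hv.hasDerivWithinAt
  have h2 := hs.eq_deriv s h1 hp
  have h3 : derivWithin v s t = A.acc (c t) (v t) := by
    rw [← sub_eq_zero]
    refine eq_zero_of_forall hy fun x => ?_
    have := DFunLike.congr_fun h2 x
    simp only [add_apply, hp', smul_apply, smul_eq_mul, ContinuousLinearMap.flip_apply] at this
    rw [map_sub, sub_apply, G_acc hy, force_apply]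
    linarith
  rw [← h3]; exact hv.hasDerivWithinAt

/-- A causal curve in an achronal hypersurface is, after reparametrization, a null geodesic. -/
lemma exists_isNullGeodesic_of_causal [FiniteDimensional ℝ E] [CompleteSpace E] {σ : ℝ}
    (hσ : σ = 1 ∨ σ = -1) {c v : ℝ → E} {a b : ℝ} (hab : a < b) (hc : C1Curve c v a b)
    (hcau : ∀ t ∈ Icc a b, c t ∈ A.ball ∧ A.Causal σ (c t) (v t) ∧ A.height (c t) = 0) :
    ∃ T > 0, ∃ c' v' : ℝ → E, A.IsNullGeodesic σ c' v' (Icc 0 T) ∧ c' 0 = c a := by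
  obtain ⟨μ, cμ, pμ, dμ⟩ := exists_multiplier hσ hab hc hcau
  have hnull := null_of_causal hσ hab hc hcau
  obtain ⟨T, hT, θ, θ0, -, hθ⟩ := exists_reparametrization hab cμ pμ
  have mθ : MapsTo θ (Icc 0 T) (Icc a b) := fun t ht => (hθ t ht).1
  have dc : ∀ t ∈ Icc 0 T, HasDerivWithinAt (c ∘ θ) (μ (θ t) • v (θ t)) (Icc 0 T) t := fun t ht =>
    (hc.1 _ (mθ ht)).scomp t (hθ t ht).2 mθ
  refine ⟨T, hT, c ∘ θ, fun t => μ (θ t) • v (θ t), fun t ht => ?_, by simp [θ0]⟩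
  obtain ⟨hb, ⟨hv, _, hfut⟩, hh⟩ := hcau _ (mθ ht)
  have pos := pμ _ (mθ ht)
  refine ⟨dc t ht, ?_, hb, hh, smul_ne_zero pos.ne' hv, ?_, ?_⟩
  · refine hasDerivWithinAt_acc ht (uniqueDiffOn_Icc hT t ht)
      (fun t ht => (hcau _ (mθ ht)).1) (dc t ht) fun x => ?_
    have := (dμ x _ (mθ ht)).scomp t (hθ t ht).2 mθ
    refine (HasDerivWithinAt.congr_deriv this ?_).congr (fun s _ => ?_) ?_
    · simp only [Function.comp, map_smul, smul_apply, smul_eq_mul]; ring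
    · simp only [Function.comp, map_smul, smul_apply, smul_eq_mul]
    · simp only [Function.comp, map_smul, smul_apply, smul_eq_mul]
  · simp only [Function.comp, map_smul, smul_apply, smul_eq_mul, hnull _ (mθ ht), mul_zero]
  · simp only [Function.comp, map_smul, smul_eq_mul]
    rw [mul_left_comm]; exact mul_neg_of_pos_of_neg pos hfut

lemma IsNullGeodesic.hasDerivWithinAt_momentum [FiniteDimensional ℝ E] {σ : ℝ} {c v : ℝ → E}
    {s : Set ℝ} (h : A.IsNullGeodesic σ c v s) {t : ℝ} (ht : t ∈ s) (x : E) :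
    HasDerivWithinAt (fun t => A.G (c t) (v t) x) (1 / 2 * A.G' (c t) x (v t) (v t)) s t := by
  obtain ⟨h1, h2, hy, -⟩ := h t ht
  have hGc : HasDerivWithinAt (fun t => A.G (c t)) (A.G' (c t) (v t)) s t :=
    (hasFDerivAt_G hy).comp_hasDerivWithinAt t h1
  refine ((hGc.clm_apply h2).clm_apply (hasDerivWithinAt_const t s x)).congr_deriv ?_
  simp [G_acc hy, force_apply]

lemma IsNullGeodesic.c1Curve {σ : ℝ} {c v : ℝ → E} {a b : ℝ}
    (h : A.IsNullGeodesic σ c v (Icc a b)) : C1Curve c v a b :=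
  ⟨fun t ht => (h t ht).1, fun t ht => (h t ht).2.1.continuousWithinAt⟩

lemma abs_div_le_of_le {x y B p : ℝ} (hp : 0 < p) (hy : p ≤ |y|) (hx : |x| ≤ B) :
    |x / y| ≤ B / p := by
  rw [abs_div]
  exact div_le_div₀ ((abs_nonneg x).trans hx) hx hp hy

set_option maxHeartbeats 1000000 in
/-- A null geodesic of the hypersurface which runs, with velocity between `m` and `M`, for the time
`b` bounds the hypersurface near its initial point, on one side of the null hyperplane orthogonal
to it, to second order. The constants depend on `m`, `M`, `b` and the distance `d` to the boundary
of the domain only. Otherwise a variation of the geodesic with fixed final point, moving the initial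
point to one vertically above `z` (below, if `σ = -1`), would be a timelike curve ending on the
hypersurface. -/
lemma exists_quadratic_bound [FiniteDimensional ℝ E] (A : AchronalGraph E) {m M b d : ℝ}
    (hm : 0 < m) (hM : 0 < M) (hb : 0 < b) (hd : 0 < d) :
    ∃ C > 0, ∃ ρ > 0, ∀ (σ : ℝ) (c v : ℝ → E), (σ = 1 ∨ σ = -1) → A.IsNullGeodesic σ c v (Icc 0 b) →
      (∀ t ∈ Icc 0 b, m ≤ ‖v t‖ ∧ ‖v t‖ ≤ M ∧ dist (c t) A.ctr ≤ A.r - d) →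
      ∀ z, A.height z = 0 → ‖z - c 0‖ ≤ ρ → A.G (c 0) (v 0) (z - c 0) ≤ C * ‖z - c 0‖ ^ 2 := by
  have hK := A.K_pos
  -- `p` bounds `|G(v, e₀)|` from below, `a₁ r` and `a₂ r` bound the coefficient of the vertical
  -- part of the variation and its derivative, `k r²` the second order terms of the energy
  set p := A.κ * m with hp
  have pp : 0 < p := mul_pos A.κ_pos hm
  set a₁ := (b + A.K * M) / p with ha₁
  set a₂ := (1 + A.K * M / b + 1 / 2 * (A.K * M ^ 2) + a₁ * (1 / 2 * (A.K * M ^ 2))) / p with ha₂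
  have pa₁ : 0 < a₁ := by positivity
  have pa₂ : 0 < a₂ := by positivity
  set k := A.K * ((1 / b + a₂) + (M + 1) * (1 + a₁)) ^ 2 with hk
  have pk : 0 < k := by positivity
  set L := A.K * ((1 + a₁) * (M + 1)) + A.K * (1 / b + a₂) with hL
  have pL : 0 < L := by positivity
  refine ⟨k * b, by positivity, min (min (1 / k) (d / (2 * (1 + a₁))))
    (min (1 / (1 / b + a₂)) (p / (2 * L))), by positivity, ?_⟩
  intro σ c v hσ hgeo hbd z hz hzρ
  set ζ := z - c 0 with hζ
  set r := ‖ζ‖ with hr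
  have r0 : 0 ≤ r := norm_nonneg _
  simp only [le_min_iff] at hzρ
  obtain ⟨⟨r1, r2⟩, r3, r4⟩ := hzρ
  rw [le_div_iff₀ (by positivity)] at r1 r2 r3 r4
  by_contra! hcon
  have rpos : 0 < r := by
    rcases r0.eq_or_lt with h | h
    · have : ζ = 0 := norm_eq_zero.1 h.symm
      rw [this, ← h] at hcon; simp at hcon
    · exact h
  have hC := hgeo.c1Curve
  have h0 : (0 : ℝ) ∈ Icc 0 b := left_mem_Icc.2 hb.le
  set P : E → ℝ → ℝ := fun x t => A.G (c t) (v t) x with hP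
  have dP : ∀ x, ∀ t ∈ Icc 0 b,
      HasDerivWithinAt (P x) (1 / 2 * A.G' (c t) x (v t) (v t)) (Icc 0 b) t :=
    fun x t ht => hgeo.hasDerivWithinAt_momentum ht x
  have hmaps : MapsTo c (Icc 0 b) A.ball := fun t ht => (hgeo t ht).2.2.1
  have cG : ContinuousOn (fun t => A.G (c t)) (Icc 0 b) := continuousOn_G.comp hC.continuousOn hmaps
  have cG' : ContinuousOn (fun t => A.G' (c t)) (Icc 0 b) :=
    continuousOn_G'.comp hC.continuousOn hmaps
  have cP : ∀ x, ContinuousOn (P x) (Icc 0 b) := fun x t ht => (dP x t ht).continuousWithinAt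
  have cQ : ∀ x, ContinuousOn (fun t => 1 / 2 * A.G' (c t) x (v t) (v t)) (Icc 0 b) := fun x =>
    continuousOn_const.mul (((cG'.clm_apply continuousOn_const).clm_apply hC.2).clm_apply hC.2)
  have sP : ∀ t ∈ Icc 0 b, p ≤ -σ * P A.e₀ t := by
    intro t ht
    obtain ⟨-, -, hy, -, -, hnull, hfut⟩ := hgeo t ht
    have h1 := A.cone _ hy _ hnull.le
    have h2 : p ≤ A.κ * ‖v t‖ := by rw [hp]; exact mul_le_mul_of_nonneg_left (hbd t ht).1 A.κ_pos.le
    have h3 : |A.G (c t) A.e₀ (v t)| = -σ * P A.e₀ t := by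
      simp only [hP]; rw [A.symm _ hy (v t)]
      rcases hσ with rfl | rfl
      · rw [abs_of_neg (by linarith)]; ring
      · rw [abs_of_pos (by linarith)]; ring
    linarith
  have aP : ∀ t ∈ Icc 0 b, p ≤ |P A.e₀ t| := by
    intro t ht
    have := sP t ht
    rcases hσ with rfl | rfl
    · rw [le_abs]; right; linarith
    · rw [le_abs]; left; linarith
  have nP : ∀ t ∈ Icc 0 b, P A.e₀ t ≠ 0 := fun t ht h => by
    have := aP t ht; rw [h, abs_zero] at this; linarith
  -- the variation `φ ζ + α e₀`, with `α` chosen so that `G(v, φ ζ + α e₀) = k r² (b - t)`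
  set φ : ℝ → ℝ := fun t => 1 - t / b with hφ
  have dφ : ∀ t, HasDerivAt φ (-(1 / b)) t := fun t =>
    (((hasDerivAt_id t).div_const b).const_sub 1)
  set F : ℝ → ℝ := fun t => k * r ^ 2 * (b - t) with hF
  have dF : ∀ t, HasDerivAt F (-(k * r ^ 2)) t := fun t =>
    (((hasDerivAt_id t).const_sub b).const_mul (k * r ^ 2)).congr_deriv (by ring)
  set α : ℝ → ℝ := fun t => (F t - φ t * P ζ t) / P A.e₀ t with hα
  set N' : ℝ → ℝ := fun t => -(k * r ^ 2) -
    (-(1 / b) * P ζ t + φ t * (1 / 2 * A.G' (c t) ζ (v t) (v t))) with hN'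
  set α' : ℝ → ℝ := fun t => (N' t * P A.e₀ t - (F t - φ t * P ζ t) *
    (1 / 2 * A.G' (c t) A.e₀ (v t) (v t))) / P A.e₀ t ^ 2 with hα'
  have dα : ∀ t ∈ Icc 0 b, HasDerivWithinAt α (α' t) (Icc 0 b) t := fun t ht =>
    (((dF t).hasDerivWithinAt.sub ((dφ t).hasDerivWithinAt.mul (dP ζ t ht))).div (dP A.e₀ t ht)
      (nP t ht))
  have cφ : ContinuousOn φ (Icc 0 b) := fun t _ => (dφ t).continuousAt.continuousWithinAt
  have cF : ContinuousOn F (Icc 0 b) := fun t _ => (dF t).continuousAt.continuousWithinAt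
  have cα' : ContinuousOn α' (Icc 0 b) := by
    refine ContinuousOn.div ?_ ((cP A.e₀).pow 2) (fun t ht => pow_ne_zero 2 (nP t ht))
    refine ContinuousOn.sub (ContinuousOn.mul ?_ (cP A.e₀)) ((cF.sub (cφ.mul (cP ζ))).mul (cQ A.e₀))
    exact continuousOn_const.sub ((continuousOn_const.mul (cP ζ)).add (cφ.mul (cQ ζ)))
  have hη : C1Curve (fun t => φ t • ζ + α t • A.e₀) (fun t => (-(1 / b)) • ζ + α' t • A.e₀) 0 b :=
    ⟨fun t ht => ((dφ t).hasDerivWithinAt.smul_const _).add ((dα t ht).smul_const _),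
      continuousOn_const.add (cα'.smul continuousOn_const)⟩
  have bounds : ∀ t ∈ Icc 0 b, |φ t| ≤ 1 ∧ |α t| ≤ a₁ * r ∧ |α' t| ≤ a₂ * r := by
    intro t ht
    obtain ⟨hm', hM', -⟩ := hbd t ht
    have hy := hmaps ht
    have hφ1 : |φ t| ≤ 1 := by
      have h1 : 0 ≤ t / b := div_nonneg ht.1 hb.le
      have h2 : t / b ≤ 1 := (div_le_one hb).2 ht.2
      rw [abs_le]; simp only [hφ]; constructor <;> linarith
    have bPζ : |P ζ t| ≤ A.K * M * r := (abs_G_le hy _ _).trans (by gcongr)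
    have bQ : ∀ x, |1 / 2 * A.G' (c t) x (v t) (v t)| ≤ 1 / 2 * (A.K * M ^ 2) * ‖x‖ := by
      intro x
      rw [abs_mul, abs_of_pos (by norm_num : (0 : ℝ) < 1 / 2), mul_assoc]
      gcongr
      refine (abs_G'_le hy _ _ _).trans ?_
      calc A.K * ‖x‖ * ‖v t‖ * ‖v t‖ ≤ A.K * ‖x‖ * M * M := by gcongr
        _ = _ := by ring
    have bkr : k * r ^ 2 ≤ r := by nlinarith
    have bF : |F t| ≤ r * b := by
      simp only [hF]
      rw [abs_of_nonneg (mul_nonneg (by positivity) (by linarith [ht.2]))]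
      have : b - t ≤ b := by linarith [ht.1]
      have h2 : 0 ≤ b - t := by linarith [ht.2]
      gcongr
    have bφP : |φ t * P ζ t| ≤ A.K * M * r := by
      rw [abs_mul]
      calc _ ≤ 1 * (A.K * M * r) := by gcongr
        _ = _ := one_mul _
    have bα : |α t| ≤ a₁ * r := by
      have h1 : |F t - φ t * P ζ t| ≤ (b + A.K * M) * r :=
        (abs_sub _ _).trans (by linarith)
      exact (abs_div_le_of_le pp (aP t ht) h1).trans_eq (by rw [ha₁]; ring)
    refine ⟨hφ1, bα, ?_⟩
    have e : α' t = (N' t - α t * (1 / 2 * A.G' (c t) A.e₀ (v t) (v t))) / P A.e₀ t := by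
      have := nP t ht
      simp only [hα', hα]; field_simp
    rw [e]
    have hN : |N' t| ≤ (1 + A.K * M / b + 1 / 2 * (A.K * M ^ 2)) * r := by
      have h1 : |-(1 / b) * P ζ t| ≤ A.K * M / b * r := by
        rw [abs_mul, abs_neg, abs_of_pos (by positivity : 0 < 1 / b)]
        calc _ ≤ 1 / b * (A.K * M * r) := by gcongr
          _ = _ := by ring
      have h2 : |φ t * (1 / 2 * A.G' (c t) ζ (v t) (v t))| ≤ 1 / 2 * (A.K * M ^ 2) * r := by
        rw [abs_mul]
        calc _ ≤ 1 * (1 / 2 * (A.K * M ^ 2) * r) := by gcongr; exact bQ ζ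
          _ = _ := one_mul _
      have h3 : |-(k * r ^ 2)| ≤ r := by rw [abs_neg, abs_of_nonneg (by positivity)]; exact bkr
      simp only [hN']
      refine (abs_sub _ _).trans ?_
      have := abs_add_le (-(1 / b) * P ζ t) (φ t * (1 / 2 * A.G' (c t) ζ (v t) (v t)))
      linarith
    have hQ0 : |α t * (1 / 2 * A.G' (c t) A.e₀ (v t) (v t))| ≤
        a₁ * r * (1 / 2 * (A.K * M ^ 2)) := by
      rw [abs_mul]
      have := bQ A.e₀
      rw [A.norm_e₀, mul_one] at this
      gcongr
    have h1 := (abs_sub (N' t) (α t * (1 / 2 * A.G' (c t) A.e₀ (v t) (v t)))).trans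
      (add_le_add hN hQ0)
    exact (abs_div_le_of_le pp (aP t ht) h1).trans_eq (by rw [ha₂]; ring)
  have nη : ∀ t ∈ Icc 0 b, ‖φ t • ζ + α t • A.e₀‖ ≤ (1 + a₁) * r := by
    intro t ht
    obtain ⟨b1, b2, -⟩ := bounds t ht
    refine (norm_add_le _ _).trans ?_
    rw [norm_smul, norm_smul, A.norm_e₀, Real.norm_eq_abs, Real.norm_eq_abs]
    calc |φ t| * r + |α t| * 1 ≤ 1 * r + a₁ * r * 1 := by gcongr
      _ = _ := by ring
  have nη' : ∀ t ∈ Icc 0 b, ‖(-(1 / b)) • ζ + α' t • A.e₀‖ ≤ (1 / b + a₂) * r := by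
    intro t ht
    obtain ⟨-, -, b3⟩ := bounds t ht
    refine (norm_add_le _ _).trans ?_
    rw [norm_smul, norm_smul, A.norm_e₀, norm_neg, Real.norm_eq_abs, Real.norm_eq_abs,
      abs_of_pos (by positivity : 0 < 1 / b)]
    linarith
  -- the first variation `-2 k r²` of the energy outweighs the second order terms
  have key := A.achronal σ _ _ 0 b hσ hb (hC.add_smul hη 1) (by
    intro t ht
    obtain ⟨hm', hM', hdist⟩ := hbd t ht
    have hy := hmaps ht
    simp only [one_smul]
    have n1 := nη t ht
    have n2 := nη' t ht
    have hyη : c t + (φ t • ζ + α t • A.e₀) ∈ A.ball := by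
      rw [Metric.mem_ball, dist_eq_norm] at *
      calc ‖c t + (φ t • ζ + α t • A.e₀) - A.ctr‖
          = ‖(c t - A.ctr) + (φ t • ζ + α t • A.e₀)‖ := by congr 1; abel
        _ ≤ ‖c t - A.ctr‖ + ‖φ t • ζ + α t • A.e₀‖ := norm_add_le _ _
        _ < A.r := by nlinarith
    have n3 : ‖(-(1 / b)) • ζ + α' t • A.e₀‖ ≤ 1 := n2.trans (by linarith)
    refine ⟨hyη, ?_, ?_⟩
    · have hE := abs_energy_sub_le hy hyη hM' n3
      have hb2 : A.K * (‖(-(1 / b)) • ζ + α' t • A.e₀‖ + (M + 1) * ‖φ t • ζ + α t • A.e₀‖) ^ 2 ≤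
          k * r ^ 2 := by
        calc _ ≤ A.K * ((1 / b + a₂) * r + (M + 1) * ((1 + a₁) * r)) ^ 2 := by gcongr
          _ = _ := by rw [hk]; ring
      have hvar : 2 * A.G (c t) (v t) ((-(1 / b)) • ζ + α' t • A.e₀) +
          A.G' (c t) (φ t • ζ + α t • A.e₀) (v t) (v t) = -2 * (k * r ^ 2) := by
        have hn := nP t ht
        simp only [map_add, map_smul, add_apply, smul_apply, smul_eq_mul]
        have e1 : A.G (c t) (v t) A.e₀ = P A.e₀ t := rfl
        have e2 : A.G (c t) (v t) ζ = P ζ t := rfl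
        rw [e1, e2]
        simp only [hα', hα, hN']
        field_simp
        ring
      rw [hvar, (hgeo t ht).2.2.2.2.2.1] at hE
      have := (abs_le.1 hE).2
      have : 0 < k * r ^ 2 := by positivity
      linarith
    · have b1 : |(A.G (c t + (φ t • ζ + α t • A.e₀)) - A.G (c t)) A.e₀
          (v t + ((-(1 / b)) • ζ + α' t • A.e₀))| ≤ A.K * ((1 + a₁) * r) * (M + 1) := by
        have := (A.G (c t + (φ t • ζ + α t • A.e₀)) - A.G (c t)).le_opNorm₂ A.e₀
          (v t + ((-(1 / b)) • ζ + α' t • A.e₀))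
        rw [Real.norm_eq_abs, A.norm_e₀, mul_one] at this
        refine this.trans ?_
        gcongr
        · have h := A.lip (c t) hy _ hyη
          rw [add_sub_cancel_left] at h
          exact h.trans (by gcongr)
        · exact (norm_add_le _ _).trans (add_le_add hM' n3)
      have b2 : |A.G (c t) A.e₀ ((-(1 / b)) • ζ + α' t • A.e₀)| ≤ A.K * ((1 / b + a₂) * r) := by
        refine (abs_G_le hy _ _).trans ?_
        rw [A.norm_e₀, mul_one]; gcongr
      have e : A.G (c t + (φ t • ζ + α t • A.e₀)) A.e₀ (v t + ((-(1 / b)) • ζ + α' t • A.e₀)) =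
          A.G (c t) A.e₀ (v t) + (A.G (c t + (φ t • ζ + α t • A.e₀)) - A.G (c t)) A.e₀
          (v t + ((-(1 / b)) • ζ + α' t • A.e₀)) +
          A.G (c t) A.e₀ ((-(1 / b)) • ζ + α' t • A.e₀) := by
        simp only [sub_apply, map_add]; ring
      rw [e]
      have e3 : A.K * ((1 + a₁) * r) * (M + 1) + A.K * ((1 / b + a₂) * r) = r * L := by
        rw [hL]; ring
      have h5 := sP t ht
      simp only [hP] at h5
      rw [A.symm _ hy (v t)] at h5
      rw [abs_le] at b1 b2
      rcases hσ with rfl | rfl <;> linarith) (by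
    have φ0 : φ 0 = 1 := by simp [hφ]
    simp only [φ0, one_smul]
    rw [← add_assoc, hζ, add_sub_cancel, A.height_add, hz, zero_add]
    have h1 := sP 0 h0
    have h2 : σ * α 0 = (P ζ 0 - k * b * r ^ 2) / (-σ * P A.e₀ 0) := by
      have := nP 0 h0
      simp only [hα, hF, φ0]
      rcases hσ with rfl | rfl <;> field_simp <;> ring
    rw [h2]
    exact div_nonneg (by linarith) (by linarith))
  have φb : φ b = 0 := by simp [hφ, hb.ne']
  have αb : α b = 0 := by simp [hα, hF, φb]
  simp only [φb, αb, zero_smul, add_zero, smul_zero] at key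
  rw [(hgeo b (right_mem_Icc.2 hb.le)).2.2.2.1] at key
  simp at key

end AchronalGraph

end NullHorizon

namespace NullHorizon

variable {E : Type*} [NormedAddCommGroup E] [NormedSpace ℝ E]

/-! ### Peano's existence theorem -/

/-- The vertices of Euler's polygon with time step `τ`, starting at `p`, for the differential
equation `y' = V y`. -/
noncomputable def eulerPolygon (V : E → E) (p : E) (τ : ℝ) : ℕ → E
  | 0 => p
  | i + 1 => eulerPolygon V p τ i + τ • V (eulerPolygon V p τ i)

lemma norm_eulerPolygon_add_sub_le {V : E → E} {p : E} {τ ρ M : ℝ} (hτ : 0 ≤ τ)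
    (hV : ∀ x ∈ Metric.closedBall p ρ, ‖V x‖ ≤ M) (i k : ℕ) (h : (i + k : ℕ) * τ * M ≤ ρ)
    (hM : 0 ≤ M) :
    eulerPolygon V p τ i ∈ Metric.closedBall p ρ ∧
      ‖eulerPolygon V p τ (i + k) - eulerPolygon V p τ i‖ ≤ k * τ * M := by
  have mem : ∀ i : ℕ, i * τ * M ≤ ρ → ‖eulerPolygon V p τ i - p‖ ≤ i * τ * M := by
    intro i
    induction i with
    | zero => intro _; simp [eulerPolygon]
    | succ i ih =>
      intro hi
      push_cast at hi ⊢
      have h1 : (i : ℝ) * τ * M ≤ ρ := by nlinarith [mul_nonneg hτ hM]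
      have h2 := hV _ (mem_closedBall_iff_norm.2 ((ih h1).trans h1))
      rw [eulerPolygon, add_sub_right_comm]
      refine (norm_add_le _ _).trans ?_
      rw [norm_smul, Real.norm_eq_abs, abs_of_nonneg hτ]
      nlinarith [ih h1, mul_le_mul_of_nonneg_left h2 hτ]
  have mem' : ∀ j : ℕ, j ≤ i + k → ‖eulerPolygon V p τ j - p‖ ≤ ρ := by
    intro j hj
    have : (j : ℝ) * τ * M ≤ (i + k : ℕ) * τ * M := by gcongr
    exact (mem j (this.trans h)).trans (this.trans h)
  refine ⟨mem_closedBall_iff_norm.2 (mem' i (by omega)), ?_⟩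
  have : ∀ l : ℕ, l ≤ k → ‖eulerPolygon V p τ (i + l) - eulerPolygon V p τ i‖ ≤ l * τ * M := by
    intro l
    induction l with
    | zero => intro _; simp
    | succ l ih =>
      intro hl
      have h2 := hV _ (mem_closedBall_iff_norm.2 (mem' (i + l) (by omega)))
      rw [← add_assoc, eulerPolygon, add_sub_right_comm]
      refine (norm_add_le _ _).trans ?_
      rw [norm_smul, Real.norm_eq_abs, abs_of_nonneg hτ]
      push_cast
      nlinarith [ih (by omega), mul_le_mul_of_nonneg_left h2 hτ]
  exact this k le_rfl

lemma norm_eulerPolygon_sub_smul_le {V : E → E} {p : E} {τ ρ M δ e : ℝ} (hτ : 0 ≤ τ)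
    (hV : ∀ x ∈ Metric.closedBall p ρ, ‖V x‖ ≤ M) (hM : 0 ≤ M)
    (hu : ∀ x ∈ Metric.closedBall p ρ, ∀ y ∈ Metric.closedBall p ρ, ‖x - y‖ < δ → ‖V x - V y‖ ≤ e)
    (i k : ℕ) (h : (i + k : ℕ) * τ * M ≤ ρ) (hδ : k * τ * M < δ) :
    ‖eulerPolygon V p τ (i + k) - eulerPolygon V p τ i - (k * τ) • V (eulerPolygon V p τ i)‖ ≤
      k * τ * e := by
  have : ∀ l : ℕ, l ≤ k → ‖eulerPolygon V p τ (i + l) - eulerPolygon V p τ i -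
      (l * τ) • V (eulerPolygon V p τ i)‖ ≤ l * τ * e := by
    intro l
    induction l with
    | zero => intro _; simp
    | succ l ih =>
      intro hl
      have hl' : (i + l : ℕ) * τ * M ≤ ρ := by
        refine le_trans ?_ h
        have : i + l ≤ i + k := by omega
        gcongr
      obtain ⟨m1, n1⟩ := norm_eulerPolygon_add_sub_le hτ hV i l hl' hM
      obtain ⟨m2, -⟩ := norm_eulerPolygon_add_sub_le hτ hV (i + l) 0 (by simpa using hl') hM
      have n2 : ‖eulerPolygon V p τ (i + l) - eulerPolygon V p τ i‖ < δ := by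
        refine n1.trans_lt (lt_of_le_of_lt ?_ hδ)
        have : l ≤ k := by omega
        gcongr
      have h3 := hu _ m2 _ m1 n2
      have e1 : eulerPolygon V p τ (i + (l + 1)) - eulerPolygon V p τ i -
          ((l + 1 : ℕ) * τ) • V (eulerPolygon V p τ i) =
          (eulerPolygon V p τ (i + l) - eulerPolygon V p τ i - (l * τ) • V (eulerPolygon V p τ i)) +
          τ • (V (eulerPolygon V p τ (i + l)) - V (eulerPolygon V p τ i)) := by
        rw [← add_assoc, eulerPolygon]
        push_cast
        module
      rw [e1]
      refine (norm_add_le _ _).trans ?_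
      rw [norm_smul, Real.norm_eq_abs, abs_of_nonneg hτ]
      push_cast
      nlinarith [ih (by omega), mul_le_mul_of_nonneg_left h3 hτ]
  exact this k le_rfl

/-- **Peano's theorem**: an autonomous differential equation with continuous right-hand side has
local solutions. Euler's polygons converge along an ultrafilter, and the limit inherits the
difference quotient estimates. -/
theorem exists_hasDerivWithinAt_of_continuousOn [FiniteDimensional ℝ E] {V : E → E} {p : E} {ρ : ℝ}
    (hρ : 0 < ρ) (hV : ContinuousOn V (Metric.closedBall p ρ)) :
    ∃ T > 0, ∃ c : ℝ → E, c 0 = p ∧ ∀ t ∈ Icc 0 T, c t ∈ Metric.closedBall p ρ ∧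
      HasDerivWithinAt c (V (c t)) (Icc 0 T) t := by
  have : ProperSpace E := FiniteDimensional.proper_real E
  have hcomp := isCompact_closedBall p ρ
  obtain ⟨M₀, hM₀⟩ := hcomp.exists_bound_of_continuousOn hV
  set M := max M₀ 1 with hMdef
  have hM : 0 < M := lt_of_lt_of_le one_pos (le_max_right _ _)
  have hVM : ∀ x ∈ Metric.closedBall p ρ, ‖V x‖ ≤ M := fun x hx =>
    (hM₀ x hx).trans (le_max_left _ _)
  set T := ρ / M with hT
  have pT : 0 < T := div_pos hρ hM
  have hTM : T * M = ρ := div_mul_cancel₀ _ hM.ne'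
  set τ : ℕ → ℝ := fun N => 1 / ((N : ℝ) + 1) with hτ
  have pτ : ∀ N, 0 < τ N := fun N => by positivity
  have tτ : Tendsto τ atTop (𝓝 0) := tendsto_one_div_add_atTop_nhds_zero_nat
  set x : ℕ → ℝ → E := fun N t => eulerPolygon V p (τ N) ⌊t / τ N⌋₊ with hx
  have fl : ∀ N, ∀ t, 0 ≤ t → (⌊t / τ N⌋₊ : ℝ) * τ N ≤ t ∧ t < (⌊t / τ N⌋₊ : ℝ) * τ N + τ N := by
    intro N t ht
    have h1 := Nat.floor_le (div_nonneg ht (pτ N).le)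
    have h2 := Nat.lt_floor_add_one (t / τ N)
    rw [le_div_iff₀ (pτ N)] at h1
    rw [div_lt_iff₀ (pτ N)] at h2
    exact ⟨h1, by linarith⟩
  have xmem : ∀ N, ∀ t ∈ Icc 0 T, x N t ∈ Metric.closedBall p ρ := by
    intro N t ht
    refine (norm_eulerPolygon_add_sub_le (pτ N).le hVM _ 0 ?_ hM.le).1
    have := (fl N t ht.1).1
    simp only [add_zero]
    calc _ ≤ t * M := by gcongr
      _ ≤ T * M := by gcongr; exact ht.2
      _ = ρ := hTM
  -- the limit of the polygons along a nonprincipal ultrafilter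
  have hlim : ∀ t, ∃ y, t ∈ Icc 0 T → y ∈ Metric.closedBall p ρ ∧
      Tendsto (fun N => x N t) (hyperfilter ℕ : Filter ℕ) (𝓝 y) := by
    intro t
    by_cases ht : t ∈ Icc 0 T
    · obtain ⟨y, hy, hle⟩ := hcomp.ultrafilter_le_nhds ((hyperfilter ℕ).map fun N => x N t) (by
        rw [le_principal_iff]
        exact Filter.mem_map.2 (univ_mem' fun N => xmem N t ht))
      exact ⟨y, fun _ => ⟨hy, hle⟩⟩
    · exact ⟨p, fun h => absurd h ht⟩
  choose c hc using hlim
  have tτ' : Tendsto τ (hyperfilter ℕ : Filter ℕ) (𝓝 0) := tτ.mono_left Nat.hyperfilter_le_atTop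
  have c0 : c 0 = p := by
    have h1 := (hc 0 ⟨le_rfl, pT.le⟩).2
    have h2 : (fun N => x N 0) = fun _ => p := by
      funext N; simp [hx, eulerPolygon]
    rw [h2] at h1
    exact tendsto_nhds_unique h1 tendsto_const_nhds
  -- the polygons at the times `s ≤ t` differ by `k` steps, where `k τ` is close to `t - s`
  have idx : ∀ N s t, 0 ≤ s → s ≤ t → t ≤ T → ∃ k : ℕ, x N t = eulerPolygon V p (τ N)
      (⌊s / τ N⌋₊ + k) ∧ |k * τ N - (t - s)| ≤ τ N ∧ (⌊s / τ N⌋₊ + k : ℕ) * τ N * M ≤ ρ := by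
    intro N s t hs hst ht
    have hle : ⌊s / τ N⌋₊ ≤ ⌊t / τ N⌋₊ := Nat.floor_le_floor (by have := pτ N; gcongr)
    obtain ⟨k, hk⟩ := Nat.exists_eq_add_of_le hle
    refine ⟨k, by simp only [hx]; rw [hk], ?_, ?_⟩
    · have h1 := fl N s hs
      have h2 := fl N t (hs.trans hst)
      rw [hk] at h2
      push_cast at h2
      rw [abs_le]; constructor <;> nlinarith
    · rw [← hk]
      have h2 := (fl N t (hs.trans hst)).1
      calc _ ≤ t * M := by gcongr
        _ ≤ T * M := by gcongr
        _ = ρ := hTM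
  have lip : ∀ s t, 0 ≤ s → s ≤ t → t ≤ T → ‖c t - c s‖ ≤ (t - s) * M := by
    intro s t hs hst ht
    have h1 := (hc t ⟨hs.trans hst, ht⟩).2.sub (hc s ⟨hs, hst.trans ht⟩).2
    have h2 : Tendsto (fun N => (t - s + τ N) * M) (hyperfilter ℕ : Filter ℕ)
        (𝓝 ((t - s + 0) * M)) := (tτ'.const_add _).mul_const _
    rw [add_zero] at h2
    refine le_of_tendsto_of_tendsto h1.norm h2 (Eventually.of_forall fun N => ?_)
    obtain ⟨k, hk1, hk2, hk3⟩ := idx N s t hs hst ht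
    simp only
    rw [hk1]
    refine (norm_eulerPolygon_add_sub_le (pτ N).le hVM _ k hk3 hM.le).2.trans ?_
    have := (abs_le.1 hk2).2
    gcongr
    linarith
  have est : ∀ e > 0, ∃ δ > 0, ∀ s t, 0 ≤ s → s ≤ t → t ≤ T → t - s < δ →
      ‖c t - c s - (t - s) • V (c s)‖ ≤ (t - s) * e ∧ ‖V (c t) - V (c s)‖ ≤ e := by
    intro e he
    obtain ⟨δ, hδ, hu⟩ := Metric.uniformContinuousOn_iff.1
      (hcomp.uniformContinuousOn_of_continuous hV) e he
    have hu' : ∀ x ∈ Metric.closedBall p ρ, ∀ y ∈ Metric.closedBall p ρ, ‖x - y‖ < δ →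
        ‖V x - V y‖ ≤ e := fun x hx y hy hxy => by
      have := hu x hx y hy (by rwa [dist_eq_norm])
      rw [dist_eq_norm] at this; exact this.le
    refine ⟨δ / M, div_pos hδ hM, fun s t hs hst ht hlt => ?_⟩
    rw [lt_div_iff₀ hM] at hlt
    have hsm : s ∈ Icc 0 T := ⟨hs, hst.trans ht⟩
    have htm : t ∈ Icc 0 T := ⟨hs.trans hst, ht⟩
    refine ⟨?_, hu' _ (hc t htm).1 _ (hc s hsm).1 ((lip s t hs hst ht).trans_lt hlt)⟩
    have hVs : Tendsto (fun N => V (x N s)) (hyperfilter ℕ : Filter ℕ) (𝓝 (V (c s))) :=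
      (hV _ (hc s hsm).1).tendsto.comp (tendsto_nhdsWithin_iff.2
        ⟨(hc s hsm).2, Eventually.of_forall fun N => xmem N s hsm⟩)
    have h1 := ((hc t htm).2.sub (hc s hsm).2).sub (hVs.const_smul (t - s))
    have h2 : Tendsto (fun N => (t - s + τ N) * e + τ N * M) (hyperfilter ℕ : Filter ℕ)
        (𝓝 ((t - s + 0) * e + 0 * M)) := ((tτ'.const_add _).mul_const _).add (tτ'.mul_const _)
    rw [add_zero, zero_mul, add_zero] at h2
    have h3 : Tendsto (fun N => (t - s + τ N) * M) (hyperfilter ℕ : Filter ℕ)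
        (𝓝 ((t - s + 0) * M)) := (tτ'.const_add _).mul_const _
    rw [add_zero] at h3
    refine le_of_tendsto_of_tendsto h1.norm h2 ?_
    filter_upwards [h3.eventually_lt_const hlt] with N hN
    obtain ⟨k, hk1, hk2, hk3⟩ := idx N s t hs hst ht
    have hk4 := (abs_le.1 hk2).2
    have hk5 : k * τ N * M < δ := lt_of_le_of_lt (by gcongr; linarith) hN
    have h6 := norm_eulerPolygon_sub_smul_le (pτ N).le hVM hM.le hu' _ k hk3 hk5
    rw [← hk1] at h6
    have e1 : x N t - x N s - (t - s) • V (x N s) =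
        (x N t - x N s - (k * τ N) • V (x N s)) + (k * τ N - (t - s)) • V (x N s) := by module
    rw [e1]
    refine (norm_add_le _ _).trans (add_le_add (h6.trans (by gcongr; linarith)) ?_)
    rw [norm_smul, Real.norm_eq_abs]
    exact mul_le_mul hk2 (hVM _ (xmem N s hsm)) (norm_nonneg _) (pτ N).le
  refine ⟨T, pT, c, c0, fun t ht => ⟨(hc t ht).1, ?_⟩⟩
  rw [hasDerivWithinAt_iff_isLittleO, Asymptotics.isLittleO_iff]
  intro e he
  obtain ⟨δ, hδ, H⟩ := est (e / 2) (by positivity)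
  filter_upwards [inter_mem_nhdsWithin (Icc 0 T) (Metric.ball_mem_nhds t hδ)] with s hs
  have hd : |s - t| < δ := by have := hs.2; rwa [Metric.mem_ball, Real.dist_eq] at this
  rw [Real.norm_eq_abs]
  rcases le_total t s with h | h
  · rw [abs_of_nonneg (by linarith)] at hd ⊢
    have := (H t s ht.1 h hs.1.2 hd).1
    nlinarith
  · rw [abs_of_nonpos (by linarith)] at hd ⊢
    obtain ⟨h1, h2⟩ := H s t hs.1.1 h ht.2 (by linarith)
    have e1 : c s - c t - (s - t) • V (c t) =
        -(c t - c s - (t - s) • V (c s)) + (t - s) • (V (c t) - V (c s)) := by module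
    rw [e1]
    refine (norm_add_le _ _).trans ?_
    rw [norm_neg, norm_smul, Real.norm_eq_abs, abs_of_nonneg (by linarith)]
    nlinarith

namespace AchronalGraph
variable {A : AchronalGraph E}

/-! ### The null direction at a point of differentiability -/

/-- Affine reparametrization of null geodesics. -/
lemma IsNullGeodesic.comp_affine {σ σ' k q : ℝ} {c v : ℝ → E} {s s' : Set ℝ}
    (h : A.IsNullGeodesic σ c v s) (hk : k ≠ 0) (hσ : ∀ x, σ * x < 0 → σ' * (k * x) < 0)
    (hs : MapsTo (fun t => k * t + q) s' s) :
    A.IsNullGeodesic σ' (fun t => c (k * t + q)) (fun t => k • v (k * t + q)) s' := by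
  intro t ht
  obtain ⟨h1, h2, h3, h4, h5, h6, h7⟩ := h _ (hs ht)
  have hd : HasDerivWithinAt (fun t => k * t + q) k s' t := by
    have : HasDerivAt (fun t => k * t + q) k t := by
      simpa using ((hasDerivAt_id t).const_mul k).add_const q
    exact this.hasDerivWithinAt
  refine ⟨h1.scomp t hd hs, ?_, h3, h4, smul_ne_zero hk h5, ?_, ?_⟩
  · rw [acc_smul]
    refine HasDerivWithinAt.congr_deriv ((h2.scomp t hd hs).const_smul k) ?_
    rw [smul_smul, sq]
  · simp [h6]
  · simp only [map_smul, smul_eq_mul]; exact hσ _ h7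

lemma IsNullGeodesic.reverse {σ : ℝ} {c v : ℝ → E} {b : ℝ} (h : A.IsNullGeodesic σ c v (Icc 0 b)) :
    A.IsNullGeodesic (-σ) (fun t => c (-1 * t + b)) (fun t => (-1 : ℝ) • v (-1 * t + b))
      (Icc 0 b) := by
  refine h.comp_affine (by norm_num) (fun x hx => by linarith) (fun t ht => ?_)
  constructor <;> linarith [ht.1, ht.2]

/-- A hyperplane bounding the hypersurface on one side near `y`, up to second order, is tangent to
it where it is differentiable. -/
lemma eq_smul_of_quadratic_bound {y : E} {D P : E →L[ℝ] ℝ} {C ρ : ℝ} (hρ : 0 < ρ)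
    (hy : A.height y = 0) (hD : HasFDerivAt A.height D y)
    (H : ∀ z, A.height z = 0 → ‖z - y‖ ≤ ρ → P (z - y) ≤ C * ‖z - y‖ ^ 2) (x : E) :
    P x = P A.e₀ * D x := by
  -- `y + u t` is the point of the hypersurface on the vertical line through `y + t x`; the function
  -- `P (u t) - C ‖u t‖²` has a maximum at `0`
  set u : ℝ → E := fun t => t • x - A.height (y + t • x) • A.e₀ with hu
  have h1 : HasDerivAt (fun s : ℝ => y + s • x) x 0 := by
    simpa using ((hasDerivAt_id (0 : ℝ)).smul_const x).const_add y
  have h2 : HasDerivAt (fun s : ℝ => A.height (y + s • x)) (D x) 0 := by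
    have h3 : HasFDerivAt A.height D (y + (0 : ℝ) • x) := by simpa using hD
    exact h3.comp_hasDerivAt (0 : ℝ) h1
  have du : HasDerivAt u (x - D x • A.e₀) 0 := by
    have h3 : HasDerivAt (fun s : ℝ => s • x) x 0 := by
      simpa using (hasDerivAt_id (0 : ℝ)).smul_const x
    exact h3.sub (h2.smul_const A.e₀)
  have u0 : u 0 = 0 := by simp [hu, hy]
  have dn : HasDerivAt (fun t => ‖u t‖ ^ 2) 0 0 := by
    rw [hasDerivAt_iff_isLittleO]
    have h3 := du.isBigO_sub
    simp only [u0, sub_zero] at h3 ⊢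
    have h4 := (h3.norm_left.pow 2).trans_isLittleO
      (Asymptotics.isLittleO_pow_id (𝕜 := ℝ) one_lt_two)
    simpa using h4
  have df : HasDerivAt (fun t => P (u t) - C * ‖u t‖ ^ 2) (P (x - D x • A.e₀) - C * 0) 0 :=
    (P.hasFDerivAt.comp_hasDerivAt (0 : ℝ) du).sub (dn.const_mul C)
  have hmax : IsLocalMax (fun t => P (u t) - C * ‖u t‖ ^ 2) 0 := by
    have : ∀ᶠ t in 𝓝 (0 : ℝ), ‖u t‖ < ρ := by
      have := du.continuousAt.norm
      rw [ContinuousAt, u0, norm_zero] at this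
      exact this.eventually_lt_const hρ
    filter_upwards [this] with t ht
    simp only [u0, map_zero, norm_zero]
    have hz : A.height (y + u t) = 0 := by
      have : y + u t = (y + t • x) + (-A.height (y + t • x)) • A.e₀ := by simp only [hu]; module
      rw [this, A.height_add]; ring
    have := H (y + u t) hz (by rw [add_sub_cancel_left]; exact ht.le)
    rw [add_sub_cancel_left] at this
    norm_num
    exact this
  have := hmax.hasDerivAt_eq_zero df
  rw [map_sub, map_smul, smul_eq_mul] at this
  linarith

/-- Local bounds for a given null geodesic. -/
lemma IsNullGeodesic.exists_bounds {σ : ℝ} {c v : ℝ → E} {b : ℝ} (hb : 0 ≤ b)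
    (h : A.IsNullGeodesic σ c v (Icc 0 b)) :
    ∃ m > 0, ∃ M > 0, ∃ d > 0, ∀ t ∈ Icc 0 b,
      m ≤ ‖v t‖ ∧ ‖v t‖ ≤ M ∧ dist (c t) A.ctr ≤ A.r - d := by
  have hC := h.c1Curve
  have hne : (Icc 0 b).Nonempty := nonempty_Icc.2 hb
  obtain ⟨t₁, ht₁, h₁⟩ := isCompact_Icc.exists_isMinOn hne hC.2.norm
  obtain ⟨t₂, ht₂, h₂⟩ := isCompact_Icc.exists_isMaxOn hne hC.2.norm
  obtain ⟨t₃, ht₃, h₃⟩ := isCompact_Icc.exists_isMaxOn hne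
    ((Continuous.dist continuous_id continuous_const).comp_continuousOn hC.continuousOn :
      ContinuousOn (fun t => dist (c t) A.ctr) (Icc 0 b))
  refine ⟨‖v t₁‖, norm_pos_iff.2 (h t₁ ht₁).2.2.2.2.1, ‖v t₂‖,
    norm_pos_iff.2 (h t₂ ht₂).2.2.2.2.1, A.r - dist (c t₃) A.ctr, ?_,
    fun t ht => ⟨h₁ ht, h₂ ht, ?_⟩⟩
  · have := (h t₃ ht₃).2.2.1; rw [Metric.mem_ball] at this; linarith
  · have : dist (c t) A.ctr ≤ dist (c t₃) A.ctr := h₃ ht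
    linarith

/-- Where the hypersurface is differentiable, its null geodesics are orthogonal to it. -/
lemma IsNullGeodesic.momentum_eq [FiniteDimensional ℝ E] {σ : ℝ} (hσ : σ = 1 ∨ σ = -1)
    {c v : ℝ → E} {b : ℝ} (hb : 0 < b) (h : A.IsNullGeodesic σ c v (Icc 0 b)) {D : E →L[ℝ] ℝ}
    (hD : HasFDerivAt A.height D (c 0)) (x : E) :
    A.G (c 0) (v 0) x = A.G (c 0) (v 0) A.e₀ * D x := by
  obtain ⟨m, hm, M, hM, d, hd, hbd⟩ := h.exists_bounds hb.le
  obtain ⟨C, hC, ρ, hρ, H⟩ := exists_quadratic_bound A hm hM hb hd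
  exact eq_smul_of_quadratic_bound hρ (h 0 (left_mem_Icc.2 hb.le)).2.2.2.1 hD
    (H σ c v hσ h hbd) x

/-- Where the hypersurface is differentiable, its null geodesics have a common direction. -/
lemma exists_eq_smul_of_differentiable [FiniteDimensional ℝ E] {σ σ' : ℝ} (hσ : σ = 1 ∨ σ = -1)
    (hσ' : σ' = 1 ∨ σ' = -1) {c v c' v' : ℝ → E} {b b' : ℝ} (hb : 0 < b) (hb' : 0 < b')
    (h : A.IsNullGeodesic σ c v (Icc 0 b)) (h' : A.IsNullGeodesic σ' c' v' (Icc 0 b'))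
    (hcc : c 0 = c' 0) (hD : DifferentiableAt ℝ A.height (c 0)) :
    ∃ k : ℝ, k ≠ 0 ∧ 0 < σ * σ' * k ∧ v' 0 = k • v 0 := by
  have e1 := h.momentum_eq hσ hb hD.hasFDerivAt
  have e2 := h'.momentum_eq hσ' hb' (hcc ▸ hD.hasFDerivAt)
  obtain ⟨-, -, hy, -, -, -, s1⟩ := h 0 (left_mem_Icc.2 hb.le)
  obtain ⟨-, -, -, -, -, -, s2⟩ := h' 0 (left_mem_Icc.2 hb'.le)
  rw [← hcc] at e2 s2
  rw [A.symm _ hy] at s1 s2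
  set a := A.G (c 0) (v 0) A.e₀
  set a' := A.G (c 0) (v' 0) A.e₀
  have ha : a ≠ 0 := by rintro h0; rw [h0] at s1; simp at s1
  have ha' : a' ≠ 0 := by rintro h0; rw [h0] at s2; simp at s2
  refine ⟨a' / a, div_ne_zero ha' ha, ?_, ?_⟩
  · have h1 : 0 < (σ * a) * (σ' * a') := mul_pos_of_neg_of_neg s1 s2
    have h2 : σ * σ' * (a' / a) = (σ * a) * (σ' * a') / (a * a) := by field_simp
    rw [h2]
    exact div_pos h1 (mul_self_pos.2 ha)
  · rw [← sub_eq_zero]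
    refine eq_zero_of_forall hy fun x => ?_
    rw [map_sub, sub_apply, map_smul, smul_apply, e1, e2, smul_eq_mul]
    field_simp
    ring

end AchronalGraph

end NullHorizon

namespace NullHorizon

variable {E : Type*} [NormedAddCommGroup E] [NormedSpace ℝ E]

/-! ### Uniform length of null geodesics -/

/-- The Picard–Lindelöf theorem for an autonomous equation, together with the information that the
solution stays close to its initial point. -/
lemma exists_solution_mem_closedBall {F : Type*} [NormedAddCommGroup F] [NormedSpace ℝ F]
    [CompleteSpace F] {f : F → F} {z : F} {a L ε : ℝ} {K : NNReal} (ha : 0 ≤ a) (hL : 0 ≤ L)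
    (hε : 0 ≤ ε) (hεa : L * ε ≤ a) (hf : LipschitzOnWith K f (Metric.closedBall z a))
    (hb : ∀ x ∈ Metric.closedBall z a, ‖f x‖ ≤ L) :
    ∃ α : ℝ → F, α 0 = z ∧ ∀ t ∈ Icc 0 ε, α t ∈ Metric.closedBall z a ∧
      HasDerivWithinAt α (f (α t)) (Icc 0 ε) t := by
  lift a to NNReal using ha
  lift L to NNReal using hL
  have hpl : IsPicardLindelof (fun _ => f) (tmin := 0) (tmax := ε) ⟨0, left_mem_Icc.2 hε⟩ z
      a 0 L K :=
    { lipschitzOnWith := fun _ _ => hf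
      continuousOn := fun _ _ => continuousOn_const
      norm_le := fun _ _ x hx => hb x hx
      mul_max_le := by
        simp only [sub_zero, sub_self, NNReal.coe_zero]
        rw [max_eq_left hε]; exact hεa }
  have hz : z ∈ Metric.closedBall z ((0 : NNReal) : ℝ) := by simp
  obtain ⟨α, hα⟩ := ODE.FunSpace.exists_isFixedPt_next hpl hz
  refine ⟨α.compProj, ?_, fun t ht => ⟨α.compProj_mem_closedBall hpl.mul_max_le, ?_⟩⟩
  · have := ODE.FunSpace.compProj_val (α := α) (t := ⟨0, left_mem_Icc.2 hε⟩)
    rw [this, ← hα, ODE.FunSpace.next_apply₀]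
  · have h1 := ODE.hasDerivWithinAt_picard_Icc (f := fun _ => f) (left_mem_Icc.2 hε)
      hpl.continuousOn_uncurry α.continuous_compProj.continuousOn
      (fun _ _ => α.compProj_mem_closedBall hpl.mul_max_le) z ht
    refine h1.congr_of_mem (fun s hs => ?_) ht
    nth_rw 1 [← hα]
    rw [ODE.FunSpace.compProj_of_mem hs, ODE.FunSpace.next_apply]

namespace AchronalGraph
variable {A : AchronalGraph E}

/-- If the null geodesics of the hypersurface starting at a given point can be extended as long as
they stay near that point, then they run for a time depending only on the domain (for a fixed
normalization of the initial velocity), and with controlled velocity. -/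
lemma exists_uniform_time [FiniteDimensional ℝ E] (A : AchronalGraph E) :
    ∃ ε > 0, ∃ m > 0, ∃ M > 0, ∃ d > 0, ∀ (σ : ℝ) (c v : ℝ → E) (b : ℝ), 0 < b →
      A.IsNullGeodesic σ c v (Icc 0 b) →
      c 0 ∈ Metric.closedBall A.ctr (A.r / 4) → σ * A.G (c 0) A.e₀ (v 0) = -1 →
      (σ = 1 ∨ σ = -1) →
      (∀ (b' : ℝ) (c' v' : ℝ → E), 0 < b' → A.IsNullGeodesic σ c' v' (Icc 0 b') → c' 0 = c 0 →
        ∃ δ > 0, ∃ c'' v'' : ℝ → E, A.IsNullGeodesic σ c'' v'' (Icc 0 δ) ∧ c'' 0 = c' b' ∧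
          v'' 0 = v' b') →
      ∃ c₁ v₁ : ℝ → E, A.IsNullGeodesic σ c₁ v₁ (Icc 0 ε) ∧ c₁ 0 = c 0 ∧ v₁ 0 = v 0 ∧
        ∀ t ∈ Icc 0 ε, m ≤ ‖v₁ t‖ ∧ ‖v₁ t‖ ≤ M ∧ dist (c₁ t) A.ctr ≤ A.r - d := by
  have : ProperSpace E := FiniteDimensional.proper_real E
  have hr := A.r_pos
  have hK := A.K_pos
  have hκ := A.κ_pos
  set R := 1 / A.κ with hR
  have pR : 0 < R := by positivity
  set f : E × E → E × E := fun z => (z.2, A.acc z.1 z.2) with hf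
  -- the phase space region in which the geodesic flow has uniform bounds; `R` bounds the normalized
  -- causal vectors
  set S : Set (E × E) := Metric.closedBall A.ctr (A.r / 2) ×ˢ Metric.closedBall (0 : E) (R + 1)
    with hS
  have cS : IsCompact S := (isCompact_closedBall _ _).prod (isCompact_closedBall _ _)
  have vS : Convex ℝ S := (convex_closedBall _ _).prod (convex_closedBall _ _)
  have Sball : ∀ z ∈ S, z.1 ∈ A.ball := fun z hz =>
    Metric.closedBall_subset_ball (by linarith) hz.1
  have hfS : ContDiffOn ℝ 1 f S := fun z hz =>
    (contDiffAt_snd.prodMk (contDiffAt_acc (Sball z hz) z.2)).contDiffWithinAt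
  obtain ⟨K', hK'⟩ := hfS.exists_lipschitzOnWith (by norm_num) vS cS
  obtain ⟨L₀, hL₀⟩ := cS.exists_bound_of_continuousOn hfS.continuousOn
  set L := max L₀ 1 with hL
  have pL : 0 < L := lt_of_lt_of_le one_pos (le_max_right _ _)
  set a := min (min (A.r / 8) (1 / 2)) (1 / (2 * A.K)) with ha
  have pa : 0 < a := by positivity
  have a1 : a ≤ A.r / 8 := (min_le_left _ _).trans (min_le_left _ _)
  have a2 : a ≤ 1 / 2 := (min_le_left _ _).trans (min_le_right _ _)
  have a3 : a ≤ 1 / (2 * A.K) := min_le_right _ _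
  set ε := a / L with hε
  have pε : 0 < ε := by positivity
  refine ⟨ε, pε, 1 / (2 * A.K), by positivity, R + 1, by positivity, A.r / 2, by positivity, ?_⟩
  intro σ c v b hb hgeo hc0 hnorm hσ ext
  obtain ⟨-, -, hy, hh0, hv0, hn0, hs0⟩ := hgeo 0 (left_mem_Icc.2 hb.le)
  have habs : |A.G (c 0) A.e₀ (v 0)| = 1 := by
    rcases hσ with rfl | rfl
    · rw [show A.G (c 0) A.e₀ (v 0) = -1 by linarith]; norm_num
    · rw [show A.G (c 0) A.e₀ (v 0) = 1 by linarith]; norm_num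
  have nv1 : ‖v 0‖ ≤ R := by
    have := A.cone _ hy _ hn0.le
    rw [habs] at this
    rw [hR, le_div_iff₀ hκ]; linarith
  have nv2 : 1 / A.K ≤ ‖v 0‖ := by
    have := abs_G_le hy A.e₀ (v 0)
    rw [habs, A.norm_e₀, mul_one] at this
    rw [div_le_iff₀ hK]; linarith
  set z : E × E := (c 0, v 0) with hz
  have hsub : ∀ x ∈ Metric.closedBall z a, dist x.1 A.ctr < A.r / 2 ∧ ‖x.2‖ < R + 1 ∧
      1 / (2 * A.K) ≤ ‖x.2‖ := by
    intro x hx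
    rw [Metric.mem_closedBall, Prod.dist_eq, max_le_iff] at hx
    have h1 : dist x.1 (c 0) ≤ a := hx.1
    have h2 : ‖x.2 - v 0‖ ≤ a := by rw [← dist_eq_norm]; exact hx.2
    refine ⟨?_, ?_, ?_⟩
    · have := dist_triangle x.1 (c 0) A.ctr
      rw [Metric.mem_closedBall] at hc0
      linarith
    · have : ‖x.2‖ ≤ ‖v 0‖ + ‖x.2 - v 0‖ := by
        have := norm_add_le (v 0) (x.2 - v 0); rwa [add_sub_cancel] at this
      linarith
    · have : ‖v 0‖ ≤ ‖x.2‖ + ‖x.2 - v 0‖ := by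
        have := norm_sub_le x.2 (x.2 - v 0); rwa [sub_sub_cancel] at this
      have e : 1 / A.K = 1 / (2 * A.K) + 1 / (2 * A.K) := by field_simp; norm_num
      linarith
  have hsubS : Metric.closedBall z a ⊆ S := fun x hx => by
    obtain ⟨h1, h2, -⟩ := hsub x hx
    exact ⟨h1.le, mem_closedBall_zero_iff.2 h2.le⟩
  -- the solution of the geodesic equation in the ambient space
  obtain ⟨Φ, Φ0, hΦ⟩ := exists_solution_mem_closedBall pa.le pL.le pε.le
    (by rw [hε, mul_div_cancel₀ _ pL.ne']) (hK'.mono hsubS)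
    (fun x hx => (hL₀ x (hsubS hx)).trans (le_max_left _ _))
  have cΦ : ContinuousOn Φ (Icc 0 ε) := fun t ht => (hΦ t ht).2.continuousWithinAt
  have bΦ : ∀ t ∈ Icc 0 ε, (Φ t).1 ∈ A.ball := fun t ht => Sball _ (hsubS (hΦ t ht).1)
  -- the set of times at which the solution is a null vector based on the hypersurface
  set W : Set ℝ := {t | A.height (Φ t).1 = 0 ∧ A.G (Φ t).1 (Φ t).2 (Φ t).2 = 0 ∧
    σ * A.G (Φ t).1 A.e₀ (Φ t).2 ≤ 0} with hW
  have lgW : ∀ x ∈ Icc 0 ε, Icc 0 x ⊆ W →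
      A.IsNullGeodesic σ (fun t => (Φ t).1) (fun t => (Φ t).2) (Icc 0 x) := by
    intro x hx hsubW t ht
    have ht' : t ∈ Icc 0 ε := ⟨ht.1, ht.2.trans hx.2⟩
    have hd := (hΦ t ht').2.mono (Icc_subset_Icc_right hx.2)
    obtain ⟨w1, w2, w3⟩ := hsubW ht
    have hne : (Φ t).2 ≠ 0 := by
      have := (hsub _ (hΦ t ht').1).2.2
      rw [← norm_pos_iff]
      exact lt_of_lt_of_le (by positivity) this
    refine ⟨hd.fst, hd.snd, bΦ t ht', w1, hne, w2, lt_of_le_of_ne w3 ?_⟩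
    intro h0
    have h1 := A.cone _ (bΦ t ht') _ w2.le
    have h2 : A.G (Φ t).1 A.e₀ (Φ t).2 = 0 := by
      rcases hσ with rfl | rfl <;> linarith
    rw [h2, abs_zero] at h1
    have : 0 < A.κ * ‖(Φ t).2‖ := mul_pos hκ (norm_pos_iff.2 hne)
    linarith
  have closedW : IsClosed (Icc 0 ε ∩ W) := by
    have c1 : ContinuousOn (fun t => (Φ t).1) (Icc 0 ε) := continuous_fst.comp_continuousOn cΦ
    have c2 : ContinuousOn (fun t => (Φ t).2) (Icc 0 ε) := continuous_snd.comp_continuousOn cΦ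
    have cG : ContinuousOn (fun t => A.G (Φ t).1) (Icc 0 ε) := continuousOn_G.comp c1 bΦ
    have e : Icc 0 ε ∩ W = Icc 0 ε ∩ (fun t => (A.height (Φ t).1, A.G (Φ t).1 (Φ t).2 (Φ t).2,
        σ * A.G (Φ t).1 A.e₀ (Φ t).2)) ⁻¹' ({0} ×ˢ {0} ×ˢ Iic 0) := by
      ext t; simp [hW]
    rw [e]
    refine ContinuousOn.preimage_isClosed_of_isClosed ?_ isClosed_Icc
      (isClosed_singleton.prod (isClosed_singleton.prod isClosed_Iic))
    exact (A.continuousOn_height.comp c1 bΦ).prodMk (((cG.clm_apply c2).clm_apply c2).prodMk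
      (continuousOn_const.mul ((cG.clm_apply continuousOn_const).clm_apply c2)))
  have hW0 : (0 : ℝ) ∈ W := by
    simp only [hW, mem_ofPred_eq, Φ0, hz]
    exact ⟨hh0, hn0, hs0.le⟩
  -- the solution stays in the hypersurface: this is a closed condition, and it is an open one by
  -- extendibility and uniqueness of geodesics
  have main : Icc 0 ε ⊆ {x | Icc 0 x ⊆ W} := by
    refine IsClosed.Icc_subset_of_forall_exists_gt ?_ ?_ ?_
    · refine isClosed_of_closure_subset fun t ht => ?_
      have htI : t ∈ Icc 0 ε := by
        have := closure_mono (inter_subset_right (s := {x | Icc 0 x ⊆ W}) (t := Icc 0 ε)) ht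
        rwa [isClosed_Icc.closure_eq] at this
      refine ⟨fun u hu => ?_, htI⟩
      rcases hu.2.eq_or_lt with rfl | hlt
      · have h1 : {x | Icc 0 x ⊆ W} ∩ Icc 0 ε ⊆ Icc 0 ε ∩ W := fun x hx =>
          ⟨hx.2, hx.1 (right_mem_Icc.2 hx.2.1)⟩
        have := closure_mono h1 ht
        rw [closedW.closure_eq] at this
        exact this.2
      · obtain ⟨x, hx1, hx2⟩ := mem_closure_iff.1 ht (Ioi u) isOpen_Ioi hlt
        exact hx2.1 ⟨hu.1, le_of_lt hx1⟩
    · intro u hu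
      rw [le_antisymm hu.2 hu.1]; exact hW0
    · rintro x ⟨hxW, hx⟩ y hxy
      have hxI : x ∈ Icc 0 ε := Ico_subset_Icc_self hx
      obtain ⟨δ, hδ, c'', v'', hg, e1, e2⟩ : ∃ δ > 0, ∃ c'' v'' : ℝ → E,
          A.IsNullGeodesic σ c'' v'' (Icc 0 δ) ∧ c'' 0 = (Φ x).1 ∧ v'' 0 = (Φ x).2 := by
        rcases hx.1.eq_or_lt with rfl | hpos
        · exact ⟨b, hb, c, v, hgeo, by rw [Φ0], by rw [Φ0]⟩
        · exact ext x _ _ hpos (lgW x hxI hxW) (by rw [Φ0])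
      have hC := hg.c1Curve
      have c0'' := hC.continuousOn 0 (left_mem_Icc.2 hδ.le)
      have v0'' := hC.2 0 (left_mem_Icc.2 hδ.le)
      obtain ⟨i1, i2, -⟩ := hsub _ (hΦ x hxI).1
      have ev1 : ∀ᶠ u in 𝓝[Icc 0 δ] 0, dist (c'' u) A.ctr < A.r / 2 :=
        (c0''.dist continuousWithinAt_const).eventually_lt_const (by rw [e1]; exact i1)
      have ev2 : ∀ᶠ u in 𝓝[Icc 0 δ] 0, ‖v'' u‖ < R + 1 :=
        v0''.norm.eventually_lt_const (by simp only [e2]; exact i2)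
      obtain ⟨δ', hδ', hb'⟩ := Metric.mem_nhdsWithin_iff.1 (ev1.and ev2)
      set δ₂ := min (min δ (δ' / 2)) (min (y - x) (ε - x)) with hδ₂
      have hyx : 0 < y - x := sub_pos.2 hxy
      have hεx : 0 < ε - x := sub_pos.2 hx.2
      have pδ₂ : 0 < δ₂ := by positivity
      have d1 : δ₂ ≤ δ := (min_le_left _ _).trans (min_le_left _ _)
      have d2 : δ₂ ≤ δ' / 2 := (min_le_left _ _).trans (min_le_right _ _)
      have d3 : δ₂ ≤ y - x := (min_le_right _ _).trans (min_le_left _ _)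
      have d4 : δ₂ ≤ ε - x := (min_le_right _ _).trans (min_le_right _ _)
      have dΦ : ∀ u ∈ Icc 0 δ₂,
          HasDerivWithinAt (fun u => Φ (x + u)) (f (Φ (x + u))) (Icc 0 δ₂) u := by
        intro u hu
        have hm : MapsTo (fun u => x + u) (Icc 0 δ₂) (Icc 0 ε) := fun w hw =>
          ⟨by linarith [hw.1, hx.1], by linarith [hw.2]⟩
        have h1 : HasDerivWithinAt (fun u => x + u) 1 (Icc 0 δ₂) u :=
          ((hasDerivAt_id u).const_add x).hasDerivWithinAt
        simpa [Function.comp_def] using (hΦ _ (hm hu)).2.scomp u h1 hm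
      have dg : ∀ u ∈ Icc 0 δ₂, HasDerivWithinAt (fun u => (c'' u, v'' u)) (f (c'' u, v'' u))
          (Icc 0 δ₂) u := by
        intro u hu
        obtain ⟨h1, h2, -⟩ := hg u ⟨hu.1, hu.2.trans d1⟩
        exact (h1.prodMk h2).mono (Icc_subset_Icc_right d1)
      have up : ∀ (g : ℝ → E × E) g' u, u ∈ Ico 0 δ₂ → HasDerivWithinAt g g' (Icc 0 δ₂) u →
          HasDerivWithinAt g g' (Ici u) u := fun g g' u hu h =>
        h.mono_of_mem_nhdsWithin (Icc_mem_nhdsGE_of_mem hu)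
      have eq := ODE_solution_unique_of_mem_Icc_right (v := fun _ => f) (s := fun _ => S) (K := K')
        (a := 0) (b := δ₂) (fun _ _ => hK')
        (fun u hu => (dΦ u hu).continuousWithinAt)
        (fun u hu => up _ _ u hu (dΦ u (Ico_subset_Icc_self hu)))
        (fun u hu => hsubS (hΦ _ ⟨by linarith [hu.1, hx.1], by linarith [hu.2]⟩).1)
        (fun u hu => (dg u hu).continuousWithinAt)
        (fun u hu => up _ _ u hu (dg u (Ico_subset_Icc_self hu)))
        (fun u hu => by
          have hm : u ∈ Metric.ball 0 δ' ∩ Icc 0 δ := by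
            refine ⟨?_, hu.1, hu.2.le.trans d1⟩
            rw [Metric.mem_ball, Real.dist_eq, sub_zero, abs_of_nonneg hu.1]
            linarith [hu.2]
          obtain ⟨h1, h2⟩ := hb' hm
          exact ⟨h1.le, mem_closedBall_zero_iff.2 (le_of_lt h2)⟩)
        (by simp [e1, e2])
      refine ⟨x + δ₂, fun w hw => ?_, by simpa using pδ₂, by linarith⟩
      rcases le_total w x with hwx | hwx
      · exact hxW ⟨hw.1, hwx⟩
      · have hu : w - x ∈ Icc 0 δ₂ := ⟨by linarith, by linarith [hw.2]⟩
        have h1 := eq hu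
        simp only [add_sub_cancel] at h1
        obtain ⟨-, -, -, g1, -, g2, g3⟩ := hg _ ⟨hu.1, hu.2.trans d1⟩
        simp only [hW, mem_ofPred_eq, h1]
        exact ⟨g1, g2, g3.le⟩
  refine ⟨fun t => (Φ t).1, fun t => (Φ t).2,
    lgW ε (right_mem_Icc.2 pε.le) (main (right_mem_Icc.2 pε.le)),
    by simp only [Φ0, hz], by simp only [Φ0, hz], ?_⟩
  intro t ht
  obtain ⟨h1, h2, h3⟩ := hsub _ (hΦ t ht).1
  exact ⟨h3, h2.le, by linarith⟩

end AchronalGraph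

end NullHorizon

namespace NullHorizon

/-! ### Null geodesics at points of differentiability -/

variable {E : Type*} [NormedAddCommGroup E] [NormedSpace ℝ E]

lemma tendsto_apply {F G α : Type*} [NormedAddCommGroup F] [NormedSpace ℝ F]
    [NormedAddCommGroup G] [NormedSpace ℝ G] {l : Filter α} {f : α → F →L[ℝ] G} {x : α → F}
    {f₀ : F →L[ℝ] G} {x₀ : F} (hf : Tendsto f l (𝓝 f₀)) (hx : Tendsto x l (𝓝 x₀)) :
    Tendsto (fun a => f a (x a)) l (𝓝 (f₀ x₀)) :=
  ((isBoundedBilinearMap_apply (𝕜 := ℝ) (E := F) (F := G)).continuous.tendsto (f₀, x₀)).comp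
    (hf.prodMk_nhds hx)

namespace AchronalGraph
variable {A : AchronalGraph E}

/-- A null geodesic of the hypersurface, directed according to `σ`, starts at `y`. -/
def Starts (A : AchronalGraph E) (σ : ℝ) (y : E) : Prop :=
  ∃ b > 0, ∃ c v : ℝ → E, A.IsNullGeodesic σ c v (Icc 0 b) ∧ c 0 = y

/-- The null geodesic `(c, v)`, defined up to the time `b`, can be extended beyond it. -/
def Extends (A : AchronalGraph E) (σ : ℝ) (c v : ℝ → E) (b : ℝ) : Prop :=
  ∃ δ > 0, ∃ c' v' : ℝ → E, A.IsNullGeodesic σ c' v' (Icc 0 δ) ∧ c' 0 = c b ∧ v' 0 = v b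

/-- At a point of differentiability there are no corners: arriving geodesics continue as departing
ones. -/
lemma extends_of_differentiable [FiniteDimensional ℝ E] {σ : ℝ} (hσ : σ = 1 ∨ σ = -1)
    {c v : ℝ → E} {b : ℝ} (hb : 0 < b) (h : A.IsNullGeodesic σ c v (Icc 0 b))
    (hs : A.Starts σ (c b)) (hd : DifferentiableAt ℝ A.height (c b)) : A.Extends σ c v b := by
  obtain ⟨b', hb', c', v', hg, h0⟩ := hs
  have hσ' : -σ = 1 ∨ -σ = -1 := by rcases hσ with rfl | rfl <;> simp
  obtain ⟨k, hk, hpos, hv⟩ := exists_eq_smul_of_differentiable hσ hσ' hb' hb hg h.reverse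
    (by rw [h0]; simp) (by rw [h0]; exact hd)
  have hk' : 0 < -k := by rcases hσ with rfl | rfl <;> linarith
  have hσ0 : σ * σ = 1 := by rcases hσ with rfl | rfl <;> norm_num
  refine ⟨b' / -k, div_pos hb' hk', _, _, hg.comp_affine (σ' := σ) (k := -k) (q := 0)
    (s' := Icc 0 (b' / -k)) hk'.ne' (fun x hx => ?_) (fun t ht => ?_), by simp [h0], ?_⟩
  · rw [mul_left_comm]; exact mul_neg_of_pos_of_neg hk' hx
  · simp only [add_zero]
    refine ⟨mul_nonneg hk'.le ht.1, ?_⟩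
    have := ht.2
    rw [le_div_iff₀ hk'] at this
    linarith
  · simp only [mul_zero, add_zero, zero_add, neg_smul, one_smul] at hv ⊢
    rw [← hv, neg_neg]

/-- Null geodesics can be rescaled to have normalized initial velocity. -/
lemma IsNullGeodesic.exists_normalized {σ : ℝ} {c v : ℝ → E} {b : ℝ} (hb : 0 < b)
    (h : A.IsNullGeodesic σ c v (Icc 0 b)) :
    ∃ k > 0, A.IsNullGeodesic σ (fun t => c (k * t + 0)) (fun t => k • v (k * t + 0))
      (Icc 0 (b / k)) ∧ σ * A.G (c 0) A.e₀ (k • v 0) = -1 := by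
  have h7 := (h 0 (left_mem_Icc.2 hb.le)).2.2.2.2.2.2
  set a := σ * A.G (c 0) A.e₀ (v 0) with ha
  have hk : 0 < -a⁻¹ := by rw [neg_pos]; exact inv_lt_zero.2 h7
  refine ⟨-a⁻¹, hk, h.comp_affine hk.ne' (fun x hx => ?_) (fun t ht => ?_), ?_⟩
  · rw [mul_left_comm]; exact mul_neg_of_pos_of_neg hk hx
  · simp only [add_zero]
    refine ⟨mul_nonneg hk.le ht.1, ?_⟩
    have := ht.2
    rw [le_div_iff₀ hk] at this
    linarith
  · rw [map_smul, smul_eq_mul, mul_left_comm, ← ha, neg_mul, inv_mul_cancel₀ h7.ne]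

/-- The one-sided quadratic bound at the initial point of an extendible null geodesic, with
constants depending on the domain only. -/
lemma exists_uniform_quadratic_bound [FiniteDimensional ℝ E] (A : AchronalGraph E) :
    ∃ C > 0, ∃ ρ > 0, ∀ (σ : ℝ) (c v : ℝ → E) (b : ℝ), (σ = 1 ∨ σ = -1) → 0 < b →
      A.IsNullGeodesic σ c v (Icc 0 b) → c 0 ∈ Metric.closedBall A.ctr (A.r / 4) →
      σ * A.G (c 0) A.e₀ (v 0) = -1 →
      (∀ (b' : ℝ) (c' v' : ℝ → E), 0 < b' → A.IsNullGeodesic σ c' v' (Icc 0 b') → c' 0 = c 0 →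
        A.Extends σ c' v' b') →
      ∀ z, A.height z = 0 → ‖z - c 0‖ ≤ ρ → A.G (c 0) (v 0) (z - c 0) ≤ C * ‖z - c 0‖ ^ 2 := by
  obtain ⟨ε, hε, m, hm, M, hM, d, hd, H⟩ := exists_uniform_time A
  obtain ⟨C, hC, ρ, hρ, H'⟩ := exists_quadratic_bound A hm hM hε hd
  refine ⟨C, hC, ρ, hρ, fun σ c v b hσ hb hg hc hn hext z hz hzρ => ?_⟩
  obtain ⟨c₁, v₁, hg₁, e1, e2, hbd⟩ := H σ c v b hb hg hc hn hσ hext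
  have := H' σ c₁ v₁ hσ hg₁ hbd z hz (by rwa [e1])
  rwa [e1, e2] at this

/-- Where the hypersurface is differentiable, the null geodesics departing in one time direction
also arrive from the other one. The normalized null direction is continuous, since it is
characterized by a family of closed conditions; by Peano's theorem it has integral curves in both
directions, and these are causal curves in the hypersurface. -/
lemma starts_neg_of_differentiable [FiniteDimensional ℝ E] {σ : ℝ}
    (hσ : σ = 1 ∨ σ = -1) (hctr : A.height A.ctr = 0)
    (hstart : ∀ y ∈ A.ball, A.height y = 0 → A.Starts σ y)
    (hdiff : ∀ y ∈ A.ball, A.height y = 0 → DifferentiableAt ℝ A.height y) :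
    A.Starts (-σ) A.ctr := by
  have : ProperSpace E := FiniteDimensional.proper_real E
  have hr := A.r_pos
  have hκ := A.κ_pos
  have hσ2 : σ * σ = 1 := by rcases hσ with rfl | rfl <;> norm_num
  obtain ⟨C, hC, ρ, hρ, H⟩ := exists_uniform_quadratic_bound A
  have hext : ∀ (b' : ℝ) (c' v' : ℝ → E), 0 < b' → A.IsNullGeodesic σ c' v' (Icc 0 b') →
      A.Extends σ c' v' b' := fun b' c' v' hb' hg => by
    obtain ⟨-, -, h1, h2, -⟩ := hg b' (right_mem_Icc.2 hb'.le)
    exact extends_of_differentiable hσ hb' hg (hstart _ h1 h2) (hdiff _ h1 h2)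
  -- the normalized null direction `w y` at the points `y` of the hypersurface
  have hw : ∀ y, ∃ w, y ∈ Metric.closedBall A.ctr (A.r / 4) → A.height y = 0 →
      A.G y w w = 0 ∧ σ * A.G y A.e₀ w = -1 ∧ w ≠ 0 ∧
        ∀ z, A.height z = 0 → ‖z - y‖ ≤ ρ → A.G y w (z - y) ≤ C * ‖z - y‖ ^ 2 := by
    intro y
    by_cases hy : y ∈ Metric.closedBall A.ctr (A.r / 4) ∧ A.height y = 0
    · have hyb : y ∈ A.ball := Metric.closedBall_subset_ball (by linarith) hy.1
      obtain ⟨b, hb, c, v, hg, rfl⟩ := hstart y hyb hy.2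
      obtain ⟨k, hk, hgk, hn⟩ := hg.exists_normalized hb
      obtain ⟨-, -, -, -, h3, h4, -⟩ := hg 0 (left_mem_Icc.2 hb.le)
      refine ⟨k • v 0, fun _ _ => ⟨by simp [h4], hn, smul_ne_zero hk.ne' h3, ?_⟩⟩
      have := H σ _ _ (b / k) hσ (div_pos hb hk) hgk (by simpa using hy.1) (by simpa using hn)
        (fun b' c' v' hb' hg' _ => hext b' c' v' hb' hg')
      simpa using this
    · exact ⟨0, fun h1 h2 => absurd ⟨h1, h2⟩ hy⟩
  choose w hw using hw
  -- the vertical projection to the hypersurface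
  set foot : E → E := fun x => x + (-A.height x) • A.e₀ with hfoot
  have hfoot0 : ∀ x, A.height (foot x) = 0 := fun x => by
    simp only [hfoot]; rw [A.height_add]; ring
  have hev : ∀ᶠ x in 𝓝 A.ctr, |A.height x| < A.r / 8 := by
    have h1 := (A.continuousOn_height.continuousAt
      (Metric.isOpen_ball.mem_nhds (Metric.mem_ball_self hr))).abs
    rw [ContinuousAt, hctr, abs_zero] at h1
    exact h1.eventually_lt_const (by positivity)
  obtain ⟨ρ₀, hρ₀, hb₀⟩ := Metric.eventually_nhds_iff.1 hev
  set ρ₁ := min (A.r / 8) (ρ₀ / 2) with hρ₁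
  have pρ₁ : 0 < ρ₁ := by positivity
  have hN : Metric.closedBall A.ctr ρ₁ ⊆ A.ball :=
    Metric.closedBall_subset_ball (lt_of_le_of_lt (min_le_left _ _) (by linarith))
  have footmem : ∀ x ∈ Metric.closedBall A.ctr ρ₁, foot x ∈ Metric.closedBall A.ctr (A.r / 4) := by
    intro x hx
    have h1 : |A.height x| < A.r / 8 :=
      hb₀ (lt_of_le_of_lt hx (lt_of_le_of_lt (min_le_right _ _) (by linarith)))
    rw [mem_closedBall_iff_norm] at hx ⊢
    have h2 : ‖x - A.ctr‖ ≤ A.r / 8 := hx.trans (min_le_left _ _)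
    calc ‖foot x - A.ctr‖ = ‖(x - A.ctr) + (-A.height x) • A.e₀‖ := by
          simp only [hfoot]; congr 1; abel
      _ ≤ ‖x - A.ctr‖ + ‖(-A.height x) • A.e₀‖ := norm_add_le _ _
      _ ≤ A.r / 8 + A.r / 8 := by
          rw [norm_smul, A.norm_e₀, mul_one, norm_neg, Real.norm_eq_abs]; gcongr
      _ = A.r / 4 := by ring
  have football : ∀ x ∈ Metric.closedBall A.ctr ρ₁, foot x ∈ A.ball := fun x hx =>
    Metric.closedBall_subset_ball (by linarith) (footmem x hx)
  have cfoot : ContinuousOn foot (Metric.closedBall A.ctr ρ₁) :=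
    continuousOn_id.add ((A.continuousOn_height.mono hN).neg.smul continuousOn_const)
  have wbd : ∀ x ∈ Metric.closedBall A.ctr ρ₁,
      w (foot x) ∈ Metric.closedBall (0 : E) (1 / A.κ) := by
    intro x hx
    obtain ⟨h1, h2, -, -⟩ := hw _ (footmem x hx) (hfoot0 x)
    have h3 := A.cone _ (football x hx) _ h1.le
    have h4 : |A.G (foot x) A.e₀ (w (foot x))| = 1 := by
      rcases hσ with rfl | rfl
      · rw [show A.G (foot x) A.e₀ (w (foot x)) = -1 by linarith]; norm_num
      · rw [show A.G (foot x) A.e₀ (w (foot x)) = 1 by linarith]; norm_num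
    rw [mem_closedBall_zero_iff, le_div_iff₀ hκ]
    linarith
  -- the quadratic bound and the normalization determine the direction by differentiability
  have momentum : ∀ y ∈ A.ball, A.height y = 0 → ∀ w', σ * A.G y A.e₀ w' = -1 →
      (∀ z, A.height z = 0 → ‖z - y‖ ≤ ρ / 2 → A.G y w' (z - y) ≤ C * ‖z - y‖ ^ 2) →
      ∀ x, A.G y w' x = -σ * fderiv ℝ A.height y x := by
    intro y hy hy0 w' hn hq x
    rw [eq_smul_of_quadratic_bound (by positivity) hy0 (hdiff y hy hy0).hasFDerivAt hq x,
      A.symm y hy w']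
    have : A.G y A.e₀ w' = -σ := by linear_combination σ * hn - A.G y A.e₀ w' * hσ2
    rw [this]
  -- every cluster value of `w` satisfies the same closed conditions, on half the radius
  have cw : ContinuousOn (fun x => w (foot x)) (Metric.closedBall A.ctr ρ₁) := by
    intro x hx
    obtain ⟨-, n1, -, q1⟩ := hw _ (footmem x hx) (hfoot0 x)
    refine (isCompact_closedBall (0 : E) (1 / A.κ)).tendsto_nhds_of_unique_mapClusterPt
      (by filter_upwards [self_mem_nhdsWithin] with y hy using wbd y hy) fun w' _ hcl => ?_
    obtain ⟨U, hU, hlim⟩ := mapClusterPt_iff_ultrafilter.1 hcl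
    have hUN : ∀ᶠ y in (U : Filter E), y ∈ Metric.closedBall A.ctr ρ₁ := hU self_mem_nhdsWithin
    have lfoot : Tendsto foot U (𝓝 (foot x)) := (cfoot x hx).tendsto.mono_left hU
    have lG : Tendsto (fun y => A.G (foot y)) U (𝓝 (A.G (foot x))) :=
      (continuousOn_G.continuousAt (Metric.isOpen_ball.mem_nhds (football x hx))).tendsto.comp lfoot
    have n2 : σ * A.G (foot x) A.e₀ w' = -1 := by
      have h1 : Tendsto (fun y => σ * A.G (foot y) A.e₀ (w (foot y))) U
          (𝓝 (σ * A.G (foot x) A.e₀ w')) :=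
        (tendsto_apply (tendsto_apply lG tendsto_const_nhds) hlim).const_mul σ
      refine tendsto_nhds_unique (h1.congr' ?_) tendsto_const_nhds
      filter_upwards [hUN] with y hy using (hw _ (footmem y hy) (hfoot0 y)).2.1
    have q2 : ∀ z, A.height z = 0 → ‖z - foot x‖ ≤ ρ / 2 →
        A.G (foot x) w' (z - foot x) ≤ C * ‖z - foot x‖ ^ 2 := by
      intro z hz hzρ
      have l1 : Tendsto (fun y => z - foot y) U (𝓝 (z - foot x)) := tendsto_const_nhds.sub lfoot
      refine le_of_tendsto_of_tendsto (tendsto_apply (tendsto_apply lG hlim) l1)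
        ((l1.norm.pow 2).const_mul C) ?_
      filter_upwards [hUN, l1.norm.eventually_lt_const (show ‖z - foot x‖ < ρ by linarith)]
        with y hy hyρ
      exact (hw _ (footmem y hy) (hfoot0 y)).2.2.2 z hz (le_of_lt hyρ)
    rw [← sub_eq_zero]
    refine eq_zero_of_forall (football x hx) fun e => ?_
    rw [map_sub, sub_apply, momentum _ (football x hx) (hfoot0 x) w' n2 q2,
      momentum _ (football x hx) (hfoot0 x) _ n1 (fun z hz hzρ => q1 z hz (by linarith)), sub_self]
  obtain ⟨T, hT, c, c0, hc⟩ := exists_hasDerivWithinAt_of_continuousOn pρ₁ cw.neg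
  -- the integral curve stays in the hypersurface since `w` is tangent to it
  have dheight : ∀ t ∈ Icc 0 T, HasDerivWithinAt (fun t => A.height (c t)) 0 (Icc 0 T) t := by
    intro t ht
    obtain ⟨hm, hd⟩ := hc t ht
    obtain ⟨w1, w2, -, w4⟩ := hw _ (footmem _ hm) (hfoot0 _)
    have hD : HasFDerivAt A.height (fderiv ℝ A.height (foot (c t))) (c t) := by
      have h1 := (hdiff _ (football _ hm) (hfoot0 _)).hasFDerivAt
      set s := A.height (c t) with hs
      have h2 : HasFDerivAt (fun x : E => x + (-s) • A.e₀) (ContinuousLinearMap.id ℝ E) (c t) :=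
        (hasFDerivAt_id _).add_const _
      have h3 := (HasFDerivAt.comp (c t) (g := A.height) (f := fun x : E => x + (-s) • A.e₀)
        h1 h2).add_const s
      rw [ContinuousLinearMap.comp_id] at h3
      refine h3.congr_of_eventuallyEq (Eventually.of_forall fun x => ?_)
      simp only [Function.comp]
      rw [A.height_add]; ring
    refine (hD.comp_hasDerivWithinAt t hd).congr_deriv ?_
    have h5 := momentum _ (football _ hm) (hfoot0 _) _ w2
      (fun z hz hzρ => w4 z hz (by linarith)) (w (foot (c t)))
    rw [w1] at h5
    simp only [Pi.neg_apply, map_neg, neg_eq_zero]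
    rcases hσ with rfl | rfl <;> linarith
  have hz : ∀ t ∈ Icc 0 T, A.height (c t) = 0 := fun t ht => by
    rw [eq_of_hasDerivWithinAt_zero dheight t ht, c0, hctr]
  have hfc : ∀ t ∈ Icc 0 T, foot (c t) = c t := fun t ht => by simp [hfoot, hz t ht]
  have hσ' : -σ = 1 ∨ -σ = -1 := by rcases hσ with rfl | rfl <;> simp
  have cc : ContinuousOn c (Icc 0 T) := fun t ht => (hc t ht).2.continuousWithinAt
  obtain ⟨T', hT', c', v', hg, h0⟩ := exists_isNullGeodesic_of_causal (A := A) hσ' hT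
    (c := c) (v := fun t => -w (foot (c t)))
    ⟨fun t ht => (hc t ht).2, (cw.neg.comp cc fun t ht => (hc t ht).1)⟩ (by
      intro t ht
      have hm := (hc t ht).1
      obtain ⟨w1, w2, w3, -⟩ := hw _ (footmem _ hm) (hfoot0 _)
      rw [hfc t ht] at w1 w2 w3 ⊢
      refine ⟨hN hm, ⟨neg_ne_zero.2 w3, by simp [w1], ?_⟩, hz t ht⟩
      simp only [map_neg, mul_neg, neg_mul, neg_neg]
      linarith)
  exact ⟨T', hT', c', v', hg, by rw [h0, c0]⟩

end AchronalGraph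

end NullHorizon

namespace NullHorizon

/-! ### Regularity of functions with quadratic two-sided tangent bounds -/

/-- A function which has at each point an affine approximation with uniformly quadratic error is
of class `C^{1,1}`. -/
lemma isC11Near_of_abs_sub_le {F : Type*} [NormedAddCommGroup F] [NormedSpace ℝ F]
    {h : F → ℝ} {x₀ : F} {ℓ : F → F →L[ℝ] ℝ} {R C : ℝ} (hR : 0 < R) (hC : 0 ≤ C)
    (H : ∀ x ∈ Metric.ball x₀ R, ∀ z ∈ Metric.ball x₀ R,
      |h z - h x - ℓ x (z - x)| ≤ C * ‖z - x‖ ^ 2) : IsC11Near h x₀ := by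
  have hd : ∀ x ∈ Metric.ball x₀ R, HasFDerivAt h (ℓ x) x := by
    intro x hx
    refine HasFDerivAt.of_isLittleO ?_
    refine Asymptotics.IsBigO.trans_isLittleO (g := fun z => ‖z - x‖ ^ 2) ?_ ?_
    · refine Asymptotics.IsBigO.of_bound C ?_
      filter_upwards [Metric.isOpen_ball.mem_nhds hx] with z hz
      simpa using H x hx z hz
    · have h1 : Tendsto (fun z => z - x) (𝓝 x) (𝓝 0) := by
        have : Continuous fun z : F => z - x := by fun_prop
        simpa using this.tendsto x
      exact (Asymptotics.isLittleO_norm_pow_id (E' := F) one_lt_two).comp_tendsto h1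
  refine ⟨Metric.ball x₀ (R / 4), Metric.isOpen_ball, Metric.mem_ball_self (by positivity),
    fun y hy => (hd y (Metric.ball_subset_ball (by linarith) hy)).differentiableAt,
    (6 * C).toNNReal, LipschitzOnWith.of_dist_le_mul fun x hx y hy => ?_⟩
  have hx' := Metric.ball_subset_ball (show R / 4 ≤ R by linarith) hx
  have hy' := Metric.ball_subset_ball (show R / 4 ≤ R by linarith) hy
  rw [(hd x hx').fderiv, (hd y hy').fderiv, Real.coe_toNNReal _ (by positivity), dist_comm,
    dist_eq_norm, dist_comm, dist_eq_norm]
  set d := ‖y - x‖ with hdd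
  rcases (norm_nonneg (y - x)).eq_or_lt with h0 | h0
  · rw [eq_comm, norm_eq_zero, sub_eq_zero] at h0
    simp [hdd, h0]
  refine ContinuousLinearMap.opNorm_le_bound _ (by positivity) fun u => ?_
  rcases (norm_nonneg u).eq_or_lt with hu | hu
  · rw [eq_comm, norm_eq_zero] at hu
    simp [hu]
  rw [← hdd] at h0
  -- compare the affine approximations at `x` and `y` in the points `y` and `y + u'`
  have key : ∀ u' : F, ‖u'‖ = d → |(ℓ y - ℓ x) u'| ≤ 6 * C * d * d := by
    intro u' hu'
    have hz : y + u' ∈ Metric.ball x₀ R := by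
      rw [mem_ball_iff_norm] at hx hy ⊢
      have h1 : d ≤ ‖y - x₀‖ + ‖x - x₀‖ := by
        rw [hdd, show y - x = (y - x₀) - (x - x₀) by abel]; exact norm_sub_le _ _
      have h2 : ‖y + u' - x₀‖ ≤ ‖y - x₀‖ + ‖u'‖ := by
        rw [show y + u' - x₀ = (y - x₀) + u' by abel]; exact norm_add_le _ _
      linarith
    have a1 := H x hx' _ hz
    have a2 := H y hy' _ hz
    have a3 := H x hx' y hy'
    have n1 : ‖y + u' - x‖ ≤ 2 * d := by
      rw [show y + u' - x = (y - x) + u' by abel]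
      exact (norm_add_le _ _).trans (by rw [hu', ← hdd]; linarith)
    have a1' : |h (y + u') - h x - ℓ x (y + u' - x)| ≤ C * (2 * d) ^ 2 :=
      a1.trans (by gcongr)
    rw [add_sub_cancel_left, hu'] at a2
    rw [← hdd] at a3
    have e1 : ℓ x (y + u' - x) = ℓ x (y - x) + ℓ x u' := by rw [← map_add]; congr 1; abel
    rw [e1] at a1'
    rw [sub_apply]
    rw [abs_le] at *
    constructor <;> nlinarith
  have k1 := key ((d / ‖u‖) • u) (by
    rw [norm_smul, Real.norm_eq_abs, abs_of_pos (by positivity)]; field_simp)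
  rw [map_smul, smul_eq_mul, abs_mul, abs_of_pos (by positivity : 0 < d / ‖u‖),
    div_mul_eq_mul_div, div_le_iff₀ hu] at k1
  rw [Real.norm_eq_abs]
  have : d * |(ℓ y - ℓ x) u| ≤ d * (6 * C * d * ‖u‖) := by linarith
  exact le_of_mul_le_mul_left this h0

/-! ### The spatial and the time coordinates -/

/-- The inclusion `ℝⁿ → ℝ × ℝⁿ` of the hyperplane `{x⁰ = 0}`. -/
noncomputable def emb (n : ℕ) : Space n →L[ℝ] Coord n :=
  LinearMap.toContinuousLinearMap
    { toFun := fun x => WithLp.toLp 2 (Fin.cons 0 (fun i => x i))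
      map_add' := fun x y => by
        ext i; refine Fin.cases ?_ (fun i => ?_) i <;> simp
      map_smul' := fun a x => by
        ext i; refine Fin.cases ?_ (fun i => ?_) i <;> simp }

@[simp] lemma emb_zero {n : ℕ} (x : Space n) : emb n x 0 = 0 := by simp [emb]

@[simp] lemma emb_succ {n : ℕ} (x : Space n) (i : Fin n) : emb n x i.succ = x i := by simp [emb]

/-- The spatial projection as a continuous linear map. -/
noncomputable def spatialL (n : ℕ) : Coord n →L[ℝ] Space n :=
  LinearMap.toContinuousLinearMap
    { toFun := spatial
      map_add' := fun x y => by ext i; simp [spatial]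
      map_smul' := fun a x => by ext i; simp [spatial] }

@[simp] lemma spatial_apply {n : ℕ} (y : Coord n) (i : Fin n) : spatial y i = y i.succ := rfl

@[simp] lemma e₀_zero (n : ℕ) : e₀ n 0 = 1 := by simp [e₀]

@[simp] lemma e₀_succ {n : ℕ} (i : Fin n) : e₀ n i.succ = 0 := by simp [e₀]

@[simp] lemma norm_e₀ (n : ℕ) : ‖e₀ n‖ = 1 := by simp [e₀]

lemma e₀_ne_zero (n : ℕ) : e₀ n ≠ 0 := by
  intro h
  have := norm_e₀ n
  rw [h] at this
  simp at this

@[simp] lemma spatial_emb {n : ℕ} (x : Space n) : spatial (emb n x) = x := by ext i; simp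

lemma spatial_add {n : ℕ} (x y : Coord n) : spatial (x + y) = spatial x + spatial y := by
  ext i; simp

lemma spatial_sub {n : ℕ} (x y : Coord n) : spatial (x - y) = spatial x - spatial y := by
  ext i; simp

lemma spatial_smul {n : ℕ} (a : ℝ) (y : Coord n) : spatial (a • y) = a • spatial y := by
  ext i; simp

@[simp] lemma spatial_e₀ (n : ℕ) : spatial (e₀ n) = 0 := by ext i; simp

lemma eq_smul_e₀_add_emb {n : ℕ} (y : Coord n) : y = y 0 • e₀ n + emb n (spatial y) := by
  ext i; refine Fin.cases ?_ (fun i => ?_) i <;> simp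

lemma continuous_spatial {n : ℕ} : Continuous (spatial : Coord n → Space n) :=
  (spatialL n).continuous

lemma continuous_zero_coord {n : ℕ} : Continuous (fun y : Coord n => y 0) := by fun_prop

lemma norm_sq_eq {n : ℕ} (y : Coord n) : ‖y‖ ^ 2 = (y 0) ^ 2 + ‖spatial y‖ ^ 2 := by
  rw [EuclideanSpace.norm_sq_eq, EuclideanSpace.norm_sq_eq, Fin.sum_univ_succ]
  simp

lemma norm_spatial_le {n : ℕ} (y : Coord n) : ‖spatial y‖ ≤ ‖y‖ := by
  refine le_of_sq_le_sq ?_ (norm_nonneg _)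
  rw [norm_sq_eq y]
  nlinarith [sq_nonneg (y 0)]

@[simp] lemma norm_emb {n : ℕ} (x : Space n) : ‖emb n x‖ = ‖x‖ := by
  have := norm_sq_eq (emb n x)
  simp only [emb_zero, spatial_emb] at this
  nlinarith [norm_nonneg (emb n x), norm_nonneg x]


lemma spatial_add_smul_e₀ {n : ℕ} (y : Coord n) (s : ℝ) : spatial (y + s • e₀ n) = spatial y := by
  rw [spatial_add, spatial_smul, spatial_e₀, smul_zero, add_zero]

lemma differentiableAt_height_iff {n : ℕ} {h : Space n → ℝ} (y : Coord n) :
    DifferentiableAt ℝ (fun y : Coord n => y 0 - h (spatial y)) y ↔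
      DifferentiableAt ℝ h (spatial y) := by
  constructor
  · intro H
    have h1 : DifferentiableAt ℝ (fun x => emb n x + (y 0) • e₀ n) (spatial y) :=
      (emb n).differentiableAt.add_const _
    have h2 : emb n (spatial y) + y 0 • e₀ n = y := by
      rw [add_comm]; exact (eq_smul_e₀_add_emb y).symm
    have h3 := (DifferentiableAt.comp (spatial y) (g := fun y : Coord n => y 0 - h (spatial y))
      (f := fun x => emb n x + (y 0) • e₀ n) (by rw [h2]; exact H) h1).const_sub (y 0)
    refine h3.congr_of_eventuallyEq (Eventually.of_forall fun x => ?_)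
    simp [spatial_add_smul_e₀]
  · intro H
    refine DifferentiableAt.sub (by fun_prop) ?_
    exact DifferentiableAt.comp y (f := spatial) H (spatialL n).differentiableAt

/-- If null geodesics depart from all points of the hypersurface and can be extended in both time
directions, the two one-sided quadratic bounds add up to a two-sided one, and the hypersurface is
the graph of a function of class `C^{1,1}`. -/
lemma isC11Near_of_extends {n : ℕ} {A : AchronalGraph (Coord n)} {h : Space n → ℝ}
    (hA : ∀ y, A.height y = y 0 - h (spatial y)) (he : A.e₀ = e₀ n) (hctr : A.height A.ctr = 0)
    (hstart : ∀ y ∈ A.ball, A.height y = 0 → A.Starts (-1) y)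
    (hext : ∀ σ, (σ = 1 ∨ σ = -1) → ∀ (b' : ℝ) (c' v' : ℝ → Coord n), 0 < b' →
      A.IsNullGeodesic σ c' v' (Icc 0 b') → A.Extends σ c' v' b') :
    IsC11Near h (spatial A.ctr) := by
  have hr := A.r_pos
  have hκ := A.κ_pos
  have hK := A.K_pos
  obtain ⟨C, hC, ρ, hρ, H⟩ := AchronalGraph.exists_uniform_quadratic_bound A
  -- the tangent functional at `y` is the momentum of the null geodesic through `y`; it satisfies a
  -- quadratic bound on both sides since the geodesic runs on both sides of `y`
  have main : ∀ y ∈ Metric.closedBall A.ctr (A.r / 4), A.height y = 0 →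
      ∃ ℓ : Coord n →L[ℝ] ℝ, ℓ (e₀ n) = -1 ∧ ‖ℓ‖ ≤ A.K / A.κ ∧
        ∀ z, A.height z = 0 → ‖z - y‖ ≤ ρ → |ℓ (z - y)| ≤ C * ‖z - y‖ ^ 2 := by
    intro y hy hy0
    have hyb : y ∈ A.ball := Metric.closedBall_subset_ball (by linarith) hy
    obtain ⟨b, hb, c, v, hg, rfl⟩ := hstart y hyb hy0
    obtain ⟨k, hk, hgk, hn⟩ := hg.exists_normalized hb
    set b₁ := b / k with hb₁
    have pb₁ : 0 < b₁ := by positivity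
    set c₁ : ℝ → Coord n := fun t => c (k * t + 0) with hc₁
    set v₁ : ℝ → Coord n := fun t => k • v (k * t + 0) with hv₁
    have e1 : c₁ 0 = c 0 := by simp [hc₁]
    have e2 : v₁ 0 = k • v 0 := by simp [hv₁]
    have hrev := hgk.reverse
    rw [neg_neg] at hrev
    obtain ⟨δ, hδ, c₂, v₂, hg₂, h1, h2⟩ := hext 1 (Or.inl rfl) b₁ _ _ pb₁ hrev
    simp only [neg_mul, one_mul, neg_add_cancel, neg_smul, one_smul] at h1 h2
    have q1 := H (-1) _ _ b₁ (Or.inr rfl) pb₁ hgk (by rwa [e1]) (by rw [e1, e2]; exact hn)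
      (fun b' c' v' hb' hg' _ => hext _ (Or.inr rfl) b' c' v' hb' hg')
    have hn2 : (1 : ℝ) * A.G (c₂ 0) A.e₀ (v₂ 0) = -1 := by
      rw [h1, h2, e1, e2, map_neg]; linarith
    have q2 := H 1 _ _ δ (Or.inl rfl) hδ hg₂ (by rw [h1, e1]; exact hy) hn2
      (fun b' c' v' hb' hg' _ => hext _ (Or.inl rfl) b' c' v' hb' hg')
    obtain ⟨-, -, -, -, -, hnull, -⟩ := hg₂ 0 (left_mem_Icc.2 hδ.le)
    rw [h1, e1] at hnull q2 hn2
    rw [e1] at q1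
    rw [h2] at hnull q2 hn2
    refine ⟨A.G (c 0) (-v₁ 0), ?_, ?_, ?_⟩
    · rw [← he, ← A.symm _ hyb]; linarith
    · have h3 := A.cone _ hyb _ hnull.le
      rw [show A.G (c 0) A.e₀ (-v₁ 0) = -1 by linarith] at h3
      calc ‖A.G (c 0) (-v₁ 0)‖ ≤ ‖A.G (c 0)‖ * ‖-v₁ 0‖ := (A.G (c 0)).le_opNorm _
        _ ≤ A.K * (1 / A.κ) := by
          gcongr
          · exact A.bound _ hyb
          · rw [le_div_iff₀ hκ]; norm_num at h3; rw [norm_neg]; linarith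
        _ = A.K / A.κ := by ring
    · intro z hz hzρ
      have a1 := q1 z hz hzρ
      have a2 := q2 z hz hzρ
      rw [map_neg, neg_apply] at a2 ⊢
      rw [abs_le]; constructor <;> linarith
  choose! ℓ hℓ1 hℓ2 hℓ3 using main
  -- the parametrization of the hypersurface by its spatial coordinates
  set Y : Space n → Coord n := fun x => h x • e₀ n + emb n x with hY
  have Yspat : ∀ x, spatial (Y x) = x := fun x => by simp [hY, spatial_add, spatial_smul]
  have Yzero : ∀ x, Y x 0 = h x := fun x => by simp [hY]
  have Yh : ∀ x, A.height (Y x) = 0 := fun x => by rw [hA, Yzero, Yspat, sub_self]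
  have Yctr : Y (spatial A.ctr) = A.ctr := by
    rw [hA, sub_eq_zero] at hctr
    rw [eq_smul_e₀_add_emb A.ctr, hctr]
    simp [hY, spatial_add, spatial_smul]
  set L := A.K / A.κ with hL
  have pL : 0 < L := by positivity
  have hcont : ContinuousAt h (spatial A.ctr) := by
    have h1 : ContinuousAt A.height A.ctr := A.continuousOn_height.continuousAt
      (Metric.isOpen_ball.mem_nhds (Metric.mem_ball_self hr))
    have h2 : Continuous (fun x : Space n => A.ctr 0 • e₀ n + emb n x) := by fun_prop
    have h3 : ContinuousAt (fun x => A.height (A.ctr 0 • e₀ n + emb n x)) (spatial A.ctr) := by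
      refine ContinuousAt.comp (f := fun x : Space n => A.ctr 0 • e₀ n + emb n x) ?_
        h2.continuousAt
      rwa [← eq_smul_e₀_add_emb]
    have h4 := (continuousAt_const (y := A.ctr 0)).sub h3
    refine h4.congr (Eventually.of_forall fun x => ?_)
    simp [hA, spatial_add, spatial_smul]
  have Ycont : ContinuousAt Y (spatial A.ctr) :=
    (hcont.smul continuousAt_const).add (emb n).continuous.continuousAt
  set ε := min (A.r / 4) (min (ρ / 2) (1 / (4 * C))) with hε
  have pε : 0 < ε := by positivity
  obtain ⟨R, hR, HR⟩ := Metric.continuousAt_iff.1 Ycont ε pε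
  rw [Yctr] at HR
  refine isC11Near_of_abs_sub_le (ℓ := fun x => (ℓ (Y x)).comp (emb n)) hR
    (C := C * (1 + (2 * L + 1) ^ 2)) (by positivity) fun x hx z hz => ?_
  have hYx := HR hx
  have hYz := HR hz
  have m1 : Y x ∈ Metric.closedBall A.ctr (A.r / 4) := (hYx.le).trans (min_le_left _ _)
  have dd : ‖Y z - Y x‖ < 2 * ε := by
    rw [← dist_eq_norm]
    calc dist (Y z) (Y x) ≤ dist (Y z) A.ctr + dist (Y x) A.ctr := dist_triangle_right _ _ _
      _ < 2 * ε := by linarith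
  have hε2 : ε ≤ ρ / 2 := (min_le_right _ _).trans (min_le_left _ _)
  have hε3 : ε ≤ 1 / (4 * C) := (min_le_right _ _).trans (min_le_right _ _)
  have b1 := hℓ3 _ m1 (Yh x) (Y z) (Yh z) (by linarith)
  have b2 := hℓ1 _ m1 (Yh x)
  have b3 := hℓ2 _ m1 (Yh x)
  have ed : Y z - Y x = (h z - h x) • e₀ n + emb n (z - x) := by
    simp only [hY, map_sub, sub_smul]; abel
  have es : ‖Y z - Y x‖ ^ 2 = (h z - h x) ^ 2 + ‖z - x‖ ^ 2 := by
    rw [norm_sq_eq, spatial_sub, Yspat, Yspat, PiLp.sub_apply, Yzero, Yzero]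
  have ev : ℓ (Y x) (Y z - Y x) = -((h z - h x) - ℓ (Y x) (emb n (z - x))) := by
    rw [ed, map_add, map_smul, b2, smul_eq_mul]; ring
  rw [ev, abs_neg, es] at b1
  have b4 : |ℓ (Y x) (emb n (z - x))| ≤ L * ‖z - x‖ := by
    have := (ℓ (Y x)).le_opNorm (emb n (z - x))
    rw [norm_emb, Real.norm_eq_abs] at this
    exact this.trans (by gcongr)
  -- a crude Lipschitz bound turns the error into one quadratic in the spatial distance
  have b5 : |h z - h x| ≤ (2 * L + 1) * ‖z - x‖ := by
    have c1 : |h z - h x| ≤ ‖Y z - Y x‖ :=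
      abs_le_of_sq_le_sq (by rw [es]; nlinarith [sq_nonneg ‖z - x‖]) (norm_nonneg _)
    have c2 : ‖z - x‖ ≤ ‖Y z - Y x‖ := by
      have := norm_spatial_le (Y z - Y x)
      rwa [spatial_sub, Yspat, Yspat] at this
    have c3 : C * (2 * ε) ≤ 1 / 2 := by
      rw [le_div_iff₀ (by positivity)] at hε3; linarith
    have c4 : C * |h z - h x| ^ 2 ≤ 1 / 2 * |h z - h x| := by
      have : C * |h z - h x| ≤ 1 / 2 := (mul_le_mul_of_nonneg_left (c1.trans dd.le) hC.le).trans c3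
      nlinarith [abs_nonneg (h z - h x)]
    have c5 : C * ‖z - x‖ ^ 2 ≤ 1 / 2 * ‖z - x‖ := by
      have : C * ‖z - x‖ ≤ 1 / 2 := (mul_le_mul_of_nonneg_left (c2.trans dd.le) hC.le).trans c3
      nlinarith [norm_nonneg (z - x)]
    have c6 : |h z - h x| ≤ |(h z - h x) - ℓ (Y x) (emb n (z - x))| +
        |ℓ (Y x) (emb n (z - x))| := by
      have := abs_add_le ((h z - h x) - ℓ (Y x) (emb n (z - x))) (ℓ (Y x) (emb n (z - x)))
      rwa [sub_add_cancel] at this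
    rw [← sq_abs (h z - h x)] at b1
    linarith
  have b6 : (h z - h x) ^ 2 ≤ ((2 * L + 1) * ‖z - x‖) ^ 2 := by
    rw [← sq_abs]; gcongr
  calc |h z - h x - ((ℓ (Y x)).comp (emb n)) (z - x)|
      ≤ C * ((h z - h x) ^ 2 + ‖z - x‖ ^ 2) := b1
    _ ≤ C * (((2 * L + 1) * ‖z - x‖) ^ 2 + ‖z - x‖ ^ 2) := by gcongr
    _ = C * (1 + (2 * L + 1) ^ 2) * ‖z - x‖ ^ 2 := by ring

end NullHorizon

namespace NullHorizon

/-! ### Lorentzian scalar products -/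

section Lorentz

variable {V : Type*} [TopologicalSpace V] [AddCommGroup V] [Module ℝ V] [IsTopologicalAddGroup V]
  [ContinuousSMul ℝ V]

/-- `g` is a symmetric bilinear form of signature `(-, +, …, +)`. -/
def IsLorentz (g : V →L[ℝ] V →L[ℝ] ℝ) : Prop :=
  (∀ v w, g v w = g w v) ∧ ∃ u, g u u < 0 ∧ ∀ w, w ≠ 0 → g u w = 0 → 0 < g w w

variable {g : V →L[ℝ] V →L[ℝ] ℝ}

/-- The Cauchy–Schwarz inequality on the orthogonal complement of a vector on which the form is
positive definite. -/
lemma sq_le_mul_of_orthogonal (hs : ∀ v w, g v w = g w v) {u : V}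
    (hu : ∀ w, w ≠ 0 → g u w = 0 → 0 < g w w) {t s : V} (ht : g u t = 0) (hs' : g u s = 0) :
    (g t s) ^ 2 ≤ g t t * g s s := by
  by_cases h0 : s = 0
  · simp [h0]
  have h1 := hu s h0 hs'
  have h2 : 0 ≤ g (g s s • t - g t s • s) (g s s • t - g t s • s) := by
    by_cases h3 : g s s • t - g t s • s = 0
    · simp [h3]
    · exact (hu _ h3 (by simp [ht, hs'])).le
  simp only [map_sub, map_smul, sub_apply, smul_apply, smul_eq_mul, hs s t] at h2
  have h3 : 0 ≤ g s s * (g t t * g s s - (g t s) ^ 2) := by nlinarith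
  have := nonneg_of_mul_nonneg_right h3 h1
  linarith

/-- A Lorentzian form is positive definite on the orthogonal complement of every timelike
vector. -/
lemma IsLorentz.pos_of_orthogonal (hg : IsLorentz g) {T : V} (hT : g T T < 0) {w : V}
    (hw : w ≠ 0) (h : g T w = 0) : 0 < g w w := by
  obtain ⟨hs, u, hu, hpos⟩ := hg
  have hu0 := hu.ne
  set α := g u T / g u u with hα
  set β := g u w / g u u with hβ
  set t := T - α • u with ht
  set s := w - β • u with hs'
  have ht0 : g u t = 0 := by simp only [ht, map_sub, map_smul, smul_eq_mul, hα]; field_simp; ring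
  have hs0 : g u s = 0 := by simp only [hs', map_sub, map_smul, smul_eq_mul, hβ]; field_simp; ring
  have eT : T = α • u + t := by simp [ht]
  have ew : w = β • u + s := by simp [hs']
  have cs := sq_le_mul_of_orthogonal hs hpos ht0 hs0
  have ht0' : g t u = 0 := by rw [hs, ht0]
  have hs0' : g s u = 0 := by rw [hs, hs0]
  clear_value α β t s
  subst eT ew
  simp only [map_add, map_smul, add_apply, smul_apply, smul_eq_mul, ht0, hs0, ht0', hs0'] at hT h ⊢
  have htt : 0 ≤ g t t := by
    by_cases h3 : t = 0
    · simp [h3]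
    · exact (hpos _ h3 ht0).le
  have hα0 : α ≠ 0 := by rintro rfl; simp at hT; linarith
  have hα2 : 0 < α ^ 2 := by positivity
  by_cases h4 : s = 0
  · subst h4
    simp only [map_zero, mul_zero, add_zero] at h
    have : β = 0 := by
      simpa [hα0, hu0] using h
    subst this
    simp at hw
  have hss := hpos _ h4 hs0
  have e1 : g t s = -(α * (β * g u u)) := by linarith
  rw [e1] at cs
  have e2 : g t t < α ^ 2 * (-g u u) := by nlinarith
  have e3 : α ^ 2 * (-g u u) * (β ^ 2 * (-g u u)) < α ^ 2 * (-g u u) * g s s := by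
    have : g t t * g s s < α ^ 2 * (-g u u) * g s s := mul_lt_mul_of_pos_right e2 hss
    nlinarith
  have e4 := lt_of_mul_lt_mul_left e3 (mul_nonneg hα2.le (by linarith))
  nlinarith

/-- Two timelike vectors in the same time cone induce the same time orientation of the causal
vectors. -/
lemma IsLorentz.neg_of_neg (hg : IsLorentz g) {T U v : V} (hT : g T T < 0) (hU : g U U < 0)
    (hTU : g T U < 0) (hv : g v v ≤ 0) (hvT : g v T < 0) : g v U < 0 := by
  have hpos : ∀ w, w ≠ 0 → g T w = 0 → 0 < g w w := fun w hw h => hg.pos_of_orthogonal hT hw h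
  have hs := hg.1
  have hT0 := hT.ne
  set α := g T v / g T T with hα
  set β := g T U / g T T with hβ
  set t := v - α • T with ht
  set s := U - β • T with hs'
  have pα : 0 < α := div_pos_of_neg_of_neg (by rw [hs]; exact hvT) hT
  have pβ : 0 < β := div_pos_of_neg_of_neg hTU hT
  have ht0 : g T t = 0 := by simp only [ht, map_sub, map_smul, smul_eq_mul, hα]; field_simp; ring
  have hs0 : g T s = 0 := by simp only [hs', map_sub, map_smul, smul_eq_mul, hβ]; field_simp; ring
  have cs := sq_le_mul_of_orthogonal hs hpos ht0 hs0
  have ev : v = α • T + t := by simp [ht]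
  have eU : U = β • T + s := by simp [hs']
  have ht0' : g t T = 0 := by rw [hs, ht0]
  have hs0' : g s T = 0 := by rw [hs, hs0]
  clear_value α β t s
  subst ev eU
  simp only [map_add, map_smul, add_apply, smul_apply, smul_eq_mul, ht0, hs0, ht0', hs0']
    at hU hv ⊢
  have nn : ∀ x, g T x = 0 → 0 ≤ g x x := fun x hx => by
    by_cases h3 : x = 0
    · simp [h3]
    · exact (hpos _ h3 hx).le
  have htt := nn t ht0
  have hss := nn s hs0
  set a := -g T T with ha
  have pa : 0 < a := by simp [ha, hT]
  have e1 : g t t ≤ α ^ 2 * a := by nlinarith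
  have e2 : g s s < β ^ 2 * a := by nlinarith
  have e3 : g t t * g s s < (α * β * a) ^ 2 := by
    calc g t t * g s s ≤ α ^ 2 * a * g s s := by gcongr
      _ < α ^ 2 * a * (β ^ 2 * a) := by gcongr
      _ = (α * β * a) ^ 2 := by ring
  have e4 := abs_lt_of_sq_lt_sq (cs.trans_lt e3) (by positivity)
  have := (abs_lt.1 e4).2
  nlinarith

lemma IsLorentz.neg_iff_neg (hg : IsLorentz g) {T U v : V} (hT : g T T < 0) (hU : g U U < 0)
    (hTU : g T U < 0) (hv : g v v ≤ 0) : g v T < 0 ↔ g v U < 0 :=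
  ⟨hg.neg_of_neg hT hU hTU hv, hg.neg_of_neg hU hT (by rwa [hg.1]) hv⟩

end Lorentz

/-! ### The metric in a chart -/

variable {n : ℕ} {M : Type*} [TopologicalSpace M] [ChartedSpace (Coord n) M]
  [IsManifold 𝓘(ℝ, Coord n) 4 M]

/-- The derivative of the inverse of a chart; the tangent spaces of `M` are copies of the coordinate
space. -/
noncomputable def chartD (e : OpenPartialHomeomorph M (Coord n)) (y : Coord n) :
    Coord n →L[ℝ] Coord n :=
  mfderiv 𝓘(ℝ, Coord n) 𝓘(ℝ, Coord n) e.symm y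

/-- The metric in the chart `e`, as a field of bilinear forms. -/
noncomputable def chartG (S : Spacetime n M) (e : OpenPartialHomeomorph M (Coord n))
    (y : Coord n) : Coord n →L[ℝ] Coord n →L[ℝ] ℝ :=
  ContinuousLinearMap.bilinearComp (E := Coord n) (F := Coord n) (G := ℝ)
    (S.g (e.symm y)) (chartD e y) (chartD e y)

lemma chartG_apply (S : Spacetime n M) (e : OpenPartialHomeomorph M (Coord n))
    (y u w : Coord n) : chartG S e y u w = S.g (e.symm y) (chartD e y u) (chartD e y w) := rfl

lemma chartMetric_eq (S : Spacetime n M) (e : OpenPartialHomeomorph M (Coord n))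
    (y u w : Coord n) : S.chartMetric e y u w = chartG S e y u w := rfl

lemma mdifferentiable_chart_of_mem {e : OpenPartialHomeomorph M (Coord n)}
    (he : e ∈ IsManifold.maximalAtlas 𝓘(ℝ, Coord n) 4 M) :
    e.MDifferentiable 𝓘(ℝ, Coord n) 𝓘(ℝ, Coord n) :=
  ⟨(contMDiffOn_of_mem_maximalAtlas he).mdifferentiableOn (by norm_num),
    (contMDiffOn_symm_of_mem_maximalAtlas he).mdifferentiableOn (by norm_num)⟩

lemma bijective_chartD {e : OpenPartialHomeomorph M (Coord n)}
    (he : e ∈ IsManifold.maximalAtlas 𝓘(ℝ, Coord n) 4 M) {y : Coord n} (hy : y ∈ e.target) :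
    Function.Bijective (chartD e y) :=
  (mdifferentiable_chart_of_mem he).symm.mfderiv_bijective hy

lemma isLorentz_g (S : Spacetime n M) (x : M) : IsLorentz (S.g x) := ⟨S.symm x, S.signature x⟩

lemma isLorentz_chartG (S : Spacetime n M) {e : OpenPartialHomeomorph M (Coord n)}
    (he : e ∈ IsManifold.maximalAtlas 𝓘(ℝ, Coord n) 4 M) {y : Coord n} (hy : y ∈ e.target) :
    IsLorentz (chartG S e y) := by
  have hb := bijective_chartD he hy
  obtain ⟨u, hu, hpos⟩ := S.signature (e.symm y)
  obtain ⟨u, rfl⟩ := hb.2 u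
  refine ⟨fun v w => S.symm _ _ _, u, hu, fun w hw h => hpos _ ?_ h⟩
  intro h0
  exact hw (hb.1 (h0.trans (map_zero _).symm))

lemma contMDiffOn_chartD {e : OpenPartialHomeomorph M (Coord n)}
    (he : e ∈ IsManifold.maximalAtlas 𝓘(ℝ, Coord n) 4 M) (u : Coord n) :
    ContMDiffOn 𝓘(ℝ, Coord n) 𝓘(ℝ, Coord n).tangent 3
      (fun y => (TotalSpace.mk' (Coord n) (e.symm y) (chartD e y u) :
        TangentBundle 𝓘(ℝ, Coord n) M)) e.target := by
  have h1 := (contMDiffOn_symm_of_mem_maximalAtlas he).contMDiffOn_tangentMapWithin (m := 3)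
    (by norm_cast) e.open_target.uniqueMDiffOn
  have h2 : ContMDiffOn 𝓘(ℝ, Coord n) 𝓘(ℝ, Coord n).tangent 3
      (fun y => (⟨y, u⟩ : TangentBundle 𝓘(ℝ, Coord n) (Coord n))) e.target :=
    contMDiffOn_vectorSpace_iff_contDiffOn.2 contDiffOn_const
  refine (h1.comp h2 (fun y hy => hy)).congr fun y hy => ?_
  simp only [Function.comp, tangentMapWithin]
  rw [mfderivWithin_of_isOpen e.open_target hy]
  rfl

/-- The metric in a chart, evaluated on `C³` vector fields along the chart. -/
lemma contDiffOn_g_apply (S : Spacetime n M) {e : OpenPartialHomeomorph M (Coord n)}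
    (he : e ∈ IsManifold.maximalAtlas 𝓘(ℝ, Coord n) 4 M)
    {X Y : ∀ y : Coord n, TangentSpace 𝓘(ℝ, Coord n) (e.symm y)}
    (hX : ContMDiffOn 𝓘(ℝ, Coord n) 𝓘(ℝ, Coord n).tangent 3
      (fun y => (TotalSpace.mk' (Coord n) (e.symm y) (X y) : TangentBundle 𝓘(ℝ, Coord n) M))
      e.target)
    (hY : ContMDiffOn 𝓘(ℝ, Coord n) 𝓘(ℝ, Coord n).tangent 3
      (fun y => (TotalSpace.mk' (Coord n) (e.symm y) (Y y) : TangentBundle 𝓘(ℝ, Coord n) M))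
      e.target) :
    ContDiffOn ℝ 3 (fun y => S.g (e.symm y) (X y) (Y y)) e.target := by
  have hg := S.contMDiff_g.comp_contMDiffOn
    ((contMDiffOn_symm_of_mem_maximalAtlas he).of_le (m := 3) (by norm_cast))
  rw [← contMDiffOn_iff_contDiffOn]
  intro y hy
  have := (hg.clm_bundle_apply₂ (E₃ := Bundle.Trivial M ℝ) (F₃ := ℝ) hX hY) y hy
  exact ((Bundle.contMDiffWithinAt_totalSpace).1 this).2

lemma contDiffOn_chartG (S : Spacetime n M) {e : OpenPartialHomeomorph M (Coord n)}
    (he : e ∈ IsManifold.maximalAtlas 𝓘(ℝ, Coord n) 4 M) :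
    ContDiffOn ℝ 3 (chartG S e) e.target := by
  rw [contDiffOn_clm_apply]
  intro u
  rw [contDiffOn_clm_apply]
  intro w
  exact contDiffOn_g_apply S he (contMDiffOn_chartD he u) (contMDiffOn_chartD he w)

lemma continuousOn_g_chartD_V (S : Spacetime n M) {e : OpenPartialHomeomorph M (Coord n)}
    (he : e ∈ IsManifold.maximalAtlas 𝓘(ℝ, Coord n) 4 M) (u : Coord n) :
    ContinuousOn (fun y => S.g (e.symm y) (chartD e y u) (S.V (e.symm y))) e.target :=
  (contDiffOn_g_apply S he (contMDiffOn_chartD he u) (S.contMDiff_V.comp_contMDiffOn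
    ((contMDiffOn_symm_of_mem_maximalAtlas he).of_le (by norm_cast)))).continuousOn

end NullHorizon

namespace NullHorizon

/-! ### The geodesic equation in charts -/

/-- The geodesic equation with lowered index, for the position `y`, the velocity `u` and the
acceleration `a`. -/
def GeodesicEq {E : Type*} [NormedAddCommGroup E] [NormedSpace ℝ E] (G : E → E →L[ℝ] E →L[ℝ] ℝ)
    (y u a : E) : Prop :=
  ∀ w, G y a w + fderiv ℝ G y u u w - (1 / 2) * fderiv ℝ G y w u u = 0

lemma contDiffWithinAt_succ_of_hasDerivWithinAt {E : Type*} [NormedAddCommGroup E]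
    [NormedSpace ℝ E] {f f' : ℝ → E} {s : Set ℝ} {t : ℝ} {k : ℕ} (ht : t ∈ s)
    (h : ∀ᶠ τ in 𝓝[s] t, HasDerivWithinAt f (f' τ) s τ) (hf' : ContDiffWithinAt ℝ k f' s t) :
    ContDiffWithinAt ℝ (k + 1) f s t := by
  rw [contDiffWithinAt_succ_iff_hasFDerivWithinAt' (by simp)]
  refine ⟨s ∩ {τ | HasDerivWithinAt f (f' τ) s τ}, ?_, ?_, by simp,
    fun τ => ContinuousLinearMap.toSpanSingleton ℝ (f' τ), ?_, ?_⟩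
  · rw [insert_eq_of_mem ht]
    exact inter_mem self_mem_nhdsWithin h
  · rw [insert_eq_of_mem ht]; exact inter_subset_left
  · rintro τ ⟨-, hτ⟩
    exact hτ.hasFDerivWithinAt
  · exact (ContinuousLinearMap.toSpanSingletonCLE (𝕜 := ℝ) (E := E)).contDiff.comp_contDiffWithinAt
      hf'

/-- The geodesic equation is invariant under changes of coordinates. -/
lemma GeodesicEq.of_pullback {E : Type*} [NormedAddCommGroup E] [NormedSpace ℝ E]
    {G G' : E → E →L[ℝ] E →L[ℝ] ℝ} {φ : E → E} {y u a : E}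
    (hG' : DifferentiableAt ℝ G' (φ y)) (hs : ∀ v w, G' (φ y) v w = G' (φ y) w v)
    (hφ : ContDiffAt ℝ 2 φ y) (hsurj : Function.Surjective (fderiv ℝ φ y))
    (h : ∀ᶠ z in 𝓝 y, G z = (G' (φ z)).bilinearComp (fderiv ℝ φ z) (fderiv ℝ φ z))
    (hgeo : GeodesicEq G y u a) :
    GeodesicEq G' (φ y) (fderiv ℝ φ y u)
      (fderiv ℝ (fderiv ℝ φ) y u u + fderiv ℝ φ y a) := by
  intro w
  obtain ⟨w, rfl⟩ := hsurj w
  have hsymm : ∀ v w, fderiv ℝ (fderiv ℝ φ) y v w = fderiv ℝ (fderiv ℝ φ) y w v :=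
    hφ.isSymmSndFDerivAt (by simp)
  have hD : HasFDerivAt (fderiv ℝ φ) (fderiv ℝ (fderiv ℝ φ) y) y :=
    ((hφ.fderiv_right (m := 1) (by norm_num)).differentiableAt (by norm_num)).hasFDerivAt
  have hφ1 : HasFDerivAt φ (fderiv ℝ φ y) y := (hφ.differentiableAt (by norm_num)).hasFDerivAt
  have hGd : ∀ u w : E, HasFDerivAt (fun z => G z u w) _ y := fun u w =>
    ((hG'.hasFDerivAt.comp y hφ1).clm_apply (hD.clm_apply (hasFDerivAt_const u y))).clm_apply
      (hD.clm_apply (hasFDerivAt_const w y)) |>.congr_of_eventuallyEq (by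
        filter_upwards [h] with z hz
        rw [hz]; rfl)
  have hGdiff : DifferentiableAt ℝ G y := by
    have h1 : DifferentiableAt ℝ
        (fun z =>
        (ContinuousLinearMap.bilinearComp (G' (φ z)) (fderiv ℝ φ z) (fderiv ℝ φ z))) y := by
      have h2 : DifferentiableAt ℝ (fun z => (G' (φ z)).comp (fderiv ℝ φ z)) y :=
        ((hG'.hasFDerivAt.comp y hφ1).clm_comp hD).differentiableAt
      have h3 : DifferentiableAt ℝ (fun z => (((G' (φ z)).comp (fderiv ℝ φ z)).flip).comp
          (fderiv ℝ φ z)) y := by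
        refine DifferentiableAt.clm_comp ?_ hD.differentiableAt
        exact (ContinuousLinearMap.flipₗᵢ ℝ E E ℝ).differentiable.differentiableAt.comp y h2
      exact (ContinuousLinearMap.flipₗᵢ ℝ E E ℝ).differentiable.differentiableAt.comp y h3
    exact h1.congr_of_eventuallyEq h
  have key : ∀ ξ u w : E, fderiv ℝ G y ξ u w =
      fderiv ℝ G' (φ y) (fderiv ℝ φ y ξ) (fderiv ℝ φ y u) (fderiv ℝ φ y w) +
      G' (φ y) (fderiv ℝ (fderiv ℝ φ) y ξ u) (fderiv ℝ φ y w) +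
      G' (φ y) (fderiv ℝ φ y u) (fderiv ℝ (fderiv ℝ φ) y ξ w) := by
    intro ξ u w
    have h1 := (hGdiff.hasFDerivAt.clm_apply (hasFDerivAt_const u y)).clm_apply
      (hasFDerivAt_const w y)
    have h2 := DFunLike.congr_fun (h1.unique (hGd u w)) ξ
    simp at h2
    rw [h2]; ring
  have h0 := hgeo w
  rw [key, key, h.self_of_nhds] at h0
  simp only [ContinuousLinearMap.bilinearComp_apply] at h0
  rw [hs (fderiv ℝ (fderiv ℝ φ) y w u), hsymm w u] at h0
  rw [map_add, add_apply]
  linarith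

/-- A curve with velocity `v` and acceleration `a` satisfies the geodesic equation of the metric
`G` at the time `t`. -/
def IsGeodesicAt {E : Type*} [NormedAddCommGroup E] [NormedSpace ℝ E]
    (G : E → E →L[ℝ] E →L[ℝ] ℝ) (c v a : ℝ → E) (s : Set ℝ) (t : ℝ) : Prop :=
  HasDerivWithinAt c (v t) s t ∧ HasDerivWithinAt v (a t) s t ∧ ContinuousWithinAt a s t ∧
    GeodesicEq G (c t) (v t) (a t)

variable {n : ℕ} {M : Type*} [TopologicalSpace M] [ChartedSpace (Coord n) M]
  [IsManifold 𝓘(ℝ, Coord n) 4 M]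

section Charts

variable {S : Spacetime n M} {e e' : OpenPartialHomeomorph M (Coord n)}
  (he : e ∈ IsManifold.maximalAtlas 𝓘(ℝ, Coord n) 4 M)
  (he' : e' ∈ IsManifold.maximalAtlas 𝓘(ℝ, Coord n) 4 M)

include he he'

lemma contDiffOn_transition : ContDiffOn ℝ 4 (e' ∘ e.symm) (e.symm.trans e').source := by
  have h1 := (contMDiffOn_of_mem_maximalAtlas he').comp' (contMDiffOn_symm_of_mem_maximalAtlas he)
  rw [OpenPartialHomeomorph.trans_source]
  exact contMDiffOn_iff_contDiffOn.1 h1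

lemma chartD_transition {y : Coord n} (hy : y ∈ (e.symm.trans e').source) (u : Coord n) :
    chartD e y u = chartD e' (e' (e.symm y)) (fderiv ℝ (e' ∘ e.symm) y u) := by
  have hy' := hy
  rw [OpenPartialHomeomorph.trans_source] at hy
  have h1 : MDifferentiableAt 𝓘(ℝ, Coord n) 𝓘(ℝ, Coord n) (e' ∘ e.symm) y :=
    (((contDiffOn_transition he he').contDiffAt ((e.symm.trans e').open_source.mem_nhds
      hy')).differentiableAt (by norm_num)).mdifferentiableAt
  have h2 : MDifferentiableAt 𝓘(ℝ, Coord n) 𝓘(ℝ, Coord n) e'.symm ((e' ∘ e.symm) y) :=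
    (mdifferentiable_chart_of_mem he').mdifferentiableAt_symm (e'.map_source hy.2)
  have h3 := mfderiv_comp y h2 h1
  rw [mfderiv_eq_fderiv] at h3
  have h4 : e'.symm ∘ (e' ∘ e.symm) =ᶠ[𝓝 y] e.symm := by
    filter_upwards [(e.symm.trans e').open_source.mem_nhds hy'] with z hz
    rw [OpenPartialHomeomorph.trans_source] at hz
    exact e'.left_inv hz.2
  have h5 := h4.mfderiv_eq (I := 𝓘(ℝ, Coord n)) (I' := 𝓘(ℝ, Coord n))
  exact DFunLike.congr_fun (h5.symm.trans h3) u

lemma chartG_transition {y : Coord n} (hy : y ∈ (e.symm.trans e').source) :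
    chartG S e y = (chartG S e' (e' (e.symm y))).bilinearComp (fderiv ℝ (e' ∘ e.symm) y)
      (fderiv ℝ (e' ∘ e.symm) y) := by
  ext u w
  rw [ContinuousLinearMap.bilinearComp_apply, chartG_apply, chartG_apply,
    chartD_transition he he' hy u, chartD_transition he he' hy w]
  rw [OpenPartialHomeomorph.trans_source] at hy
  have : ∀ x : M, x = e.symm y → ∀ p q : Coord n,
      (S.g x : Coord n →L[ℝ] Coord n →L[ℝ] ℝ) p q = (S.g (e.symm y) : _ →L[ℝ] _ →L[ℝ] ℝ) p q := by
    rintro x rfl p q; rfl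
  exact (this _ (e'.left_inv hy.2) _ _).symm

lemma bijective_fderiv_transition {y : Coord n} (hy : y ∈ (e.symm.trans e').source) :
    Function.Bijective (fderiv ℝ (e' ∘ e.symm) y) := by
  have h1 : chartD e y = (chartD e' (e' (e.symm y))).comp (fderiv ℝ (e' ∘ e.symm) y) := by
    ext1 u; exact chartD_transition he he' hy u
  rw [OpenPartialHomeomorph.trans_source] at hy
  have h2 := bijective_chartD he hy.1
  have h3 := bijective_chartD he' (e'.map_source hy.2)
  rw [h1, ContinuousLinearMap.coe_comp] at h2
  exact (Function.Bijective.of_comp_iff' h3 _).1 h2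

/-- The geodesic equation does not depend on the chart. -/
lemma IsGeodesicAt.change_chart {γ : ℝ → M} {v a : ℝ → Coord n} {s : Set ℝ} {t : ℝ}
    (hsrc : ∀ᶠ τ in 𝓝[s] t, γ τ ∈ e.source ∩ e'.source) (hts : t ∈ s)
    (h : IsGeodesicAt (chartG S e) (fun τ => e (γ τ)) v a s t) :
    IsGeodesicAt (chartG S e') (fun τ => e' (γ τ))
      (fun τ => fderiv ℝ (e' ∘ e.symm) (e (γ τ)) (v τ))
      (fun τ => fderiv ℝ (fderiv ℝ (e' ∘ e.symm)) (e (γ τ)) (v τ) (v τ) +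
        fderiv ℝ (e' ∘ e.symm) (e (γ τ)) (a τ)) s t := by
  obtain ⟨h1, h2, h3, h4⟩ := h
  have ht := hsrc.self_of_nhdsWithin hts
  set φ := e' ∘ e.symm with hφ
  have hy : e (γ t) ∈ (e.symm.trans e').source := by
    rw [OpenPartialHomeomorph.trans_source]
    exact ⟨e.map_source ht.1, by simpa [e.left_inv ht.1] using ht.2⟩
  have hφs : ContDiffAt ℝ 4 φ (e (γ t)) := (contDiffOn_transition he he').contDiffAt
    ((e.symm.trans e').open_source.mem_nhds hy)
  have hφ1 : ContDiffAt ℝ 3 (fderiv ℝ φ) (e (γ t)) := hφs.fderiv_right (by norm_cast)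
  have hφ2 : ContDiffAt ℝ 2 (fderiv ℝ (fderiv ℝ φ)) (e (γ t)) := hφ1.fderiv_right (by norm_cast)
  have e1 : φ (e (γ t)) = e' (γ t) := by simp [hφ, e.left_inv ht.1]
  have d1 : HasDerivWithinAt (fun τ => fderiv ℝ φ (e (γ τ)))
      (fderiv ℝ (fderiv ℝ φ) (e (γ t)) (v t)) s t :=
    (hφ1.differentiableAt (by norm_num)).hasFDerivAt.comp_hasDerivWithinAt t h1
  refine ⟨?_, ?_, ?_, ?_⟩
  · have h5 := (hφs.differentiableAt (by norm_num)).hasFDerivAt.comp_hasDerivWithinAt t h1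
    refine h5.congr_of_eventuallyEq ?_ e1.symm
    filter_upwards [hsrc] with τ hτ
    simp [hφ, e.left_inv hτ.1]
  · exact d1.clm_apply h2
  · have c2 : ContinuousWithinAt (fun τ => fderiv ℝ (fderiv ℝ φ) (e (γ τ))) s t :=
      ContinuousAt.comp_continuousWithinAt (f := fun τ => e (γ τ)) hφ2.continuousAt
        h1.continuousWithinAt
    exact ((c2.clm_apply h2.continuousWithinAt).clm_apply h2.continuousWithinAt).add
      (d1.continuousWithinAt.clm_apply h3)
  · have hyt : e' (γ t) ∈ e'.target := e'.map_source ht.2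
    beta_reduce
    rw [← e1]
    refine GeodesicEq.of_pullback (G := chartG S e) ?_ ?_ (hφs.of_le (by norm_cast))
      (bijective_fderiv_transition he he' hy).2 ?_ h4
    · rw [e1]
      exact ((contDiffOn_chartG S he').contDiffAt (e'.open_target.mem_nhds hyt)).differentiableAt
        (by norm_num)
    · rw [e1]; exact (isLorentz_chartG S he' hyt).1
    · filter_upwards [(e.symm.trans e').open_source.mem_nhds hy] with z hz
      exact chartG_transition he he' hz

end Charts

end NullHorizon

namespace NullHorizon

/-! ### Null geodesics of a hypersurface as local objects -/

lemma IsGeodesicAt.congr {E : Type*} [NormedAddCommGroup E] [NormedSpace ℝ E]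
    {G : E → E →L[ℝ] E →L[ℝ] ℝ} {c v a c' v' a' : ℝ → E} {s s' : Set ℝ} {t : ℝ}
    (h : IsGeodesicAt G c v a s t) (ht : t ∈ s) (hs : s' =ᶠ[𝓝 t] s) (hc : c' =ᶠ[𝓝[s] t] c)
    (hv : v' =ᶠ[𝓝[s] t] v) (ha : a' =ᶠ[𝓝[s] t] a) : IsGeodesicAt G c' v' a' s' t := by
  obtain ⟨h1, h2, h3, h4⟩ := h
  have ec := hc.self_of_nhdsWithin ht
  have ev := hv.self_of_nhdsWithin ht
  have ea := ha.self_of_nhdsWithin ht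
  refine ⟨?_, ?_, ?_, ?_⟩
  · rw [hasDerivWithinAt_congr_set hs, ev]
    exact h1.congr_of_eventuallyEq hc ec
  · rw [hasDerivWithinAt_congr_set hs, ea]
    exact h2.congr_of_eventuallyEq hv ev
  · rw [continuousWithinAt_congr_set hs]
    exact h3.congr_of_eventuallyEq ha ea
  · rwa [ec, ev, ea]

lemma uniqueDiffOn_of_ordConnected {s : Set ℝ} (hs : s.OrdConnected) (hs' : s.Nontrivial) :
    UniqueDiffOn ℝ s :=
  uniqueDiffOn_convex hs.convex (hs.convex.nontrivial_iff_nonempty_interior.1 hs')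

variable {n : ℕ} {M : Type*} [TopologicalSpace M] [ChartedSpace (Coord n) M]
  [IsManifold 𝓘(ℝ, Coord n) 4 M]

/-- The velocity of a curve in terms of its representation in a chart. -/
lemma velocity_eq {e : OpenPartialHomeomorph M (Coord n)}
    (he : e ∈ IsManifold.maximalAtlas 𝓘(ℝ, Coord n) 4 M) {γ : ℝ → M} {s : Set ℝ} {t : ℝ}
    (hs : UniqueDiffWithinAt ℝ s t) (hγ : ContinuousWithinAt γ s t) (hsrc : γ t ∈ e.source)
    {u : Coord n} (h : HasDerivWithinAt (fun τ => e (γ τ)) u s t) :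
    velocity n γ s t = chartD e (e (γ t)) u := by
  have h1 : HasMFDerivWithinAt 𝓘(ℝ, ℝ) 𝓘(ℝ, Coord n) (fun τ => e (γ τ)) s t
      (ContinuousLinearMap.toSpanSingleton ℝ u) :=
    hasMFDerivWithinAt_iff_hasFDerivWithinAt.2 h.hasFDerivWithinAt
  have h2 := ((mdifferentiable_chart_of_mem he).mdifferentiableAt_symm
    (e.map_source hsrc)).hasMFDerivAt
  have h3 := HasMFDerivAt.comp_hasMFDerivWithinAt (f := fun τ => e (γ τ)) t h2 h1
  have h4 : HasMFDerivWithinAt 𝓘(ℝ, ℝ) 𝓘(ℝ, Coord n) γ s t _ :=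
    h3.congr_of_eventuallyEq (by
      filter_upwards [hγ (e.open_source.mem_nhds hsrc)] with τ hτ
      exact (e.left_inv hτ).symm) (e.left_inv hsrc).symm
  have h5 := h4.mfderivWithin (uniqueMDiffWithinAt_iff_uniqueDiffWithinAt.2 hs)
  have h6 := DFunLike.congr_fun h5 (1 : ℝ)
  refine h6.trans ?_
  change chartD e (e (γ t)) (ContinuousLinearMap.toSpanSingleton ℝ u (1 : ℝ)) = _
  simp

/-- Near the time `t`, the curve `γ`, whose velocity and acceleration in the chart `e` are `v` and
`a`, is a future-directed lightlike geodesic, and at the time `t` it meets `H`. -/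
def IsNullGerm (S : Spacetime n M) (H : Set M) (e : OpenPartialHomeomorph M (Coord n))
    (γ : ℝ → M) (v a : ℝ → Coord n) (s : Set ℝ) (t : ℝ) : Prop :=
  γ t ∈ H ∧ γ t ∈ e.source ∧ ContinuousWithinAt γ s t ∧
    (∀ᶠ τ in 𝓝[s] t, IsGeodesicAt (chartG S e) (fun τ => e (γ τ)) v a s τ) ∧
    S.FutureLightlike (γ t) (chartD e (e (γ t)) (v t))

variable {S : Spacetime n M} {H : Set M} {e e' : OpenPartialHomeomorph M (Coord n)}

lemma differentiableAt_chartG (he : e ∈ IsManifold.maximalAtlas 𝓘(ℝ, Coord n) 4 M) {y : Coord n}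
    (hy : y ∈ e.target) : DifferentiableAt ℝ (chartG S e) y :=
  ((contDiffOn_chartG S he).contDiffAt (e.open_target.mem_nhds hy)).differentiableAt (by norm_num)

lemma fderiv_chartG_apply (he : e ∈ IsManifold.maximalAtlas 𝓘(ℝ, Coord n) 4 M) {y : Coord n}
    (hy : y ∈ e.target) (u w ξ : Coord n) :
    fderiv ℝ (fun y => chartG S e y u w) y ξ = fderiv ℝ (chartG S e) y ξ u w := by
  have h := (((differentiableAt_chartG (S := S) he hy).hasFDerivAt.clm_apply
    (hasFDerivAt_const u _)).clm_apply (hasFDerivAt_const w _)).fderiv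
  simpa using DFunLike.congr_fun h ξ

lemma IsNullGerm.congr {γ γ' : ℝ → M} {v a v' a' : ℝ → Coord n} {s s' : Set ℝ} {t : ℝ}
    (h : IsNullGerm S H e γ v a s t) (ht : t ∈ s) (hs : s' =ᶠ[𝓝 t] s)
    (hγ : γ' =ᶠ[𝓝[s] t] γ) (hv : v' =ᶠ[𝓝[s] t] v) (ha : a' =ᶠ[𝓝[s] t] a) :
    IsNullGerm S H e γ' v' a' s' t := by
  obtain ⟨h1, h2, h3, h4, h5⟩ := h
  have eγ := hγ.self_of_nhdsWithin ht
  have ev := hv.self_of_nhdsWithin ht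
  refine ⟨by rwa [eγ], by rwa [eγ], ?_, ?_, by rw [eγ, ev]; exact h5⟩
  · rw [continuousWithinAt_congr_set hs]
    exact h3.congr_of_eventuallyEq hγ eγ
  · have e1 : 𝓝[s'] t = 𝓝[s] t := nhdsWithin_eq_iff_eventuallyEq.2 hs
    rw [e1]
    have hs2 := eventually_nhdsWithin_of_eventually_nhds (s := s)
      (eventually_eventually_nhds.2 hs)
    filter_upwards [h4, hs2, eventually_eventually_nhdsWithin.2 hγ,
      eventually_eventually_nhdsWithin.2 hv, eventually_eventually_nhdsWithin.2 ha,
      self_mem_nhdsWithin] with τ k1 k2 k3 k4 k5 k6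
    refine k1.congr k6 k2 ?_ k4 k5
    filter_upwards [k3] with x hx using by rw [hx]

/-- Being a lightlike geodesic does not depend on the chart. -/
lemma IsNullGerm.change_chart (he : e ∈ IsManifold.maximalAtlas 𝓘(ℝ, Coord n) 4 M)
    (he' : e' ∈ IsManifold.maximalAtlas 𝓘(ℝ, Coord n) 4 M) {γ : ℝ → M} {v a : ℝ → Coord n}
    {s : Set ℝ} {t : ℝ} (h : IsNullGerm S H e γ v a s t) (hsrc : γ t ∈ e'.source) :
    ∃ v' a', IsNullGerm S H e' γ v' a' s t := by
  obtain ⟨h1, h2, h3, h4, h5⟩ := h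
  have hy : e (γ t) ∈ (e.symm.trans e').source := by
    rw [OpenPartialHomeomorph.trans_source]
    exact ⟨e.map_source h2, by simpa [e.left_inv h2] using hsrc⟩
  have hev : ∀ᶠ τ in 𝓝[s] t, γ τ ∈ e.source ∩ e'.source :=
    h3 ((e.open_source.inter e'.open_source).mem_nhds ⟨h2, hsrc⟩)
  refine ⟨fun τ => fderiv ℝ (e' ∘ e.symm) (e (γ τ)) (v τ),
    fun τ => fderiv ℝ (fderiv ℝ (e' ∘ e.symm)) (e (γ τ)) (v τ) (v τ) +
      fderiv ℝ (e' ∘ e.symm) (e (γ τ)) (a τ), h1, hsrc, h3, ?_, ?_⟩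
  · filter_upwards [h4, eventually_eventually_nhdsWithin.2 hev, self_mem_nhdsWithin]
      with τ k1 k2 k3
    exact k1.change_chart he he' k2 k3
  · rwa [chartD_transition he he' hy, e.left_inv h2] at h5

/-- A lightlike geodesic, seen in a chart. -/
lemma IsGeodesicAt.of_isLightlikeGeodesicIn {γ : ℝ → M} {s : Set ℝ}
    (he : e ∈ IsManifold.maximalAtlas 𝓘(ℝ, Coord n) 4 M)
    (h : S.IsLightlikeGeodesicIn H γ s) {t : ℝ} (ht : t ∈ s) (hsrc : γ t ∈ e.source) :
    IsGeodesicAt (chartG S e) (fun τ => e (γ τ)) (derivWithin (fun τ => e (γ τ)) s)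
      (derivWithin (derivWithin (fun τ => e (γ τ)) s) s) s t ∧
    S.FutureLightlike (γ t) (chartD e (e (γ t)) (derivWithin (fun τ => e (γ τ)) s t)) := by
  obtain ⟨hc, hn, ⟨hcont, hgeo⟩, hH⟩ := h
  have hU := uniqueDiffOn_of_ordConnected hc hn
  obtain ⟨h2, heq⟩ := hgeo t ht e he hsrc
  have hderiv : ∀ {k m : ℕ∞ω} {f : ℝ → Coord n}, m + 1 ≤ k → ContDiffWithinAt ℝ k f s t →
      ContDiffWithinAt ℝ m (derivWithin f s) s t := by
    intro k m f hk hf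
    have h1 := (hf.fderivWithin_right hU hk ht).clm_apply
      (contDiffWithinAt_const (c := (1 : ℝ)))
    exact h1
  have h1 := hderiv (m := 1) (by norm_num) h2
  have h0 := hderiv (m := 0) (by norm_num) h1
  have d1 := (h2.differentiableWithinAt (by norm_num)).hasDerivWithinAt
  have d2 := (h1.differentiableWithinAt (by norm_num)).hasDerivWithinAt
  refine ⟨⟨d1, d2, h0.continuousWithinAt, fun w => ?_⟩, ?_⟩
  · have := heq w
    simp only [chartMetric_eq, fderiv_chartG_apply he (e.map_source hsrc)] at this
    exact this
  · have h4 := (hH t ht).2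
    rwa [velocity_eq he (hU t ht) (hcont t ht) hsrc d1] at h4

lemma IsNullGerm.of_isLightlikeGeodesicIn {γ : ℝ → M} {s : Set ℝ}
    (he : e ∈ IsManifold.maximalAtlas 𝓘(ℝ, Coord n) 4 M)
    (h : S.IsLightlikeGeodesicIn H γ s) {t : ℝ} (ht : t ∈ s) (hsrc : γ t ∈ e.source) :
    IsNullGerm S H e γ (derivWithin (fun τ => e (γ τ)) s)
      (derivWithin (derivWithin (fun τ => e (γ τ)) s) s) s t := by
  refine ⟨(h.2.2.2 t ht).1, hsrc, h.2.2.1.1 t ht, ?_,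
    (IsGeodesicAt.of_isLightlikeGeodesicIn he h ht hsrc).2⟩
  filter_upwards [self_mem_nhdsWithin, h.2.2.1.1 t ht (e.open_source.mem_nhds hsrc)] with τ k1 k2
  exact (IsGeodesicAt.of_isLightlikeGeodesicIn he h k1 k2).1

/-- A curve is a lightlike geodesic if it is one near each time, in some chart. -/
lemma isLightlikeGeodesicIn_of_isNullGerm {γ : ℝ → M} {s : Set ℝ} (hc : s.OrdConnected)
    (hn : s.Nontrivial)
    (h : ∀ t ∈ s, ∃ e ∈ IsManifold.maximalAtlas 𝓘(ℝ, Coord n) 4 M, ∃ v a,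
      IsNullGerm S H e γ v a s t) : S.IsLightlikeGeodesicIn H γ s := by
  have hU := uniqueDiffOn_of_ordConnected hc hn
  refine ⟨hc, hn, ⟨fun t ht => ?_, fun t ht e' he' hsrc => ?_⟩, fun t ht => ?_⟩
  · obtain ⟨e, he, v, a, h⟩ := h t ht
    exact h.2.2.1
  · obtain ⟨e, he, v, a, h⟩ := h t ht
    obtain ⟨v', a', -, -, hcont, hev, -⟩ := h.change_chart he he' hsrc
    have d1 : ∀ᶠ τ in 𝓝[s] t, HasDerivWithinAt (fun τ => e' (γ τ)) (v' τ) s τ :=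
      hev.mono fun τ hτ => hτ.1
    have d2 : ∀ᶠ τ in 𝓝[s] t, HasDerivWithinAt v' (a' τ) s τ := hev.mono fun τ hτ => hτ.2.1
    have c3 : ContDiffWithinAt ℝ 0 a' s t := by
      rw [contDiffWithinAt_zero ht]
      refine ⟨_, hev, fun τ hτ => ?_⟩
      exact hτ.2.2.2.1.mono inter_subset_left
    have hc2 := contDiffWithinAt_succ_of_hasDerivWithinAt (k := 1) ht d1
      (contDiffWithinAt_succ_of_hasDerivWithinAt (k := 0) ht d2 c3)
    refine ⟨hc2, fun w => ?_⟩
    have e1 : derivWithin (fun τ => e' (γ τ)) s =ᶠ[𝓝[s] t] v' := by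
      filter_upwards [d1, self_mem_nhdsWithin] with τ h1 h2 using h1.derivWithin (hU τ h2)
    have e2 : derivWithin (derivWithin (fun τ => e' (γ τ)) s) s t = a' t := by
      rw [e1.derivWithin_eq (e1.self_of_nhdsWithin ht)]
      exact (d2.self_of_nhdsWithin ht).derivWithin (hU t ht)
    have e3 := e1.self_of_nhdsWithin ht
    simp only [chartMetric_eq, fderiv_chartG_apply he' (e'.map_source hsrc), e2, e3]
    exact (hev.self_of_nhdsWithin ht).2.2.2 w
  · obtain ⟨e, he, v, a, h1, h2, h3, h4, h5⟩ := h t ht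
    refine ⟨h1, ?_⟩
    rw [velocity_eq he (hU t ht) h3 h2 (h4.self_of_nhdsWithin ht).1]
    exact h5

lemma GeodesicEq.unique (he : e ∈ IsManifold.maximalAtlas 𝓘(ℝ, Coord n) 4 M) {y u a b : Coord n}
    (hy : y ∈ e.target) (ha : GeodesicEq (chartG S e) y u a)
    (hb : GeodesicEq (chartG S e) y u b) : a = b := by
  by_contra hne
  have hL := isLorentz_chartG S he hy
  have h0 : ∀ w, chartG S e y (a - b) w = 0 := fun w => by
    have h1 := ha w
    have h2 := hb w
    rw [map_sub, sub_apply]; linarith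
  obtain ⟨u, hu, -⟩ := hL.2
  have := hL.pos_of_orthogonal hu (sub_ne_zero.2 hne) (by rw [hL.1]; exact h0 u)
  rw [h0] at this
  exact lt_irrefl _ this

/-- The local form of the gluing of geodesics: the accelerations agree at the meeting time, since
they are determined by the geodesic equation. -/
lemma IsNullGerm.glue (he : e ∈ IsManifold.maximalAtlas 𝓘(ℝ, Coord n) 4 M) {γ : ℝ → M}
    {v₁ a₁ v₂ a₂ : ℝ → Coord n} {s₁ s₂ : Set ℝ} {t₀ : ℝ} (hs₁ : IsGreatest s₁ t₀)
    (hs₂ : IsLeast s₂ t₀) (h₁ : IsNullGerm S H e γ v₁ a₁ s₁ t₀)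
    (h₂ : IsNullGerm S H e γ v₂ a₂ s₂ t₀) (hv : v₁ t₀ = v₂ t₀) :
    ∃ v a, IsNullGerm S H e γ v a (s₁ ∪ s₂) t₀ := by
  obtain ⟨m₁, b₁⟩ := hs₁
  obtain ⟨m₂, b₂⟩ := hs₂
  obtain ⟨h1, h2, h3, h4, h5⟩ := h₁
  obtain ⟨-, -, k3, k4, -⟩ := h₂
  have g1 := h4.self_of_nhdsWithin m₁
  have g2 := k4.self_of_nhdsWithin m₂
  have ha : a₁ t₀ = a₂ t₀ :=
    g1.2.2.2.unique he (e.map_source h2) (by rw [hv]; exact g2.2.2.2)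
  set v : ℝ → Coord n := fun τ => if τ ≤ t₀ then v₁ τ else v₂ τ with hvdef
  set a : ℝ → Coord n := fun τ => if τ ≤ t₀ then a₁ τ else a₂ τ with hadef
  have v1 : EqOn v v₁ s₁ := fun τ hτ => if_pos (b₁ hτ)
  have a1 : EqOn a a₁ s₁ := fun τ hτ => if_pos (b₁ hτ)
  have v2 : EqOn v v₂ s₂ := fun τ hτ => by
    rcases (b₂ hτ).eq_or_lt with rfl | h
    · rw [← hv]; exact if_pos le_rfl
    · exact if_neg (not_le.2 h)
  have a2 : EqOn a a₂ s₂ := fun τ hτ => by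
    rcases (b₂ hτ).eq_or_lt with rfl | h
    · rw [← ha]; exact if_pos le_rfl
    · exact if_neg (not_le.2 h)
  refine ⟨v, a, h1, h2, h3.union k3, ?_, by rw [v1 m₁]; exact h5⟩
  have center : IsGeodesicAt (chartG S e) (fun τ => e (γ τ)) v a (s₁ ∪ s₂) t₀ := by
    refine ⟨?_, ?_, ?_, ?_⟩
    · rw [v1 m₁]
      exact g1.1.union (by rw [hv]; exact g2.1)
    · rw [a1 m₁]
      exact (g1.2.1.congr v1 (v1 m₁)).union (by rw [ha]; exact g2.2.1.congr v2 (v2 m₂))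
    · exact (g1.2.2.1.congr a1 (a1 m₁)).union (g2.2.2.1.congr a2 (a2 m₂))
    · rw [v1 m₁, a1 m₁]; exact g1.2.2.2
  rw [nhdsWithin_union, eventually_sup]
  constructor
  · filter_upwards [h4, self_mem_nhdsWithin] with τ hτ hmem
    rcases (b₁ hmem).eq_or_lt with rfl | hlt
    · exact center
    refine hτ.congr hmem ?_ EventuallyEq.rfl (eventually_nhdsWithin_of_forall v1)
      (eventually_nhdsWithin_of_forall a1)
    filter_upwards [Iio_mem_nhds hlt] with x hx
    refine propext ⟨fun h => h.resolve_right fun h' => ?_, Or.inl⟩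
    exact absurd (b₂ h') (not_le.2 hx)
  · filter_upwards [k4, self_mem_nhdsWithin] with τ hτ hmem
    rcases (b₂ hmem).eq_or_lt with rfl | hlt
    · exact center
    refine hτ.congr hmem ?_ EventuallyEq.rfl (eventually_nhdsWithin_of_forall v2)
      (eventually_nhdsWithin_of_forall a2)
    filter_upwards [Ioi_mem_nhds hlt] with x hx
    refine propext ⟨fun h => h.resolve_left fun h' => ?_, Or.inr⟩
    exact absurd (b₁ h') (not_le.2 hx)

/-- Two lightlike geodesics which meet with the same velocity form a lightlike geodesic. -/
lemma isLightlikeGeodesicIn_union {γ : ℝ → M} {s₁ s₂ : Set ℝ} {t₀ : ℝ}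
    (hs₁ : IsGreatest s₁ t₀) (hs₂ : IsLeast s₂ t₀) (h₁ : S.IsLightlikeGeodesicIn H γ s₁)
    (h₂ : S.IsLightlikeGeodesicIn H γ s₂)
    (he : e ∈ IsManifold.maximalAtlas 𝓘(ℝ, Coord n) 4 M) (hsrc : γ t₀ ∈ e.source)
    (hv : derivWithin (fun τ => e (γ τ)) s₁ t₀ = derivWithin (fun τ => e (γ τ)) s₂ t₀) :
    S.IsLightlikeGeodesicIn H γ (s₁ ∪ s₂) := by
  have b₁ := hs₁.2
  have b₂ := hs₂.2
  have o₁ := h₁.1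
  have o₂ := h₂.1
  refine isLightlikeGeodesicIn_of_isNullGerm ?_ (h₁.2.1.mono subset_union_left) fun t ht => ?_
  · refine ⟨fun x hx y hy z hz => ?_⟩
    rcases le_total z t₀ with hzt | hzt
    · rcases hx with hx | hx
      · exact Or.inl (o₁.out hx hs₁.1 ⟨hz.1, hzt⟩)
      · exact Or.inl (by rw [show z = t₀ from le_antisymm hzt ((b₂ hx).trans hz.1)]; exact hs₁.1)
    · rcases hy with hy | hy
      · exact Or.inr (by rw [show z = t₀ from le_antisymm (hz.2.trans (b₁ hy)) hzt]; exact hs₂.1)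
      · exact Or.inr (o₂.out hs₂.1 hy ⟨hzt, hz.2⟩)
  · rcases lt_trichotomy t t₀ with hlt | rfl | hlt
    · have ht₁ : t ∈ s₁ := ht.resolve_right fun h' => absurd (b₂ h') (not_le.2 hlt)
      refine ⟨chartAt _ (γ t), IsManifold.chart_mem_maximalAtlas _, _, _,
        (IsNullGerm.of_isLightlikeGeodesicIn (IsManifold.chart_mem_maximalAtlas _) h₁ ht₁
          (mem_chart_source _ _)).congr ht₁ ?_ EventuallyEq.rfl EventuallyEq.rfl EventuallyEq.rfl⟩
      filter_upwards [Iio_mem_nhds hlt] with x hx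
      refine propext ⟨fun h => h.resolve_right fun h' => ?_, Or.inl⟩
      exact absurd (b₂ h') (not_le.2 hx)
    · exact ⟨e, he, IsNullGerm.glue he hs₁ hs₂ (.of_isLightlikeGeodesicIn he h₁ hs₁.1 hsrc)
        (.of_isLightlikeGeodesicIn he h₂ hs₂.1 hsrc) hv⟩
    · have ht₂ : t ∈ s₂ := ht.resolve_left fun h' => absurd (b₁ h') (not_le.2 hlt)
      refine ⟨chartAt _ (γ t), IsManifold.chart_mem_maximalAtlas _, _, _,
        (IsNullGerm.of_isLightlikeGeodesicIn (IsManifold.chart_mem_maximalAtlas _) h₂ ht₂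
          (mem_chart_source _ _)).congr ht₂ ?_ EventuallyEq.rfl EventuallyEq.rfl EventuallyEq.rfl⟩
      filter_upwards [Ioi_mem_nhds hlt] with x hx
      refine propext ⟨fun h => h.resolve_left fun h' => ?_, Or.inr⟩
      exact absurd (b₁ h') (not_le.2 hx)

end NullHorizon

namespace NullHorizon

/-! ### Existence of generators -/

variable {n : ℕ} {M : Type*} [TopologicalSpace M] [ChartedSpace (Coord n) M]
  [IsManifold 𝓘(ℝ, Coord n) 4 M] {S : Spacetime n M} {H : Set M}

/-- In a directed family of order connected subsets of the line, each point of the union has a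
member of the family as a relative neighbourhood. -/
lemma exists_mem_eventuallyEq_sUnion {C : Set (Set ℝ)} (hd : DirectedOn (· ⊆ ·) C)
    (ho : ∀ s ∈ C, s.OrdConnected) {t : ℝ} (ht : t ∈ ⋃₀ C) :
    ∃ s ∈ C, t ∈ s ∧ ⋃₀ C =ᶠ[𝓝 t] s := by
  -- a member of the family which reaches to the left of `t` whenever the union does
  have left : ∀ s₀ ∈ C, ∃ s ∈ C, s₀ ⊆ s ∧ ((∃ a ∈ ⋃₀ C, a < t) → ∃ a ∈ s, a < t) := by
    intro s₀ hs₀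
    by_cases h : ∃ a ∈ ⋃₀ C, a < t
    · obtain ⟨a, ⟨s₁, hs₁, ha⟩, hat⟩ := h
      obtain ⟨s, hs, h0, h1⟩ := hd s₀ hs₀ s₁ hs₁
      exact ⟨s, hs, h0, fun _ => ⟨a, h1 ha, hat⟩⟩
    · exact ⟨s₀, hs₀, subset_rfl, fun h' => absurd h' h⟩
  have right : ∀ s₀ ∈ C, ∃ s ∈ C, s₀ ⊆ s ∧ ((∃ a ∈ ⋃₀ C, t < a) → ∃ a ∈ s, t < a) := by
    intro s₀ hs₀
    by_cases h : ∃ a ∈ ⋃₀ C, t < a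
    · obtain ⟨a, ⟨s₁, hs₁, ha⟩, hat⟩ := h
      obtain ⟨s, hs, h0, h1⟩ := hd s₀ hs₀ s₁ hs₁
      exact ⟨s, hs, h0, fun _ => ⟨a, h1 ha, hat⟩⟩
    · exact ⟨s₀, hs₀, subset_rfl, fun h' => absurd h' h⟩
  obtain ⟨s₀, hs₀, ht₀⟩ := ht
  obtain ⟨s₁, hs₁, h01, hl⟩ := left s₀ hs₀
  obtain ⟨s, hs, h1, hr⟩ := right s₁ hs₁
  have hts : t ∈ s := h1 (h01 ht₀)
  have hoc := ho s hs
  refine ⟨s, hs, hts, ?_⟩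
  have evl : ∀ᶠ x in 𝓝 t, x ∈ ⋃₀ C → x < t → x ∈ s := by
    by_cases h : ∃ a ∈ ⋃₀ C, a < t
    · obtain ⟨a, ha, hat⟩ := hl h
      filter_upwards [Ioi_mem_nhds hat] with x hx _ hxt
      exact hoc.out (h1 ha) hts ⟨le_of_lt hx, hxt.le⟩
    · exact Eventually.of_forall fun x hx hxt => absurd ⟨x, hx, hxt⟩ h
  have evr : ∀ᶠ x in 𝓝 t, x ∈ ⋃₀ C → t < x → x ∈ s := by
    by_cases h : ∃ a ∈ ⋃₀ C, t < a
    · obtain ⟨a, ha, hat⟩ := hr h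
      filter_upwards [Iio_mem_nhds hat] with x hx _ hxt
      exact hoc.out hts ha ⟨hxt.le, le_of_lt hx⟩
    · exact Eventually.of_forall fun x hx hxt => absurd ⟨x, hx, hxt⟩ h
  filter_upwards [evl, evr] with x hx1 hx2
  refine propext ⟨fun h => ?_, fun h => ⟨s, hs, h⟩⟩
  rcases lt_trichotomy x t with h' | rfl | h'
  · exact hx1 h h'
  · exact hts
  · exact hx2 h h'

/-- Every lightlike geodesic in `H` is part of a generator. -/
lemma exists_isGenerator {γ : ℝ → M} {s : Set ℝ} (h : S.IsLightlikeGeodesicIn H γ s) :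
    ∃ (η : ℝ → M) (s' : Set ℝ), s ⊆ s' ∧ EqOn η γ s ∧ S.IsGenerator H η s' := by
  let X := {q : (ℝ → M) × Set ℝ // S.IsLightlikeGeodesicIn H q.1 q.2}
  let r : X → X → Prop := fun p q => p.1.2 ⊆ q.1.2 ∧ EqOn q.1.1 p.1.1 p.1.2
  have htrans : ∀ {a b c : X}, r a b → r b c → r a c := fun {a b c} h1 h2 =>
    ⟨h1.1.trans h2.1, fun x hx => (h2.2 (h1.1 hx)).trans (h1.2 hx)⟩
  have hrefl : ∀ a, r a a := fun a => ⟨subset_rfl, fun _ _ => rfl⟩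
  let Y := {q : X // r ⟨(γ, s), h⟩ q}
  have key : ∃ m : Y, ∀ a : Y, r m.1 a.1 → r a.1 m.1 := by
    refine exists_maximal_of_chains_bounded (r := fun a b : Y => r a.1 b.1) (fun c hc => ?_)
      (fun h1 h2 => htrans h1 h2)
    rcases c.eq_empty_or_nonempty with rfl | ⟨y₀, hy₀⟩
    · exact ⟨⟨_, hrefl _⟩, fun a ha => ha.elim⟩
    have htot : ∀ a ∈ c, ∀ b ∈ c, r a.1 b.1 ∨ r b.1 a.1 := fun a ha b hb => by
      by_cases hab : a = b
      · subst hab; exact Or.inl (hrefl _)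
      · exact hc ha hb hab
    set C : Set (Set ℝ) := (fun a : Y => a.1.1.2) '' c with hC
    have hagree : ∀ a ∈ c, ∀ b ∈ c, ∀ t ∈ a.1.1.2, t ∈ b.1.1.2 → a.1.1.1 t = b.1.1.1 t := by
      intro a ha b hb t hta htb
      rcases htot a ha b hb with h1 | h1
      · exact (h1.2 hta).symm
      · exact h1.2 htb
    have hch : ∀ t, ∃ x : M, ∀ a ∈ c, t ∈ a.1.1.2 → a.1.1.1 t = x := by
      intro t
      by_cases ht : ∃ b ∈ c, t ∈ b.1.1.2
      · obtain ⟨b, hb, htb⟩ := ht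
        exact ⟨b.1.1.1 t, fun a ha hta => hagree a ha b hb t hta htb⟩
      · exact ⟨γ 0, fun a ha hta => absurd ⟨a, ha, hta⟩ ht⟩
    choose η hη using hch
    have hd : DirectedOn (· ⊆ ·) C := by
      rintro _ ⟨a, ha, rfl⟩ _ ⟨b, hb, rfl⟩
      rcases htot a ha b hb with h1 | h1
      · exact ⟨_, ⟨b, hb, rfl⟩, h1.1, subset_rfl⟩
      · exact ⟨_, ⟨a, ha, rfl⟩, subset_rfl, h1.1⟩
    have ho : ∀ s ∈ C, s.OrdConnected := by
      rintro _ ⟨a, ha, rfl⟩; exact a.1.2.1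
    have hU : S.IsLightlikeGeodesicIn H η (⋃₀ C) := by
      refine isLightlikeGeodesicIn_of_isNullGerm ⟨?_⟩ ?_ fun t ht => ?_
      · rintro x ⟨s₁, hs₁, hx⟩ y ⟨s₂, hs₂, hy⟩ z hz
        obtain ⟨s₃, hs₃, h1, h2⟩ := hd s₁ hs₁ s₂ hs₂
        exact ⟨s₃, hs₃, (ho s₃ hs₃).out (h1 hx) (h2 hy) hz⟩
      · exact y₀.1.2.2.1.mono (subset_sUnion_of_mem ⟨y₀, hy₀, rfl⟩)
      · obtain ⟨_, ⟨a, ha, rfl⟩, hta, heq⟩ := exists_mem_eventuallyEq_sUnion hd ho ht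
        refine ⟨chartAt _ (a.1.1.1 t), IsManifold.chart_mem_maximalAtlas _, _, _,
          (IsNullGerm.of_isLightlikeGeodesicIn (IsManifold.chart_mem_maximalAtlas _) a.1.2 hta
            (mem_chart_source _ _)).congr hta heq ?_ EventuallyEq.rfl EventuallyEq.rfl⟩
        filter_upwards [self_mem_nhdsWithin] with x hx using (hη x a ha hx).symm
    have hub : ∀ a ∈ c, r a.1 ⟨(η, ⋃₀ C), hU⟩ := fun a ha =>
      ⟨subset_sUnion_of_mem ⟨a, ha, rfl⟩, fun t ht => (hη t a ha ht).symm⟩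
    exact ⟨⟨⟨(η, ⋃₀ C), hU⟩, htrans y₀.2 (hub y₀ hy₀)⟩, hub⟩
  obtain ⟨m, hm⟩ := key
  refine ⟨m.1.1.1, m.1.1.2, m.2.1, m.2.2, m.1.2, fun η s' hs heq hl => ?_⟩
  have hr : r m.1 ⟨(η, s'), hl⟩ := ⟨hs, heq⟩
  exact Subset.antisymm (hm ⟨⟨(η, s'), hl⟩, htrans m.2 hr⟩ hr).1 hs

end NullHorizon

namespace NullHorizon

/-! ### The coordinate picture of a horizon -/

/-- Near a point, a `C²` map and its derivative are bounded, and the remainders of their Taylor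
expansions are controlled. -/
lemma exists_taylor_bounds {E F : Type*} [NormedAddCommGroup E] [NormedSpace ℝ E]
    [NormedAddCommGroup F] [NormedSpace ℝ F] {G : E → F} {y₀ : E} (hG : ContDiffAt ℝ 2 G y₀) :
    ∃ r > 0, ∃ K > 0, (∀ y ∈ Metric.ball y₀ r, ‖G y‖ ≤ K) ∧
      (∀ y ∈ Metric.ball y₀ r, ‖fderiv ℝ G y‖ ≤ K) ∧
      (∀ y ∈ Metric.ball y₀ r, ∀ z ∈ Metric.ball y₀ r, ‖G z - G y‖ ≤ K * ‖z - y‖) ∧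
      (∀ y ∈ Metric.ball y₀ r, ∀ z ∈ Metric.ball y₀ r,
        ‖G z - G y - fderiv ℝ G y (z - y)‖ ≤ K * ‖z - y‖ ^ 2) := by
  have hG' : ContDiffAt ℝ 1 (fderiv ℝ G) y₀ := hG.fderiv_right (by norm_num)
  obtain ⟨k, t, ht, hlip⟩ := hG'.exists_lipschitzOnWith
  have hd : ∀ᶠ y in 𝓝 y₀, DifferentiableAt ℝ G y :=
    (hG.eventually (by simp)).mono fun y hy => hy.differentiableAt (by norm_num)
  set K : ℝ := max (max (‖G y₀‖ + 1) (‖fderiv ℝ G y₀‖ + 1)) k with hK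
  have pK : 0 < K := lt_of_lt_of_le (by positivity)
    ((le_max_left (‖G y₀‖ + 1) (‖fderiv ℝ G y₀‖ + 1)).trans (le_max_left _ _))
  have b1 : ∀ᶠ y in 𝓝 y₀, ‖G y‖ < ‖G y₀‖ + 1 :=
    hG.continuousAt.norm.eventually_lt_const (by linarith)
  have b2 : ∀ᶠ y in 𝓝 y₀, ‖fderiv ℝ G y‖ < ‖fderiv ℝ G y₀‖ + 1 :=
    hG'.continuousAt.norm.eventually_lt_const (by linarith)
  obtain ⟨r, hr, hb⟩ := Metric.eventually_nhds_iff_ball.1 ((b1.and b2).and (hd.and ht))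
  have hb2 : ∀ y ∈ Metric.ball y₀ r, ‖fderiv ℝ G y‖ ≤ K := fun y hy =>
    ((hb y hy).1.2.le).trans ((le_max_right _ _).trans (le_max_left _ _))
  refine ⟨r, hr, K, pK, fun y hy => ((hb y hy).1.1.le).trans
    ((le_max_left _ _).trans (le_max_left _ _)), hb2, fun y hy z hz => ?_, fun y hy z hz => ?_⟩
  · exact (convex_ball y₀ r).norm_image_sub_le_of_norm_fderiv_le
      (fun x hx => (hb x hx).2.1) hb2 hy hz
  · have hs : segment ℝ y z ⊆ Metric.ball y₀ r := (convex_ball y₀ r).segment_subset hy hz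
    have := (convex_segment y z).norm_image_sub_le_of_norm_hasFDerivWithin_le' (f := G)
      (f' := fderiv ℝ G) (φ := fderiv ℝ G y) (C := K * ‖z - y‖)
      (fun x hx => (hb x (hs hx)).2.1.hasFDerivAt.hasFDerivWithinAt) (fun x hx => ?_)
      (left_mem_segment ℝ y z) (right_mem_segment ℝ y z)
    · calc _ ≤ K * ‖z - y‖ * ‖z - y‖ := this
        _ = K * ‖z - y‖ ^ 2 := by ring
    · have h1 := hlip.dist_le_mul x (hb x (hs hx)).2.2 y (hb y hy).2.2
      rw [dist_eq_norm, dist_eq_norm] at h1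
      have h2 : ‖x - y‖ ≤ ‖z - y‖ := by
        obtain ⟨θ, ⟨hθ0, hθ1⟩, rfl⟩ := (segment_eq_image' ℝ y z ▸ hx)
        rw [add_sub_cancel_left, norm_smul, Real.norm_eq_abs, abs_of_nonneg hθ0]
        exact mul_le_of_le_one_left (norm_nonneg _) hθ1
      exact h1.trans (mul_le_mul (le_max_right _ _) h2 (norm_nonneg _) pK.le)

/-- Uniform form of the fact that a causal vector is not orthogonal to a timelike one. -/
lemma exists_cone_bound {E : Type*} [NormedAddCommGroup E] [NormedSpace ℝ E]
    [FiniteDimensional ℝ E] {G : E → E →L[ℝ] E →L[ℝ] ℝ} {y₀ T : E} (hG : ContinuousAt G y₀)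
    (hL : IsLorentz (G y₀)) (hT : G y₀ T T < 0) :
    ∃ r > 0, ∃ κ > 0, ∀ y ∈ Metric.ball y₀ r, ∀ v, G y v v ≤ 0 → κ * ‖v‖ ≤ |G y T v| := by
  have : ProperSpace E := FiniteDimensional.proper_real E
  -- on the unit sphere the maximum of `G(v, v)` and `|G(T, v)|` is bounded below
  have hpos : ∀ v : E, v ≠ 0 → 0 < max (G y₀ v v) |G y₀ T v| := by
    intro v hv
    by_cases h : G y₀ T v = 0
    · exact lt_max_of_lt_left (hL.pos_of_orthogonal hT hv h)
    · exact lt_max_of_lt_right (abs_pos.2 h)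
  have hκ : ∃ κ > 0, ∀ v : E, ‖v‖ = 1 → 2 * κ ≤ max (G y₀ v v) |G y₀ T v| := by
    rcases (Metric.sphere (0 : E) 1).eq_empty_or_nonempty with h | h
    · refine ⟨1, one_pos, fun v hv => ?_⟩
      have : v ∈ Metric.sphere (0 : E) 1 := by simpa using hv
      rw [h] at this
      exact this.elim
    · obtain ⟨w, hw, hmin⟩ := (isCompact_sphere (0 : E) 1).exists_isMinOn h
        (f := fun v => max (G y₀ v v) |G y₀ T v|) (by
          refine Continuous.continuousOn ?_
          exact ((G y₀).continuous.clm_apply continuous_id).max (G y₀ T).continuous.abs)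
      have hw0 : w ≠ 0 := by rintro rfl; simp at hw
      refine ⟨max (G y₀ w w) |G y₀ T w| / 2, by have := hpos w hw0; positivity, fun v hv => ?_⟩
      have := hmin (show v ∈ Metric.sphere (0 : E) 1 by simpa using hv)
      simp only [mem_ofPred_eq] at this
      linarith
  obtain ⟨κ, pκ, hκ⟩ := hκ
  set δ := κ / (1 + ‖T‖) with hδ
  have pδ : 0 < δ := by positivity
  obtain ⟨r, hr, hb⟩ := Metric.continuousAt_iff.1 hG δ pδ
  refine ⟨r, hr, κ, pκ, fun y hy v hv => ?_⟩
  by_cases hv0 : v = 0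
  · simp [hv0]
  have hn : 0 < ‖v‖ := norm_pos_iff.2 hv0
  have hGy : ‖G y - G y₀‖ ≤ δ := by rw [← dist_eq_norm]; exact (hb hy).le
  have hdiff : ∀ u : E, |G y u v - G y₀ u v| ≤ δ * ‖u‖ * ‖v‖ := by
    intro u
    have := (G y - G y₀).le_opNorm₂ u v
    rw [Real.norm_eq_abs] at this
    exact this.trans (by gcongr)
  have h1 := hκ (‖v‖⁻¹ • v) (by rw [norm_smul, norm_inv, norm_norm, inv_mul_cancel₀ hn.ne'])
  simp only [map_smul, smul_apply, smul_eq_mul, abs_mul, abs_inv, abs_norm] at h1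
  have d1 := (abs_le.1 (hdiff v)).1
  have d2 := hdiff T
  have hδ1 : δ ≤ κ := div_le_self pκ.le (by linarith [norm_nonneg T])
  have hδ2 : δ * ‖T‖ ≤ κ := by
    rw [hδ, div_mul_eq_mul_div, div_le_iff₀ (by positivity)]
    nlinarith [norm_nonneg T]
  rcases le_max_iff.1 h1 with h | h
  · exfalso
    rw [← div_eq_inv_mul, ← div_eq_inv_mul, le_div_iff₀ hn, le_div_iff₀ hn] at h
    have h3 : δ * (‖v‖ * ‖v‖) ≤ κ * (‖v‖ * ‖v‖) := by gcongr
    have h4 : 0 < κ * (‖v‖ * ‖v‖) := by positivity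
    linarith
  · rw [← div_eq_inv_mul, le_div_iff₀ hn] at h
    have h3 : |G y₀ T v| ≤ |G y T v| + δ * ‖T‖ * ‖v‖ := by
      have := abs_sub_abs_le_abs_sub (G y₀ T v) (G y T v)
      rw [abs_sub_comm] at this
      linarith
    nlinarith

variable {n : ℕ} {M : Type*} [TopologicalSpace M] [ChartedSpace (Coord n) M]
  [IsManifold 𝓘(ℝ, Coord n) 4 M] {S : Spacetime n M} {H : Set M}

lemma Spacetime.AchronalIn.mono {U U' : Set M} (h : S.AchronalIn H U) (hU : U' ⊆ U) :
    S.AchronalIn H U' := by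
  intro p hp q hq hpq
  refine h p ⟨hp.1, hU hp.2⟩ q ⟨hq.1, hU hq.2⟩
    (Relation.TransGen.mono (p := S.TimelikeStep U) ?_ _ _ hpq)
  rintro a b ⟨γ, h1, h2, h3, h4⟩
  exact ⟨γ, h1, h2, h3, fun t ht => ⟨hU (h4 t ht).1, (h4 t ht).2⟩⟩

lemma Spacetime.FutureTimelike.smul {x : M} {v : TangentSpace 𝓘(ℝ, Coord n) x} {k : ℝ}
    (hk : 0 < k) (h : S.FutureTimelike x v) : S.FutureTimelike x (k • v) := by
  obtain ⟨h1, h2⟩ := h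
  constructor
  · simp only [map_smul, smul_apply, smul_eq_mul]
    exact mul_neg_of_pos_of_neg hk (mul_neg_of_pos_of_neg hk h1)
  · simp only [map_smul, smul_apply, smul_eq_mul]
    exact mul_neg_of_pos_of_neg hk h2

variable {e : OpenPartialHomeomorph M (Coord n)}

/-- In a chart with future-directed `∂₀`, the vector `∂₀` can be used to test the time orientation
of causal vectors. -/
lemma chartG_e₀_neg_iff (he : e ∈ IsManifold.maximalAtlas 𝓘(ℝ, Coord n) 4 M) {y : Coord n}
    (hy : y ∈ e.target) (hT : S.FutureTimelike (e.symm y) (chartD e y (e₀ n))) {v : Coord n}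
    (hv : chartG S e y v v ≤ 0) :
    chartG S e y (e₀ n) v < 0 ↔ S.g (e.symm y) (chartD e y v) (S.V (e.symm y)) < 0 := by
  rw [(isLorentz_chartG S he hy).1]
  exact (isLorentz_g S (e.symm y)).neg_iff_neg hT.1 (S.timelike_V _) hT.2 hv

lemma contDiffOn_of_c1Curve {E : Type*} [NormedAddCommGroup E] [NormedSpace ℝ E] {c v : ℝ → E}
    {a b : ℝ} (h : C1Curve c v a b) : ContDiffOn ℝ 1 c (Icc a b) := by
  intro t ht
  refine contDiffWithinAt_succ_of_hasDerivWithinAt (k := 0) ht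
    (eventually_nhdsWithin_of_forall h.1) ?_
  exact (contDiffOn_zero.2 h.2) t ht

/-- A timelike curve in a chart gives a timelike curve in the manifold. -/
lemma timelikeStep_of_c1Curve (he : e ∈ IsManifold.maximalAtlas 𝓘(ℝ, Coord n) 4 M) {U : Set M}
    {c v : ℝ → Coord n} {a b : ℝ} (hab : a < b) (hc : C1Curve c v a b)
    (hT : ∀ t ∈ Icc a b, c t ∈ e.target ∧ e.symm (c t) ∈ U ∧
      S.FutureTimelike (e.symm (c t)) (chartD e (c t) (e₀ n)) ∧
      chartG S e (c t) (v t) (v t) < 0 ∧ chartG S e (c t) (e₀ n) (v t) < 0) :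
    S.TimelikeStep U (e.symm (c a)) (e.symm (c b)) := by
  have hk : 0 < b - a := sub_pos.2 hab
  have hmaps : MapsTo (fun τ => (b - a) * τ + a) (Icc 0 1) (Icc a b) := by
    intro τ hτ
    constructor
    · nlinarith [hτ.1]
    · nlinarith [hτ.2]
  have hcomp : ContDiffOn ℝ 1 (fun τ => c ((b - a) * τ + a)) (Icc 0 1) :=
    (contDiffOn_of_c1Curve hc).comp (by fun_prop) hmaps
  have hsm : ContMDiffOn 𝓘(ℝ, ℝ) 𝓘(ℝ, Coord n) 1 (fun τ => e.symm (c ((b - a) * τ + a)))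
      (Icc 0 1) :=
    ((contMDiffOn_symm_of_mem_maximalAtlas he).of_le (by norm_cast)).comp hcomp.contMDiffOn
      fun τ hτ => (hT _ (hmaps hτ)).1
  refine ⟨_, hsm, by simp, by simp, fun τ hτ => ?_⟩
  obtain ⟨h1, h2, h3, h4, h5⟩ := hT _ (hmaps hτ)
  refine ⟨h2, ?_⟩
  have hd : HasDerivWithinAt (fun τ => c ((b - a) * τ + a)) ((b - a) • v ((b - a) * τ + a))
      (Icc 0 1) τ := by
    have h6 : HasDerivWithinAt (fun τ => (b - a) * τ + a) (b - a) (Icc 0 1) τ := by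
      have := ((hasDerivAt_id τ).const_mul (b - a)).add_const a
      simpa using this.hasDerivWithinAt
    exact (hc.1 _ (hmaps hτ)).scomp τ h6 hmaps
  have hd' : HasDerivWithinAt (fun τ => e (e.symm (c ((b - a) * τ + a))))
      ((b - a) • v ((b - a) * τ + a)) (Icc 0 1) τ :=
    hd.congr (fun x hx => e.right_inv (hT _ (hmaps hx)).1) (e.right_inv h1)
  rw [velocity_eq he (uniqueDiffOn_Icc zero_lt_one τ hτ) (hsm.continuousOn τ hτ)
    (e.map_target h1) hd', e.right_inv h1, map_smul]
  have h6 := (chartG_e₀_neg_iff he h1 h3 h4.le).1 h5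
  exact Spacetime.FutureTimelike.smul hk ⟨h4, h6⟩

lemma mem_iff_of_isGraphChart {p : M} {Ω : Set (Space n)} {h : Space n → ℝ}
    (hg : S.IsGraphChart H p e Ω h) {y : Coord n} (hy : y ∈ e.target) (hΩ : spatial y ∈ Ω) :
    e.symm y ∈ H ↔ y 0 - h (spatial y) = 0 := by
  have himg := hg.2.2.2.2.2
  constructor
  · intro hH
    have : y ∈ e '' (H ∩ e.source) := ⟨e.symm y, ⟨hH, e.map_target hy⟩, e.right_inv hy⟩
    rw [himg] at this
    rw [this.2, sub_self]
  · intro h0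
    have : y ∈ e '' (H ∩ e.source) := by
      rw [himg]; exact ⟨hΩ, by linarith⟩
    obtain ⟨x, ⟨hx1, hx2⟩, rfl⟩ := this
    rwa [e.left_inv hx2]

/-- A horizon near one of its points, seen in a graph chart. The ball is so small that the vertical
segments from its points to the graph stay in the domain of the chart. -/
lemma exists_achronalGraph {p : M} {Ω : Set (Space n)} {h : Space n → ℝ}
    (hg : S.IsGraphChart H p e Ω h) (hpH : p ∈ H) {U : Set M} (hU : IsOpen U) (hpU : p ∈ U)
    (hach : S.AchronalIn H U) :
    ∃ A : AchronalGraph (Coord n), A.ctr = e p ∧ A.e₀ = e₀ n ∧ A.G = chartG S e ∧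
      (∀ y, A.height y = y 0 - h (spatial y)) ∧
      ∀ y ∈ A.ball, y ∈ e.target ∧ spatial y ∈ Ω ∧ e.symm y ∈ U := by
  obtain ⟨he, hps, hT, hΩ, hh, himg⟩ := id hg
  have hept : e p ∈ e.target := e.map_source hps
  obtain ⟨hpΩ, hp0⟩ : spatial (e p) ∈ Ω ∧ e p 0 = h (spatial (e p)) := by
    have : e p ∈ e '' (H ∩ e.source) := ⟨p, ⟨hpH, hps⟩, rfl⟩
    rwa [himg] at this
  set W : Set (Coord n) := (e.target ∩ e.symm ⁻¹' U) ∩ spatial ⁻¹' Ω with hW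
  have hWo : IsOpen W := (e.isOpen_inter_preimage_symm hU).inter (hΩ.preimage continuous_spatial)
  have hWp : e p ∈ W := ⟨⟨hept, by rwa [mem_preimage, e.left_inv hps]⟩, hpΩ⟩
  obtain ⟨R, hR, hRW⟩ := Metric.isOpen_iff.1 hWo _ hWp
  set ht : Coord n → ℝ := fun y => y 0 - h (spatial y) with hht
  have hcont : ContinuousOn ht (Metric.ball (e p) R) :=
    continuous_zero_coord.continuousOn.sub (hh.comp continuous_spatial.continuousOn
      fun y hy => (hRW hy).2)
  have hadd : ∀ y (s : ℝ), ht (y + s • e₀ n) = ht y + s := fun y s => by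
    simp only [hht, spatial_add_smul_e₀]; simp; ring
  have hev : ∀ᶠ y in 𝓝 (e p), |ht y| < R / 2 := by
    have h1 := (hcont.continuousAt (Metric.ball_mem_nhds _ hR)).abs
    have h2 : ht (e p) = 0 := by simp [hht, hp0]
    rw [ContinuousAt, h2, abs_zero] at h1
    exact h1.eventually_lt_const (by positivity)
  obtain ⟨r₀, hr₀, hb₀⟩ := Metric.eventually_nhds_iff_ball.1 hev
  have hGs : ∀ y ∈ e.target, ContDiffAt ℝ 2 (chartG S e) y := fun y hy =>
    ((contDiffOn_chartG S he).contDiffAt (e.open_target.mem_nhds hy)).of_le (by norm_cast)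
  obtain ⟨r₁, hr₁, K, hK, k1, k2, k3, k4⟩ := exists_taylor_bounds (hGs _ hept)
  obtain ⟨r₂, hr₂, κ, hκ, hcone⟩ := exists_cone_bound (hGs _ hept).continuousAt
    (isLorentz_chartG S he hept) (T := e₀ n) (hT _ hept).1
  set r := min (min r₀ (R / 2)) (min r₁ r₂) with hr
  have pr : 0 < r := by positivity
  have s0 : Metric.ball (e p) r ⊆ Metric.ball (e p) r₀ :=
    Metric.ball_subset_ball ((min_le_left _ _).trans (min_le_left _ _))
  have s1 : Metric.ball (e p) r ⊆ Metric.ball (e p) r₁ :=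
    Metric.ball_subset_ball ((min_le_right _ _).trans (min_le_left _ _))
  have s2 : Metric.ball (e p) r ⊆ Metric.ball (e p) r₂ :=
    Metric.ball_subset_ball ((min_le_right _ _).trans (min_le_right _ _))
  have hrR : r ≤ R / 2 := (min_le_left _ _).trans (min_le_right _ _)
  have s3 : Metric.ball (e p) r ⊆ Metric.ball (e p) R := Metric.ball_subset_ball (by linarith)
  have foot : ∀ y ∈ Metric.ball (e p) r, y + (-ht y) • e₀ n ∈ Metric.ball (e p) R := by
    intro y hy
    have h1 := hb₀ y (s0 hy)
    rw [mem_ball_iff_norm] at hy ⊢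
    calc ‖y + (-ht y) • e₀ n - e p‖ = ‖(y - e p) + (-ht y) • e₀ n‖ := by congr 1; abel
      _ ≤ ‖y - e p‖ + ‖(-ht y) • e₀ n‖ := norm_add_le _ _
      _ < R / 2 + R / 2 := by
        rw [norm_smul, norm_e₀, mul_one, norm_neg, Real.norm_eq_abs]
        linarith
      _ = R := by ring
  have step : ∀ (c v : ℝ → Coord n) (a b : ℝ), a < b → C1Curve c v a b →
      (∀ t ∈ Icc a b, c t ∈ Metric.ball (e p) R ∧ chartG S e (c t) (v t) (v t) < 0 ∧
        chartG S e (c t) (e₀ n) (v t) < 0) → S.TimelikeStep U (e.symm (c a)) (e.symm (c b)) := by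
    intro c v a b hab hc hcau
    refine timelikeStep_of_c1Curve he hab hc fun t ht => ?_
    obtain ⟨h1, h2, h3⟩ := hcau t ht
    obtain ⟨⟨h4, h5⟩, -⟩ := hRW h1
    exact ⟨h4, h5, hT _ h4, h2, h3⟩
  have vert : ∀ y ∈ Metric.ball (e p) R, ∀ s : ℝ, 0 < s → y + s • e₀ n ∈ Metric.ball (e p) R →
      S.TimelikeStep U (e.symm y) (e.symm (y + s • e₀ n)) := by
    intro y hy s hs hys
    have := step (fun t => y + t • e₀ n) (fun _ => e₀ n) 0 s hs ⟨fun t ht => ?_, continuousOn_const⟩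
      fun t ht => ?_
    · simpa using this
    · have := ((hasDerivAt_id t).smul_const (e₀ n)).const_add y
      simpa using this.hasDerivWithinAt
    · have hm : y + t • e₀ n ∈ Metric.ball (e p) R := by
        have h1 := (convex_ball (e p) R).add_smul_mem hy hys
          (t := t / s) ⟨div_nonneg ht.1 hs.le, div_le_one_of_le₀ ht.2 hs.le⟩
        rwa [smul_smul, div_mul_cancel₀ _ hs.ne'] at h1
      have := (hT _ (hRW hm).1.1).1
      exact ⟨hm, this, this⟩
  have memH : ∀ y ∈ Metric.ball (e p) R, ht y = 0 → e.symm y ∈ H ∩ U := by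
    intro y hy hy0
    obtain ⟨⟨h4, h5⟩, h6⟩ := hRW hy
    exact ⟨(mem_iff_of_isGraphChart hg h4 h6).2 hy0, h5⟩
  -- a timelike curve from above the graph to below it could be prolonged by vertical segments to
  -- a timelike curve between points of the graph
  have ach : ∀ (c v : ℝ → Coord n) (a b : ℝ), a < b → C1Curve c v a b →
      (∀ t ∈ Icc a b, c t ∈ Metric.ball (e p) r ∧ chartG S e (c t) (v t) (v t) < 0 ∧
        chartG S e (c t) (e₀ n) (v t) < 0) → 0 ≤ ht (c a) → 0 < ht (c b) := by
    intro c v a b hab hc hcau h0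
    by_contra! h1
    have ma := (hcau a (left_mem_Icc.2 hab.le)).1
    have mb := (hcau b (right_mem_Icc.2 hab.le)).1
    have hmid : S.ChronRel U (e.symm (c a)) (e.symm (c b)) :=
      Relation.TransGen.single (step c v a b hab hc fun t ht => ⟨s3 (hcau t ht).1, (hcau t ht).2⟩)
    have za : ht (c a + (-ht (c a)) • e₀ n) = 0 := by rw [hadd]; ring
    have zb : ht (c b + (-ht (c b)) • e₀ n) = 0 := by rw [hadd]; ring
    have start : S.ChronRel U (e.symm (c a + (-ht (c a)) • e₀ n)) (e.symm (c b)) := by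
      rcases h0.eq_or_lt with h2 | h2
      · rw [← h2]; simpa using hmid
      · have := vert _ (foot _ ma) (ht (c a)) h2
        rw [add_assoc, ← add_smul, neg_add_cancel, zero_smul, add_zero] at this
        exact Relation.TransGen.head (this (s3 ma)) hmid
    have fin : S.ChronRel U (e.symm (c a + (-ht (c a)) • e₀ n))
        (e.symm (c b + (-ht (c b)) • e₀ n)) := by
      rcases h1.eq_or_lt with h2 | h2
      · rw [h2]; simpa using start
      · exact Relation.TransGen.tail start (vert _ (s3 mb) _ (by linarith) (foot _ mb))
    exact hach _ (memH _ (foot _ ma) za) _ (memH _ (foot _ mb) zb) fin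
  refine ⟨
    { e₀ := e₀ n
      norm_e₀ := norm_e₀ n
      ctr := e p
      r := r
      r_pos := pr
      G := chartG S e
      height := ht
      K := K
      κ := κ
      K_pos := hK
      κ_pos := hκ
      symm := fun y hy => (isLorentz_chartG S he (hRW (s3 hy)).1.1).1
      smooth := fun y hy => hGs y (hRW (s3 hy)).1.1
      bound := fun y hy => k1 y (s1 hy)
      bound' := fun y hy => k2 y (s1 hy)
      lip := fun y hy z hz => k3 y (s1 hy) z (s1 hz)
      taylor := fun y hy z hz => k4 y (s1 hy) z (s1 hz)
      cone := fun y hy => hcone y (s2 hy)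
      continuousOn_height := hcont.mono s3
      height_add := hadd
      achronal := ?_ }, rfl, rfl, rfl, fun _ => rfl, fun y hy =>
        ⟨(hRW (s3 hy)).1.1, (hRW (s3 hy)).2, (hRW (s3 hy)).1.2⟩⟩
  rintro σ c v a b (rfl | rfl) hab hc hcau h0
  · simp only [one_mul] at *
    exact ach c v a b hab hc hcau h0
  · -- reversing a past-directed curve makes it future-directed
    by_contra! h1
    have hm : MapsTo (fun t => a + b - t) (Icc a b) (Icc a b) := fun t ht =>
      ⟨by linarith [ht.2], by linarith [ht.1]⟩
    have hc' : C1Curve (fun t => c (a + b - t)) (fun t => -v (a + b - t)) a b := by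
      refine ⟨fun t ht => ?_, (hc.2.comp (by fun_prop) hm).neg⟩
      have h6 : HasDerivWithinAt (fun t => a + b - t) (-1) (Icc a b) t := by
        simpa using ((hasDerivAt_id t).const_sub (a + b)).hasDerivWithinAt
      exact ((hc.1 _ (hm ht)).scomp t h6 hm).congr_deriv (by simp)
    have := ach _ _ a b hab hc' (fun t ht => ?_) (by
      rw [add_sub_cancel_left]; linarith)
    · rw [add_sub_cancel_right] at this; linarith
    · obtain ⟨h2, h3, h4⟩ := hcau _ (hm ht)
      refine ⟨h2, by simpa using h3, ?_⟩
      rw [map_neg]; linarith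

end NullHorizon

namespace NullHorizon

/-! ### Existence of graph charts -/

section ImplicitFunction

variable {X : Type*} [TopologicalSpace X] {f : ℝ × X → ℝ} {l u : ℝ} {N : Set X}

/-- If a function has at most one zero on each vertical line and takes negative values arbitrarily
near one of its zeros, it cannot be positive at both ends of the vertical line through that
zero. -/
lemma not_pos_and_pos {t₀ : ℝ} {x₀ : X} (hN : IsOpen N) (hx₀ : x₀ ∈ N) (ht₀ : t₀ ∈ Ioo l u)
    (hf : ContinuousOn f (Icc l u ×ˢ N))
    (huniq : ∀ x ∈ N, ∀ s ∈ Icc l u, ∀ t ∈ Icc l u, f (s, x) = 0 → f (t, x) = 0 → s = t)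
    (hneg : ∃ᶠ q in 𝓝 (t₀, x₀), f q < 0) : ¬ (0 < f (l, x₀) ∧ 0 < f (u, x₀)) := by
  rintro ⟨h1, h2⟩
  have hlu : l ≤ u := (ht₀.1.trans ht₀.2).le
  have hc : ∀ t ∈ Icc l u, ContinuousAt (fun x => f (t, x)) x₀ := fun t ht =>
    (hf.comp (by fun_prop : ContinuousOn (fun x => (t, x)) N) fun x hx => ⟨ht, hx⟩).continuousAt
      (hN.mem_nhds hx₀)
  have e1 := ((hc l (left_mem_Icc.2 hlu)).eventually_const_lt h1).and
    ((hc u (right_mem_Icc.2 hlu)).eventually_const_lt h2)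
  have e2 : ∀ᶠ q in 𝓝 (t₀, x₀), q.1 ∈ Ioo l u ∧ q.2 ∈ N ∧ 0 < f (l, q.2) ∧ 0 < f (u, q.2) :=
    Filter.Eventually.and (continuous_fst.tendsto (t₀, x₀) (Ioo_mem_nhds ht₀.1 ht₀.2))
      (Filter.Eventually.and (continuous_snd.tendsto (t₀, x₀) (hN.mem_nhds hx₀))
        ((continuous_snd.tendsto (t₀, x₀)).eventually e1))
  obtain ⟨⟨t, x⟩, h3, h4, h5, h6, h7⟩ := (hneg.and_eventually e2).exists
  simp only at h3 h4 h5 h6 h7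
  have hline : ContinuousOn (fun s => f (s, x)) (Icc l u) :=
    hf.comp (by fun_prop) fun s hs => ⟨hs, h5⟩
  obtain ⟨s₁, hs₁, z₁⟩ := intermediate_value_Icc' h4.1.le
    (hline.mono (Icc_subset_Icc_right h4.2.le)) ⟨h3.le, h6.le⟩
  obtain ⟨s₂, hs₂, z₂⟩ := intermediate_value_Icc h4.2.le
    (hline.mono (Icc_subset_Icc_left h4.1.le)) ⟨h3.le, h7.le⟩
  have := huniq x h5 s₁ ⟨hs₁.1, hs₁.2.trans h4.2.le⟩ s₂ ⟨h4.1.le.trans hs₂.1, hs₂.2⟩ z₁ z₂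
  have h8 : s₁ = t := le_antisymm hs₁.2 (this ▸ hs₂.1)
  simp only at z₁
  rw [h8] at z₁
  linarith

/-- A continuous function with exactly one zero on each vertical line, changing sign there: the
zeros form a continuous graph. -/
lemma exists_continuous_graph_of_neg_pos {x₀ : X} (hlu : l ≤ u) (hN : IsOpen N) (hx₀ : x₀ ∈ N)
    (hf : ContinuousOn f (Icc l u ×ˢ N))
    (huniq : ∀ x ∈ N, ∀ s ∈ Icc l u, ∀ t ∈ Icc l u, f (s, x) = 0 → f (t, x) = 0 → s = t)
    (hl : f (l, x₀) < 0) (hu : 0 < f (u, x₀)) :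
    ∃ N' ⊆ N, IsOpen N' ∧ x₀ ∈ N' ∧ ∃ h : X → ℝ, ContinuousOn h N' ∧
      ∀ x ∈ N', h x ∈ Ioo l u ∧ f (h x, x) = 0 := by
  have hc : ∀ t ∈ Icc l u, ∀ x ∈ N, ContinuousAt (fun x => f (t, x)) x := fun t ht x hx =>
    (hf.comp (by fun_prop : ContinuousOn (fun x => (t, x)) N) fun x hx => ⟨ht, hx⟩).continuousAt
      (hN.mem_nhds hx)
  have ml := left_mem_Icc.2 hlu
  have mu := right_mem_Icc.2 hlu
  have hev : ∀ᶠ x in 𝓝 x₀, x ∈ N ∧ f (l, x) < 0 ∧ 0 < f (u, x) :=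
    Filter.Eventually.and (hN.mem_nhds hx₀) (((hc l ml x₀ hx₀).eventually_lt_const hl).and
      ((hc u mu x₀ hx₀).eventually_const_lt hu))
  obtain ⟨N', hN', hN'o, hxN'⟩ := eventually_nhds_iff.1 hev
  have hline : ∀ x ∈ N', ContinuousOn (fun s => f (s, x)) (Icc l u) := fun x hx =>
    hf.comp (by fun_prop) fun s hs => ⟨hs, (hN' x hx).1⟩
  have hz : ∀ x, ∃ t, x ∈ N' → t ∈ Ioo l u ∧ f (t, x) = 0 := by
    intro x
    by_cases hx : x ∈ N'
    · obtain ⟨h1, h2, h3⟩ := hN' x hx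
      obtain ⟨t, ht, h0⟩ := intermediate_value_Icc hlu (hline x hx) ⟨h2.le, h3.le⟩
      simp only at h0
      refine ⟨t, fun _ => ⟨⟨lt_of_le_of_ne ht.1 ?_, lt_of_le_of_ne ht.2 ?_⟩, h0⟩⟩
      · rintro rfl; linarith
      · rintro rfl; linarith
    · exact ⟨0, fun h => absurd h hx⟩
  choose h hh using hz
  have below : ∀ x ∈ N', ∀ t ∈ Icc l u, t < h x → f (t, x) < 0 := by
    intro x hx t ht hlt
    by_contra! hge
    obtain ⟨h1, h2, h3⟩ := hN' x hx
    obtain ⟨s, hs, h0⟩ := intermediate_value_Icc ht.1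
      ((hline x hx).mono (Icc_subset_Icc_right ht.2)) ⟨h2.le, hge⟩
    have := huniq x h1 s ⟨hs.1, hs.2.trans ht.2⟩ (h x) (Ioo_subset_Icc_self (hh x hx).1) h0
      (hh x hx).2
    linarith [hs.2]
  have above : ∀ x ∈ N', ∀ t ∈ Icc l u, h x < t → 0 < f (t, x) := by
    intro x hx t ht hlt
    by_contra! hge
    obtain ⟨h1, h2, h3⟩ := hN' x hx
    obtain ⟨s, hs, h0⟩ := intermediate_value_Icc ht.2
      ((hline x hx).mono (Icc_subset_Icc_left ht.1)) ⟨hge, h3.le⟩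
    have := huniq x h1 s ⟨ht.1.trans hs.1, hs.2⟩ (h x) (Ioo_subset_Icc_self (hh x hx).1) h0
      (hh x hx).2
    linarith [hs.1]
  refine ⟨N', fun x hx => (hN' x hx).1, hN'o, hxN', h, fun x hx => ?_, fun x hx => hh x hx⟩
  obtain ⟨hm, h0⟩ := hh x hx
  refine ContinuousAt.continuousWithinAt (tendsto_order.2 ⟨fun a ha => ?_, fun b hb => ?_⟩)
  · obtain ⟨t, ht1, ht2⟩ := exists_between (max_lt ha hm.1)
    have htm : t ∈ Icc l u := ⟨((le_max_right _ _).trans_lt ht1).le, (ht2.trans hm.2).le⟩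
    filter_upwards [(hc t htm x (hN' x hx).1).eventually_lt_const (below x hx t htm ht2),
      hN'o.mem_nhds hx] with z hz hzN
    by_contra! hle
    have hlt : h z < t := hle.trans_lt ((le_max_left _ _).trans_lt ht1)
    exact lt_asymm hz (above z hzN t htm hlt)
  · obtain ⟨t, ht1, ht2⟩ := exists_between (lt_min hb hm.2)
    have htm : t ∈ Icc l u := ⟨(hm.1.trans ht1).le, (ht2.trans_le (min_le_right _ _)).le⟩
    filter_upwards [(hc t htm x (hN' x hx).1).eventually_const_lt (above x hx t htm ht1),
      hN'o.mem_nhds hx] with z hz hzN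
    by_contra! hle
    have hlt : t < h z := (ht2.trans_le (min_le_left _ _)).trans_le hle
    exact lt_asymm hz (below z hzN t htm hlt)

/-- A continuous function with at most one zero on each vertical line, which takes both signs
arbitrarily near one of its zeros: near that vertical line, the zeros form a continuous graph. -/
lemma exists_continuous_graph {t₀ : ℝ} {x₀ : X} (hN : IsOpen N) (hx₀ : x₀ ∈ N)
    (ht₀ : t₀ ∈ Ioo l u) (hf : ContinuousOn f (Icc l u ×ˢ N))
    (huniq : ∀ x ∈ N, ∀ s ∈ Icc l u, ∀ t ∈ Icc l u, f (s, x) = 0 → f (t, x) = 0 → s = t)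
    (h0 : f (t₀, x₀) = 0) (hneg : ∃ᶠ q in 𝓝 (t₀, x₀), f q < 0)
    (hpos : ∃ᶠ q in 𝓝 (t₀, x₀), 0 < f q) :
    ∃ N' ⊆ N, IsOpen N' ∧ x₀ ∈ N' ∧ ∃ h : X → ℝ, ContinuousOn h N' ∧
      ∀ x ∈ N', h x ∈ Ioo l u ∧ f (h x, x) = 0 := by
  have hlu : l ≤ u := (ht₀.1.trans ht₀.2).le
  have mt := Ioo_subset_Icc_self ht₀
  have nl : f (l, x₀) ≠ 0 := fun h =>
    ht₀.1.ne (huniq x₀ hx₀ _ (left_mem_Icc.2 hlu) _ mt h h0)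
  have nu : f (u, x₀) ≠ 0 := fun h =>
    ht₀.2.ne' (huniq x₀ hx₀ _ (right_mem_Icc.2 hlu) _ mt h h0)
  have huniq' : ∀ x ∈ N, ∀ s ∈ Icc l u, ∀ t ∈ Icc l u, -f (s, x) = 0 → -f (t, x) = 0 → s = t :=
    fun x hx s hs t ht h1 h2 => huniq x hx s hs t ht (neg_eq_zero.1 h1) (neg_eq_zero.1 h2)
  have p1 := not_pos_and_pos hN hx₀ ht₀ hf huniq hneg
  have p2 := not_pos_and_pos hN hx₀ ht₀ hf.neg huniq' (hpos.mono fun q hq => by simpa using hq)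
  simp only [Pi.neg_apply, Left.neg_pos_iff] at p2
  rcases nl.lt_or_gt with hl | hl
  · have hu : 0 < f (u, x₀) := nu.lt_or_gt.resolve_left fun h => p2 ⟨hl, h⟩
    exact exists_continuous_graph_of_neg_pos hlu hN hx₀ hf huniq hl hu
  · have hu : f (u, x₀) < 0 := nu.lt_or_gt.resolve_right fun h => p1 ⟨hl, h⟩
    obtain ⟨N', h1, h2, h3, h, h4, h5⟩ := exists_continuous_graph_of_neg_pos (f := fun q => -f q)
      hlu hN hx₀ hf.neg huniq' (by simpa using hl) (by simpa using hu)
    exact ⟨N', h1, h2, h3, h, h4, fun x hx => ⟨(h5 x hx).1, neg_eq_zero.1 (h5 x hx).2⟩⟩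

end ImplicitFunction

variable {n : ℕ} {M : Type*} [TopologicalSpace M] [ChartedSpace (Coord n) M]
  [IsManifold 𝓘(ℝ, Coord n) 4 M] {S : Spacetime n M} {H : Set M}

/-- Around each point there is a chart whose vector `∂₀` is future-directed timelike at that
point. -/
lemma exists_chart_futureTimelike (S : Spacetime n M) (p : M) :
    ∃ e ∈ IsManifold.maximalAtlas 𝓘(ℝ, Coord n) 4 M, p ∈ e.source ∧
      S.FutureTimelike (e.symm (e p)) (chartD e (e p) (e₀ n)) := by
  set e₁ := chartAt (Coord n) p with he₁
  have m₁ : e₁ ∈ IsManifold.maximalAtlas 𝓘(ℝ, Coord n) 4 M := IsManifold.chart_mem_maximalAtlas p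
  have hp : p ∈ e₁.source := mem_chart_source _ p
  obtain ⟨w, hw⟩ := (bijective_chartD m₁ (e₁.map_source hp)).2 (S.V (e₁.symm (e₁ p)))
  have hw0 : w ≠ 0 := by
    rintro rfl
    have := S.timelike_V (e₁.symm (e₁ p))
    rw [← hw, map_zero] at this
    have h0 : S.g (e₁.symm (e₁ p)) (0 : TangentSpace 𝓘(ℝ, Coord n) _) 0 = 0 := by simp
    exact this.ne h0
  -- a linear change of the coordinates takes the representative `w` of `S.V` to `e₀`
  obtain ⟨L, hL⟩ := SeparatingDual.exists_continuousLinearEquiv_apply_eq (R := ℝ) (V := Coord n)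
    hw0 (e₀_ne_zero n)
  set e₂ := e₁.trans L.toHomeomorph.toOpenPartialHomeomorph with he₂
  have hsrc : e₂.source = e₁.source := by simp [he₂]
  have m₂ : e₂ ∈ IsManifold.maximalAtlas 𝓘(ℝ, Coord n) 4 M := by
    refine OpenPartialHomeomorph.mem_maximalAtlas_of_contMDiffOn _ ?_ ?_
    · rw [hsrc]
      exact L.contDiff.contMDiff.comp_contMDiffOn (contMDiffOn_of_mem_maximalAtlas m₁)
    · refine (contMDiffOn_symm_of_mem_maximalAtlas m₁).comp
        (L.symm.contDiff.contMDiff.contMDiffOn) fun y hy => ?_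
      have : y ∈ e₂.target := hy
      simp only [he₂, OpenPartialHomeomorph.trans_target] at this
      exact this.2
  refine ⟨e₂, m₂, by rwa [hsrc], ?_⟩
  have hp2 : p ∈ e₂.source := by rwa [hsrc]
  have hy : e₂ p ∈ (e₂.symm.trans e₁).source := by
    rw [OpenPartialHomeomorph.trans_source]
    exact ⟨e₂.map_source hp2, by simpa [e₂.left_inv hp2] using hp⟩
  have hcomp : (e₁ ∘ e₂.symm) =ᶠ[𝓝 (e₂ p)] L.symm := by
    filter_upwards [e₂.open_target.mem_nhds (e₂.map_source hp2)] with z hz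
    simp only [he₂, OpenPartialHomeomorph.trans_target] at hz
    exact e₁.right_inv hz.2
  have hD := chartD_transition m₂ m₁ hy (e₀ n)
  rw [hcomp.fderiv_eq, ContinuousLinearEquiv.fderiv] at hD
  have h3 : L.symm (e₀ n) = w := by rw [← hL]; simp
  have h4 : chartD e₂ (e₂ p) (e₀ n) = chartD e₁ (e₁ p) w := by
    rw [hD, e₂.left_inv hp2]
    exact congrArg _ h3
  rw [h4, e₂.left_inv hp2]
  have key : ∀ x, x = p → S.FutureTimelike x (S.V x : Coord n) →
      ∀ z : Coord n, (S.V x : Coord n) = z → S.FutureTimelike p z := by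
    rintro x rfl h z rfl; exact h
  exact key _ (e₁.left_inv hp) ⟨S.timelike_V _, S.timelike_V _⟩ _ hw.symm

/-- A locally achronal hypersurface has graph charts. -/
lemma exists_isGraphChart (hH : IsTopologicalHypersurface n H) (ha : S.LocallyAchronal H) {p : M}
    (hp : p ∈ H) : ∃ e Ω h, S.IsGraphChart H p e Ω h := by
  obtain ⟨e, he, hps, hT⟩ := exists_chart_futureTimelike S p
  obtain ⟨U, hU, hpU, hach⟩ := ha p hp
  obtain ⟨f, hpf, hf⟩ := hH p hp
  have hept := e.map_source hps
  have hTev : ∀ᶠ y in 𝓝 (e p), S.FutureTimelike (e.symm y) (chartD e y (e₀ n)) := by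
    have c1 : ContinuousAt (fun y => chartG S e y (e₀ n) (e₀ n)) (e p) :=
      (((contDiffOn_chartG S he).continuousOn.clm_apply continuousOn_const).clm_apply
        continuousOn_const).continuousAt (e.open_target.mem_nhds hept)
    have c2 := (continuousOn_g_chartD_V S he (e₀ n)).continuousAt (e.open_target.mem_nhds hept)
    exact (c1.eventually_lt_const hT.1).and (c2.eventually_lt_const hT.2)
  obtain ⟨W₁, hW₁, hW₁o, hpW₁⟩ := eventually_nhds_iff.1 hTev
  set W := W₁ ∩ (e.target ∩ e.symm ⁻¹' (U ∩ f.source)) with hW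
  have hWo : IsOpen W := hW₁o.inter (e.isOpen_inter_preimage_symm (hU.inter f.open_source))
  have hpW : e p ∈ W := ⟨hpW₁, hept, by rw [mem_preimage, e.left_inv hps]; exact ⟨hpU, hpf⟩⟩
  -- the coordinates split into time and space
  set ψ : ℝ × Space n → Coord n := fun q => q.1 • e₀ n + emb n q.2 with hψ
  have cψ : Continuous ψ := by fun_prop
  have ψ0 : ∀ q, ψ q 0 = q.1 := fun q => by simp [hψ]
  have ψs : ∀ q, spatial (ψ q) = q.2 := fun q => by simp [hψ, spatial_add, spatial_smul]
  have ψinv : ∀ y, ψ (y 0, spatial y) = y := fun y => (eq_smul_e₀_add_emb y).symm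
  set q₀ : ℝ × Space n := (e p 0, spatial (e p)) with hq₀
  have hWψ : ψ ⁻¹' W ∈ 𝓝 (e p 0, spatial (e p)) :=
    (hWo.preimage cψ).mem_nhds (by rw [mem_preimage, ψinv]; exact hpW)
  obtain ⟨T, hTn, N₀, hN₀, hTN⟩ := mem_nhds_prod_iff.1 hWψ
  obtain ⟨δ, hδ, hδT⟩ := Metric.nhds_basis_closedBall.mem_iff.1 hTn
  obtain ⟨N, hNN₀, hNo, hpN⟩ := mem_nhds_iff.1 hN₀
  rw [Real.closedBall_eq_Icc] at hδT
  set l := e p 0 - δ with hl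
  set u := e p 0 + δ with hu
  have hbox : ∀ t ∈ Icc l u, ∀ x ∈ N, ψ (t, x) ∈ W := fun t ht x hx => hTN ⟨hδT ht, hNN₀ hx⟩
  -- the defining function of the hypersurface in the coordinates of `e`
  set F : ℝ × Space n → ℝ := fun q => f (e.symm (ψ q)) 0 with hF
  have hFH : ∀ q, ψ q ∈ W → (F q = 0 ↔ e.symm (ψ q) ∈ H) := fun q hq => (hf _ hq.2.2.2).symm
  have hFcont : ContinuousOn F (ψ ⁻¹' W) := by
    have h1 : ContinuousOn (fun q => f (e.symm (ψ q))) (ψ ⁻¹' W) :=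
      f.continuousOn.comp (e.continuousOn_symm.comp cψ.continuousOn fun q hq => hq.2.1)
        fun q hq => hq.2.2.2
    exact continuous_zero_coord.comp_continuousOn h1
  -- the vertical lines are timelike, so they meet the hypersurface at most once
  have hne : ∀ x ∈ N, ∀ s ∈ Icc l u, ∀ t ∈ Icc l u, s < t → F (s, x) = 0 → F (t, x) = 0 →
      False := by
    intro x hx s hs t ht hst h1 h2
    have hsH := (hFH _ (hbox s hs x hx)).1 h1
    have htH := (hFH _ (hbox t ht x hx)).1 h2
    have hmem : ∀ r ∈ Icc s t, ψ (r, x) ∈ W := fun r hr =>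
      hbox r ⟨hs.1.trans hr.1, hr.2.trans ht.2⟩ x hx
    refine hach _ ⟨hsH, (hbox s hs x hx).2.2.1⟩ _ ⟨htH, (hbox t ht x hx).2.2.1⟩
      (Relation.TransGen.single (timelikeStep_of_c1Curve he (c := fun r => ψ (r, x))
        (v := fun _ => e₀ n) hst ⟨fun r hr => ?_, continuousOn_const⟩ fun r hr => ?_))
    · have := ((hasDerivAt_id r).smul_const (e₀ n)).add_const (emb n x)
      rw [one_smul] at this
      exact this.hasDerivWithinAt
    · have hm := hmem r hr
      have h3 := hW₁ _ hm.1
      exact ⟨hm.2.1, hm.2.2.1, h3, h3.1, h3.1⟩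
  have huniq : ∀ x ∈ N, ∀ s ∈ Icc l u, ∀ t ∈ Icc l u, F (s, x) = 0 → F (t, x) = 0 → s = t := by
    intro x hx s hs t ht h1 h2
    rcases lt_trichotomy s t with h | h | h
    · exact (hne x hx s hs t ht h h1 h2).elim
    · exact h
    · exact (hne x hx t ht s hs h h2 h1).elim
  -- `F` takes both signs near the given point, since `f` is a local homeomorphism
  have hsign : ∀ σ : ℝ, σ ≠ 0 → ∃ᶠ q in 𝓝 (e p 0, spatial (e p)), 0 < σ * F q := by
    intro σ hσ
    -- points of the hypersurface chart on the chosen side of the hyperplane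
    have h0 : f p 0 = 0 := (hf p hpf).1 hp
    have ht : Tendsto (fun ε : ℝ => f p + (σ * ε) • e₀ n) (𝓝[>] 0) (𝓝 (f p)) := by
      have : Continuous fun ε : ℝ => f p + (σ * ε) • e₀ n := by fun_prop
      have h1 := this.tendsto 0
      simp only [mul_zero, zero_smul, add_zero] at h1
      exact h1.mono_left nhdsWithin_le_nhds
    have h2 : Tendsto (fun ε : ℝ => e (f.symm (f p + (σ * ε) • e₀ n))) (𝓝[>] 0) (𝓝 (e p)) := by
      have h3 := (f.continuousAt_symm (f.map_source hpf)).tendsto.comp ht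
      rw [f.left_inv hpf] at h3
      exact (e.continuousAt hps).tendsto.comp h3
    have h3 : Tendsto (fun y : Coord n => ((y 0, spatial y) : ℝ × Space n)) (𝓝 (e p))
        (𝓝 (e p 0, spatial (e p))) :=
      (continuous_zero_coord.prodMk continuous_spatial).tendsto _
    refine (h3.comp h2).frequently (Eventually.frequently ?_)
    have h4 : ∀ᶠ ε in 𝓝[>] (0 : ℝ), f p + (σ * ε) • e₀ n ∈ f.target :=
      ht (f.open_target.mem_nhds (f.map_source hpf))
    have h5 : ∀ᶠ ε in 𝓝[>] (0 : ℝ), f.symm (f p + (σ * ε) • e₀ n) ∈ e.source := by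
      have h3 := (f.continuousAt_symm (f.map_source hpf)).tendsto.comp ht
      rw [f.left_inv hpf] at h3
      exact h3 (e.open_source.mem_nhds hps)
    filter_upwards [h4, h5, self_mem_nhdsWithin] with ε k1 k2 k3
    simp only [Function.comp, hF]
    rw [ψinv, e.left_inv k2, f.right_inv k1]
    simp only [PiLp.add_apply, h0, PiLp.smul_apply, e₀_zero, smul_eq_mul, mul_one, zero_add]
    have : 0 < σ * σ := mul_self_pos.2 hσ
    rw [← mul_assoc]
    exact mul_pos this k3
  obtain ⟨N', hN'N, hN'o, hpN', h, hcont, hgraph⟩ := exists_continuous_graph (f := F) hNo hpN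
    (t₀ := e p 0) ⟨by linarith, by linarith⟩
    (hFcont.mono fun q hq => hbox q.1 hq.1 q.2 hq.2) huniq
    ((hFH _ (by rw [ψinv]; exact hpW)).2 (by rw [ψinv, e.left_inv hps]; exact hp))
    ((hsign (-1) (by norm_num)).mono fun q hq => by linarith)
    ((hsign 1 one_ne_zero).mono fun q hq => by linarith)
  -- restrict the chart to the box
  set B : Set (Coord n) := {y | y 0 ∈ Ioo l u ∧ spatial y ∈ N'} with hB
  have hBo : IsOpen B := (isOpen_Ioo.preimage continuous_zero_coord).inter
    (hN'o.preimage continuous_spatial)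
  have hBW : B ⊆ W := fun y hy => by
    have := hbox (y 0) (Ioo_subset_Icc_self hy.1) _ (hN'N hy.2)
    rwa [ψinv] at this
  set e' := (e.symm.restrOpen B hBo).symm with he'
  have hs' : e'.source = e.source ∩ e ⁻¹' B := by
    simp [he', OpenPartialHomeomorph.restrOpen]
  have ht' : e'.target = e.target ∩ B := by simp [he']
  have hcoe : ∀ x, e' x = e x := fun x => rfl
  have hcoe' : ∀ y, e'.symm y = e.symm y := fun y => rfl
  have m' : e' ∈ IsManifold.maximalAtlas 𝓘(ℝ, Coord n) 4 M := by
    refine OpenPartialHomeomorph.mem_maximalAtlas_of_contMDiffOn _ ?_ ?_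
    · exact (contMDiffOn_of_mem_maximalAtlas he).mono (by rw [hs']; exact inter_subset_left)
    · exact (contMDiffOn_symm_of_mem_maximalAtlas he).mono (by rw [ht']; exact inter_subset_left)
  refine ⟨e', N', h, m', ?_, ?_, hN'o, hcont, ?_⟩
  · rw [hs']
    exact ⟨hps, ⟨by linarith, by linarith⟩, hpN'⟩
  · intro y hy
    rw [ht'] at hy
    exact hW₁ y (hBW hy.2).1
  · ext y
    constructor
    · rintro ⟨x, ⟨hxH, hx⟩, rfl⟩
      rw [hs'] at hx
      obtain ⟨hx1, hx2⟩ := hx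
      rw [hcoe]
      refine ⟨hx2.2, ?_⟩
      obtain ⟨k1, k2⟩ := hgraph _ hx2.2
      refine huniq _ (hN'N hx2.2) _ (Ioo_subset_Icc_self hx2.1) _ (Ioo_subset_Icc_self k1) ?_ k2
      rw [hFH _ (by rw [ψinv]; exact hBW hx2), ψinv, e.left_inv hx1]
      exact hxH
    · rintro ⟨hy1, hy2⟩
      obtain ⟨k1, k2⟩ := hgraph _ hy1
      rw [← hy2] at k1 k2
      have hyB : y ∈ B := ⟨k1, hy1⟩
      have hyW := hBW hyB
      rw [hFH _ (by rw [ψinv]; exact hyW), ψinv] at k2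
      refine ⟨e.symm y, ⟨k2, ?_⟩, e.right_inv hyW.2.1⟩
      rw [hs']
      exact ⟨e.map_target hyW.2.1, by rw [mem_preimage, e.right_inv hyW.2.1]; exact hyB⟩

end NullHorizon

namespace NullHorizon

/-! ### Null geodesics in a horizon and in its coordinate picture -/

variable {n : ℕ} {M : Type*} [TopologicalSpace M] [ChartedSpace (Coord n) M]
  [IsManifold 𝓘(ℝ, Coord n) 4 M] {S : Spacetime n M} {H : Set M}
  {e : OpenPartialHomeomorph M (Coord n)} {A : AchronalGraph (Coord n)}

/-- `A` is a picture of `H` in the chart `e`: its metric is that of the spacetime, its vertical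
vector is `∂₀`, which is future-directed timelike, and its hypersurface is `H`. -/
structure IsPicture (S : Spacetime n M) (H : Set M) (e : OpenPartialHomeomorph M (Coord n))
    (A : AchronalGraph (Coord n)) : Prop where
  mem_atlas : e ∈ IsManifold.maximalAtlas 𝓘(ℝ, Coord n) 4 M
  e₀_eq : A.e₀ = e₀ n
  G_eq : A.G = chartG S e
  mem_target : ∀ y ∈ A.ball, y ∈ e.target
  futureTimelike : ∀ y ∈ A.ball, S.FutureTimelike (e.symm y) (chartD e y (e₀ n))
  mem_iff : ∀ y ∈ A.ball, (e.symm y ∈ H ↔ A.height y = 0)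

lemma exists_isPicture {p : M} {Ω : Set (Space n)} {h : Space n → ℝ}
    (hg : S.IsGraphChart H p e Ω h) (hpH : p ∈ H) {U : Set M} (hU : IsOpen U) (hpU : p ∈ U)
    (hach : S.AchronalIn H U) :
    ∃ A, IsPicture S H e A ∧ A.ctr = e p ∧ (∀ y, A.height y = y 0 - h (spatial y)) ∧
      ∀ y ∈ A.ball, e.symm y ∈ U := by
  obtain ⟨A, h1, h2, h3, h4, h5⟩ := exists_achronalGraph hg hpH hU hpU hach
  exact ⟨A, ⟨hg.1, h2, h3, fun y hy => (h5 y hy).1, fun y hy => hg.2.2.1 y (h5 y hy).1,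
    fun y hy => by rw [h4]; exact mem_iff_of_isGraphChart hg (h5 y hy).1 (h5 y hy).2.1⟩, h1, h4,
    fun y hy => (h5 y hy).2.2⟩

lemma AchronalGraph.geodesicEq_acc {y : Coord n} (hy : y ∈ A.ball) (u : Coord n) :
    GeodesicEq A.G y u (A.acc y u) := by
  intro w
  rw [AchronalGraph.G_acc hy, AchronalGraph.force_apply]
  simp only [AchronalGraph.G']
  ring

namespace IsPicture

variable (hA : IsPicture S H e A)

include hA

lemma causal_iff {y v : Coord n} (hy : y ∈ A.ball) :
    A.Causal 1 y v ↔ S.FutureCausal (e.symm y) (chartD e y v) := by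
  have hinj := (bijective_chartD hA.mem_atlas (hA.mem_target y hy)).1
  have h0 : v ≠ 0 ↔ chartD e y v ≠ 0 := by
    rw [not_iff_not]
    exact ⟨fun h => by rw [h, map_zero], fun h => hinj (h.trans (map_zero _).symm)⟩
  rw [AchronalGraph.Causal, one_mul, hA.G_eq, hA.e₀_eq]
  constructor
  · rintro ⟨h1, h2, h3⟩
    exact ⟨h0.1 h1, h2, (chartG_e₀_neg_iff hA.mem_atlas (hA.mem_target y hy)
      (hA.futureTimelike y hy) h2).1 h3⟩
  · rintro ⟨h1, h2, h3⟩
    exact ⟨h0.2 h1, h2, (chartG_e₀_neg_iff hA.mem_atlas (hA.mem_target y hy)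
      (hA.futureTimelike y hy) h2).2 h3⟩

/-- A null geodesic of the picture is a lightlike geodesic in the horizon. -/
lemma isLightlikeGeodesicIn {c v : ℝ → Coord n} {s : Set ℝ} (hc : s.OrdConnected)
    (hn : s.Nontrivial) (h : A.IsNullGeodesic 1 c v s) :
    S.IsLightlikeGeodesicIn H (fun τ => e.symm (c τ)) s := by
  refine isLightlikeGeodesicIn_of_isNullGerm hc hn fun t ht => ⟨e, hA.mem_atlas, v,
    fun τ => A.acc (c τ) (v τ), ?_⟩
  obtain ⟨h1, h2, h3, h4, h5, h6, h7⟩ := h t ht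
  have ht' := hA.mem_target _ h3
  refine ⟨(hA.mem_iff _ h3).2 h4, e.map_target ht',
    (e.continuousAt_symm ht').comp_continuousWithinAt h1.continuousWithinAt, ?_, ?_⟩
  · filter_upwards [self_mem_nhdsWithin] with τ hτ
    obtain ⟨k1, k2, k3, -⟩ := h τ hτ
    have key : IsGeodesicAt (chartG S e) c v (fun τ => A.acc (c τ) (v τ)) s τ := by
      refine ⟨k1, k2, ?_, ?_⟩
      · exact ContinuousAt.comp_continuousWithinAt (f := fun τ => (c τ, v τ))
          (AchronalGraph.contDiffAt_acc k3 (v τ)).continuousAt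
          (k1.continuousWithinAt.prodMk k2.continuousWithinAt)
      · rw [← hA.G_eq]; exact AchronalGraph.geodesicEq_acc k3 _
    refine key.congr hτ EventuallyEq.rfl ?_ EventuallyEq.rfl EventuallyEq.rfl
    filter_upwards [self_mem_nhdsWithin] with x hx
      using e.right_inv (hA.mem_target _ (h x hx).2.2.1)
  · rw [e.right_inv ht']
    obtain ⟨l1, -, l3⟩ := (hA.causal_iff h3).1 ⟨h5, h6.le, h7⟩
    exact ⟨l1, by rw [hA.G_eq] at h6; exact h6, l3⟩

/-- A lightlike geodesic in the horizon is a null geodesic of the picture. -/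
lemma isNullGeodesic {γ : ℝ → M} {s J : Set ℝ} (h : S.IsLightlikeGeodesicIn H γ s) (hJ : J ⊆ s)
    (hball : ∀ τ ∈ J, γ τ ∈ e.source ∧ e (γ τ) ∈ A.ball) :
    A.IsNullGeodesic 1 (fun τ => e (γ τ)) (derivWithin (fun τ => e (γ τ)) s) J := by
  intro t ht
  obtain ⟨h1, h2⟩ := hball t ht
  obtain ⟨⟨k1, k2, -, k3⟩, l1, l2, l3⟩ :=
    IsGeodesicAt.of_isLightlikeGeodesicIn hA.mem_atlas h (hJ ht) h1
  have hH := (h.2.2.2 t (hJ ht)).1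
  have hinv := e.left_inv h1
  have hacc : derivWithin (derivWithin (fun τ => e (γ τ)) s) s t =
      A.acc (e (γ t)) (derivWithin (fun τ => e (γ τ)) s t) := by
    refine k3.unique hA.mem_atlas (hA.mem_target _ h2) ?_
    rw [← hA.G_eq]
    exact AchronalGraph.geodesicEq_acc h2 _
  have hcau := hA.causal_iff h2 (v := derivWithin (fun τ => e (γ τ)) s t)
  rw [hinv] at hcau
  obtain ⟨m1, -, m3⟩ := hcau.2 ⟨l1, l2.le, l3⟩
  refine ⟨k1.mono hJ, hacc ▸ k2.mono hJ, h2, (hA.mem_iff _ h2).1 (by rwa [hinv]), m1, ?_, m3⟩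
  rw [hA.G_eq, chartG_apply]
  have key : ∀ x : M, x = γ t → ∀ w : Coord n, S.g (γ t) w w = 0 → S.g x w w = 0 := by
    rintro x rfl w hw; exact hw
  exact key _ hinv _ l2

/-- A causal curve in the domain of the picture, in both orientations. -/
lemma step_of_causalStep {p q : M} (h : S.CausalStep (e.source ∩ e ⁻¹' A.ball) p q) :
    A.Step 1 (e p) (e q) ∧ A.Step (-1) (e q) (e p) := by
  obtain ⟨γ, hγ, rfl, rfl, hcau⟩ := h
  set c : ℝ → Coord n := fun τ => e (γ τ) with hc
  have hU := uniqueDiffOn_Icc (zero_lt_one' ℝ)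
  have hcd : ContDiffOn ℝ 1 c (Icc 0 1) := by
    rw [← contMDiffOn_iff_contDiffOn]
    exact ((contMDiffOn_of_mem_maximalAtlas hA.mem_atlas).of_le (by norm_cast)).comp hγ
      fun t ht => (hcau t ht).1.1
  have hd : ∀ t ∈ Icc (0 : ℝ) 1, HasDerivWithinAt c (derivWithin c (Icc 0 1) t) (Icc 0 1) t :=
    fun t ht => ((hcd.differentiableOn (by norm_num)) t ht).hasDerivWithinAt
  have hC : C1Curve c (derivWithin c (Icc 0 1)) 0 1 :=
    ⟨hd, hcd.continuousOn_derivWithin hU (by norm_num)⟩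
  have hcaus : ∀ t ∈ Icc (0 : ℝ) 1, c t ∈ A.ball ∧
      A.Causal 1 (c t) (derivWithin c (Icc 0 1) t) := by
    intro t ht
    obtain ⟨⟨h1, h2⟩, h3⟩ := hcau t ht
    rw [velocity_eq hA.mem_atlas (hU t ht) (hγ.continuousOn t ht) h1 (hd t ht)] at h3
    refine ⟨h2, (hA.causal_iff h2).2 ?_⟩
    rwa [e.left_inv h1]
  refine ⟨⟨c, _, hC, rfl, rfl, hcaus⟩, fun t => c (1 - t),
    fun t => -derivWithin c (Icc 0 1) (1 - t), ?_, by simp [hc], by simp [hc], fun t ht => ?_⟩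
  · have hm : MapsTo (fun t : ℝ => 1 - t) (Icc 0 1) (Icc 0 1) := fun t ht =>
      ⟨by linarith [ht.2], by linarith [ht.1]⟩
    refine ⟨fun t ht => ?_, (hC.2.comp (by fun_prop) hm).neg⟩
    have h6 : HasDerivWithinAt (fun t : ℝ => 1 - t) (-1) (Icc 0 1) t := by
      simpa using ((hasDerivAt_id t).const_sub 1).hasDerivWithinAt
    exact ((hC.1 _ (hm ht)).scomp t h6 hm).congr_deriv (by simp)
  · obtain ⟨h1, h2, h3, h4⟩ := hcaus (1 - t) ⟨by linarith [ht.2], by linarith [ht.1]⟩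
    refine ⟨h1, neg_ne_zero.2 h2, by simpa using h3, ?_⟩
    rw [map_neg]; linarith

lemma reflTransGen_of_causalRel {p q : M} (h : S.CausalRel (e.source ∩ e ⁻¹' A.ball) p q) :
    Relation.ReflTransGen (A.Step 1) (e p) (e q) ∧
      Relation.ReflTransGen (A.Step (-1)) (e q) (e p) := by
  induction h with
  | refl => exact ⟨.refl, .refl⟩
  | tail _ h ih =>
    obtain ⟨h1, h2⟩ := hA.step_of_causalStep h
    exact ⟨ih.1.tail h1, Relation.ReflTransGen.head h2 ih.2⟩

/-- From each point of a horizon a null geodesic departs, to the future if it is a past horizon,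
to the past if it is a future horizon. -/
lemma exists_starts {U : Set M} (hach : S.AchronalIn H U) (hU : ∀ y ∈ A.ball, e.symm y ∈ U) :
    (S.IsPastHorizon H → ∀ y ∈ A.ball, A.height y = 0 → A.Starts 1 y) ∧
      (S.IsFutureHorizon H → ∀ y ∈ A.ball, A.height y = 0 → A.Starts (-1) y) := by
  set W := e.source ∩ e ⁻¹' A.ball with hW
  have hWo : IsOpen W := e.isOpen_inter_preimage Metric.isOpen_ball
  have hWa : S.AchronalIn H W := hach.mono fun x hx => by
    have := hU _ hx.2
    rwa [e.left_inv hx.1] at this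
  have key : ∀ σ : ℝ, (σ = 1 ∨ σ = -1) → ∀ y ∈ A.ball, A.height y = 0 → ∀ q ∈ H, q ∈ W →
      q ≠ e.symm y → Relation.ReflTransGen (A.Step σ) y (e q) → A.Starts σ y := by
    intro σ hσ y hy hy0 q hq hqW hne hrel
    have hyq : y ≠ e q := by rintro rfl; exact hne (e.left_inv hqW.1).symm
    have hq0 : A.height (e q) = 0 := (hA.mem_iff _ hqW.2).1 (by rwa [e.left_inv hqW.1])
    obtain ⟨c, v, hc, hc0, hcau⟩ :=
      AchronalGraph.exists_causal_curve_of_reflTransGen hσ hrel hyq hy0 hq0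
    obtain ⟨T, hT, c', v', hg, h0⟩ :=
      AchronalGraph.exists_isNullGeodesic_of_causal hσ zero_lt_one hc hcau
    exact ⟨T, hT, c', v', hg, h0.trans hc0⟩
  have hin : ∀ y ∈ A.ball, A.height y = 0 → e.symm y ∈ H ∧ e.symm y ∈ W := fun y hy hy0 =>
    ⟨(hA.mem_iff y hy).2 hy0, e.map_target (hA.mem_target y hy), by
      rw [mem_preimage, e.right_inv (hA.mem_target y hy)]; exact hy⟩
  constructor
  · intro hH y hy hy0
    obtain ⟨h1, h2⟩ := hin y hy hy0
    obtain ⟨q, hq, hne, hrel⟩ := hH.2.2 _ h1 W hWo h2 hWa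
    have hqW : q ∈ W := by
      rcases Relation.ReflTransGen.cases_tail hrel with h | ⟨r, -, γ, -, -, h3, h4⟩
      · exact absurd h hne
      · rw [← h3]; exact (h4 1 (right_mem_Icc.2 zero_le_one)).1
    have := (hA.reflTransGen_of_causalRel hrel).1
    rw [e.right_inv (hA.mem_target y hy)] at this
    exact key 1 (Or.inl rfl) y hy hy0 q hq hqW hne this
  · intro hH y hy hy0
    obtain ⟨h1, h2⟩ := hin y hy hy0
    obtain ⟨q, hq, hne, hrel⟩ := hH.2.2 _ h1 W hWo h2 hWa
    have hqW : q ∈ W := by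
      rcases Relation.ReflTransGen.cases_head hrel with h | ⟨r, ⟨γ, -, h3, -, h4⟩, -⟩
      · exact absurd h hne
      · rw [← h3]; exact (h4 0 (left_mem_Icc.2 zero_le_one)).1
    have := (hA.reflTransGen_of_causalRel hrel).2
    rw [e.right_inv (hA.mem_target y hy)] at this
    exact key (-1) (Or.inr rfl) y hy hy0 q hq hqW hne this

end IsPicture

end NullHorizon

namespace NullHorizon

/-! ### Endpoints and differentiability -/

lemma nontrivial_Icc {a b : ℝ} (h : a < b) : (Icc a b).Nontrivial :=
  ⟨a, left_mem_Icc.2 h.le, b, right_mem_Icc.2 h.le, h.ne⟩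

/-- If `t` is not the greatest element of an interval, the interval contains a short interval to the
right of `t`, on which a given local property holds. -/
lemma exists_Icc_right {s : Set ℝ} (hs : s.OrdConnected) {t b : ℝ} (ht : t ∈ s) (hb : b ∈ s)
    (htb : t < b) {P : ℝ → Prop} (hP : ∀ᶠ τ in 𝓝[s] t, P τ) :
    ∃ δ > 0, Icc t (t + δ) ⊆ s ∧ ∀ τ ∈ Icc t (t + δ), P τ := by
  obtain ⟨ε, hε, hεP⟩ := Metric.mem_nhdsWithin_iff.1 hP
  have hsub : Icc t (t + min (ε / 2) (b - t)) ⊆ s := fun τ hτ =>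
    hs.out ht hb ⟨hτ.1, by linarith [hτ.2, min_le_right (ε / 2) (b - t)]⟩
  refine ⟨min (ε / 2) (b - t), lt_min (by positivity) (by linarith), hsub, fun τ hτ =>
    hεP ⟨?_, hsub hτ⟩⟩
  rw [Metric.mem_ball, Real.dist_eq, abs_of_nonneg (by linarith [hτ.1])]
  linarith [hτ.2, min_le_left (ε / 2) (b - t)]

lemma exists_Icc_left {s : Set ℝ} (hs : s.OrdConnected) {t a : ℝ} (ht : t ∈ s) (ha : a ∈ s)
    (hat : a < t) {P : ℝ → Prop} (hP : ∀ᶠ τ in 𝓝[s] t, P τ) :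
    ∃ δ > 0, Icc (t - δ) t ⊆ s ∧ ∀ τ ∈ Icc (t - δ) t, P τ := by
  obtain ⟨ε, hε, hεP⟩ := Metric.mem_nhdsWithin_iff.1 hP
  have hsub : Icc (t - min (ε / 2) (t - a)) t ⊆ s := fun τ hτ =>
    hs.out ha ht ⟨by linarith [hτ.1, min_le_right (ε / 2) (t - a)], hτ.2⟩
  refine ⟨min (ε / 2) (t - a), lt_min (by positivity) (by linarith), hsub, fun τ hτ =>
    hεP ⟨?_, hsub hτ⟩⟩
  rw [Metric.mem_ball, Real.dist_eq, abs_sub_comm, abs_of_nonneg (by linarith [hτ.2])]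
  linarith [hτ.1, min_le_left (ε / 2) (t - a)]

variable {n : ℕ} {M : Type*} [TopologicalSpace M] [ChartedSpace (Coord n) M]
  [IsManifold 𝓘(ℝ, Coord n) 4 M] {S : Spacetime n M} {H : Set M}
  {e : OpenPartialHomeomorph M (Coord n)} {A : AchronalGraph (Coord n)}

lemma Spacetime.IsLightlikeGeodesicIn.congr {γ η : ℝ → M} {s : Set ℝ}
    (h : S.IsLightlikeGeodesicIn H γ s) (heq : EqOn η γ s) : S.IsLightlikeGeodesicIn H η s :=
  isLightlikeGeodesicIn_of_isNullGerm h.1 h.2.1 fun t ht =>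
    ⟨_, IsManifold.chart_mem_maximalAtlas (γ t), _, _,
      (IsNullGerm.of_isLightlikeGeodesicIn (IsManifold.chart_mem_maximalAtlas _) h ht
        (mem_chart_source _ _)).congr ht EventuallyEq.rfl (eventually_nhdsWithin_of_forall heq)
        EventuallyEq.rfl EventuallyEq.rfl⟩

/-- A lightlike geodesic which can be continued, from its final time `t` on, by another one with the
same velocity at `t`, is not maximal. -/
lemma not_isGenerator_of_glue (he : e ∈ IsManifold.maximalAtlas 𝓘(ℝ, Coord n) 4 M) {γ γ' : ℝ → M}
    {s s' : Set ℝ} {t : ℝ} {u : Coord n} (hs : IsGreatest s t ∧ IsLeast s' t ∨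
      IsLeast s t ∧ IsGreatest s' t) (h' : S.IsLightlikeGeodesicIn H γ' s') (h0 : γ t = γ' t)
    (hsrc : γ t ∈ e.source)
    (hu : HasDerivWithinAt (fun τ => e (γ τ)) u s t)
    (hu' : HasDerivWithinAt (fun τ => e (γ' τ)) u s' t) : ¬ S.IsGenerator H γ s := by
  rintro ⟨h, hmax⟩
  classical
  set η : ℝ → M := fun τ => if τ ∈ s then γ τ else γ' τ with hη
  have e1 : EqOn η γ s := fun τ hτ => if_pos hτ
  have hinter : ∀ τ ∈ s, τ ∈ s' → τ = t := by
    intro τ h1 h2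
    rcases hs with ⟨a, b⟩ | ⟨a, b⟩
    · exact le_antisymm (a.2 h1) (b.2 h2)
    · exact le_antisymm (b.2 h2) (a.2 h1)
  have e2 : EqOn η γ' s' := fun τ hτ => by
    by_cases hτs : τ ∈ s
    · obtain rfl := hinter τ hτs hτ
      rw [e1 hτs, h0]
    · exact if_neg hτs
  have m1 : t ∈ s := by rcases hs with ⟨a, -⟩ | ⟨a, -⟩ <;> exact a.1
  have m2 : t ∈ s' := by rcases hs with ⟨-, b⟩ | ⟨-, b⟩ <;> exact b.1
  have d1 : derivWithin (fun τ => e (η τ)) s t = u := by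
    refine HasDerivWithinAt.derivWithin ?_ (uniqueDiffOn_of_ordConnected h.1 h.2.1 t m1)
    exact hu.congr (fun τ hτ => by rw [e1 hτ]) (by rw [e1 m1])
  have d2 : derivWithin (fun τ => e (η τ)) s' t = u := by
    refine HasDerivWithinAt.derivWithin ?_ (uniqueDiffOn_of_ordConnected h'.1 h'.2.1 t m2)
    exact hu'.congr (fun τ hτ => by rw [e2 hτ]) (by rw [e2 m2])
  have hηsrc : η t ∈ e.source := by rwa [e1 m1]
  have hU : S.IsLightlikeGeodesicIn H η (s ∪ s') := by
    rcases hs with ⟨a, b⟩ | ⟨a, b⟩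
    · exact isLightlikeGeodesicIn_union a b (h.congr e1) (h'.congr e2) he hηsrc (d1.trans d2.symm)
    · rw [union_comm]
      exact isLightlikeGeodesicIn_union b a (h'.congr e2) (h.congr e1) he hηsrc (d2.trans d1.symm)
  have heq := hmax η _ subset_union_left e1 hU
  obtain ⟨x, hx, hxt⟩ := h'.2.1.exists_ne t
  exact hxt (hinter x (heq ▸ Or.inr hx) hx)

namespace IsPicture

variable (hA : IsPicture S H e A)

include hA

lemma eventually_mem_ball {γ : ℝ → M} {s : Set ℝ} (h : S.IsLightlikeGeodesicIn H γ s) {t : ℝ}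
    (ht : t ∈ s) (hsrc : γ t ∈ e.source) (hball : e (γ t) ∈ A.ball) :
    ∀ᶠ τ in 𝓝[s] t, γ τ ∈ e.source ∧ e (γ τ) ∈ A.ball :=
  h.2.2.1.1 t ht ((e.isOpen_inter_preimage Metric.isOpen_ball).mem_nhds ⟨hsrc, hball⟩)

/-- Where there are no endpoints, null geodesics can be extended, in both time directions. -/
lemma extends_of_not_isEndpoint (hend : ∀ y ∈ A.ball, A.height y = 0 → ¬ S.IsEndpoint H (e.symm y))
    {σ : ℝ} (hσ : σ = 1 ∨ σ = -1) {b : ℝ} {c v : ℝ → Coord n} (hb : 0 < b)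
    (h : A.IsNullGeodesic σ c v (Icc 0 b)) : A.Extends σ c v b := by
  obtain ⟨db, -, k1, k2, -⟩ := h b (right_mem_Icc.2 hb.le)
  have hne := hend _ k1 k2
  rcases hσ with rfl | rfl
  · obtain ⟨η, s, hs, heq, hgen⟩ := exists_isGenerator
      (hA.isLightlikeGeodesicIn ordConnected_Icc (nontrivial_Icc hb) h)
    have hbs : b ∈ s := hs (right_mem_Icc.2 hb.le)
    have hηb : η b = e.symm (c b) := heq (right_mem_Icc.2 hb.le)
    have hnot : ¬ IsGreatest s b := fun hg => hne ⟨η, s, b, hgen, Or.inr hg, hηb⟩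
    obtain ⟨b', hb's, hbb'⟩ : ∃ b' ∈ s, b < b' := by
      by_contra! hcon
      exact hnot ⟨hbs, hcon⟩
    have hsrc : η b ∈ e.source := by rw [hηb]; exact e.map_target (hA.mem_target _ k1)
    have heηb : e (η b) = c b := by rw [hηb, e.right_inv (hA.mem_target _ k1)]
    obtain ⟨δ, hδ, hsub, hball⟩ := exists_Icc_right hgen.1.1 hbs hb's hbb'
      (hA.eventually_mem_ball hgen.1 hbs hsrc (by rw [heηb]; exact k1))
    have hg := hA.isNullGeodesic hgen.1 hsub hball
    refine ⟨δ, hδ, _, _, hg.comp_affine (σ' := 1) (k := 1) (q := b) one_ne_zero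
      (fun x hx => by linarith) (fun τ hτ => ⟨by linarith [hτ.1], by linarith [hτ.2]⟩), ?_, ?_⟩
    · simp [heηb]
    · simp only [mul_zero, zero_add, one_smul]
      have d1 := (IsGeodesicAt.of_isLightlikeGeodesicIn hA.mem_atlas hgen.1 hbs hsrc).1.1.mono hs
      have d2 : HasDerivWithinAt (fun τ => e (η τ)) (v b) (Icc 0 b) b :=
        db.congr (fun τ hτ => by
          rw [heq hτ, e.right_inv (hA.mem_target _ (h τ hτ).2.2.1)]) heηb
      exact (uniqueDiffOn_Icc hb b (right_mem_Icc.2 hb.le)).eq_deriv _ d1 d2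
  · have hrev := h.reverse
    rw [neg_neg] at hrev
    obtain ⟨η, s, hs, heq, hgen⟩ := exists_isGenerator
      (hA.isLightlikeGeodesicIn ordConnected_Icc (nontrivial_Icc hb) hrev)
    have m0 : (0 : ℝ) ∈ Icc 0 b := left_mem_Icc.2 hb.le
    have h0s : (0 : ℝ) ∈ s := hs m0
    have hη0 : η 0 = e.symm (c b) := by rw [heq m0]; simp
    have hnot : ¬ IsLeast s 0 := fun hg => hne ⟨η, s, 0, hgen, Or.inl hg, hη0⟩
    obtain ⟨a, has, ha0⟩ : ∃ a ∈ s, a < 0 := by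
      by_contra! hcon
      exact hnot ⟨h0s, hcon⟩
    have hsrc : η 0 ∈ e.source := by rw [hη0]; exact e.map_target (hA.mem_target _ k1)
    have heη0 : e (η 0) = c b := by rw [hη0, e.right_inv (hA.mem_target _ k1)]
    obtain ⟨δ, hδ, hsub, hball⟩ := exists_Icc_left hgen.1.1 h0s has ha0
      (hA.eventually_mem_ball hgen.1 h0s hsrc (by rw [heη0]; exact k1))
    have hg := hA.isNullGeodesic hgen.1 hsub hball
    refine ⟨δ, hδ, _, _, hg.comp_affine (σ' := -1) (k := -1) (q := 0) (by norm_num)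
      (fun x hx => by linarith) (fun τ hτ => ⟨by linarith [hτ.2], by linarith [hτ.1]⟩), ?_, ?_⟩
    · simp [heη0]
    · simp only [mul_zero, zero_add]
      have d1 := (IsGeodesicAt.of_isLightlikeGeodesicIn hA.mem_atlas hgen.1 h0s hsrc).1.1.mono hs
      have d2 : HasDerivWithinAt (fun τ => e (η τ)) ((-1 : ℝ) • v b) (Icc 0 b) 0 := by
        have := (hrev 0 m0).1
        simp only [mul_zero, zero_add] at this
        refine this.congr (fun τ hτ => ?_) (by rw [heη0]; simp)
        rw [heq hτ, e.right_inv (hA.mem_target _ (hrev τ hτ).2.2.1)]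
      rw [(uniqueDiffOn_Icc hb 0 m0).eq_deriv _ d1 d2, smul_smul]
      simp

/-- A point of differentiability from which null geodesics depart in both time directions is not
an endpoint. -/
lemma not_isEndpoint {p : M} (hp : p ∈ e.source) (hpb : e p ∈ A.ball)
    (h₁ : A.Starts 1 (e p)) (h₂ : A.Starts (-1) (e p)) (hd : DifferentiableAt ℝ A.height (e p)) :
    ¬ S.IsEndpoint H p := by
  rintro ⟨γ, s, t, hgen, ht | ht, rfl⟩
  · obtain ⟨b, hb, hbt⟩ := hgen.1.2.1.exists_ne t
    obtain ⟨δ, hδ, hsub, hball⟩ := exists_Icc_right hgen.1.1 ht.1 hb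
      (lt_of_le_of_ne (ht.2 hb) hbt.symm) (hA.eventually_mem_ball hgen.1 ht.1 hp hpb)
    have hg := hA.isNullGeodesic hgen.1 hsub hball
    -- the generator run backwards arrives at `p` and continues to the past, without a corner
    have hg' := hg.comp_affine (σ' := -1) (k := -1) (q := t + δ) (s' := Icc 0 δ) (by norm_num)
      (fun x hx => by linarith) (fun τ hτ => ⟨by linarith [hτ.2], by linarith [hτ.1]⟩)
    have et : -1 * δ + (t + δ) = t := by ring
    obtain ⟨δ', hδ', c', v', hc', h0, hv⟩ := AchronalGraph.extends_of_differentiable (Or.inr rfl)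
      hδ hg' (by simp only [et]; exact h₂) (by simp only [et]; exact hd)
    simp only [et] at h0 hv
    -- reversing time gives a future-directed geodesic arriving at `t`
    have hJ := hc'.comp_affine (σ' := 1) (k := -1) (q := t) (s' := Icc (t - δ') t) (by norm_num)
      (fun x hx => by linarith) (fun τ hτ => ⟨by linarith [hτ.2], by linarith [hτ.1]⟩)
    have hle : t - δ' ≤ t := by linarith
    have hl := hA.isLightlikeGeodesicIn ordConnected_Icc (nontrivial_Icc (by linarith)) hJ
    have z : -1 * t + t = 0 := by ring
    refine not_isGenerator_of_glue hA.mem_atlas (Or.inr ⟨ht, isGreatest_Icc hle⟩) hl ?_ hp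
      (IsGeodesicAt.of_isLightlikeGeodesicIn hA.mem_atlas hgen.1 ht.1 hp).1.1 ?_ hgen
    · simp only [z, h0]; exact (e.left_inv hp).symm
    · have := (hJ t (right_mem_Icc.2 hle)).1
      simp only [z, hv, smul_smul] at this
      norm_num at this
      refine this.congr (fun τ hτ => ?_) ?_
      · simpa using e.right_inv (hA.mem_target _ (hJ τ hτ).2.2.1)
      · simpa using e.right_inv (hA.mem_target _ (hJ t (right_mem_Icc.2 hle)).2.2.1)
  · obtain ⟨a, ha, hat⟩ := hgen.1.2.1.exists_ne t
    obtain ⟨δ, hδ, hsub, hball⟩ := exists_Icc_left hgen.1.1 ht.1 ha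
      (lt_of_le_of_ne (ht.2 ha) hat) (hA.eventually_mem_ball hgen.1 ht.1 hp hpb)
    have hg := hA.isNullGeodesic hgen.1 hsub hball
    have hg' := hg.comp_affine (σ' := 1) (k := 1) (q := t - δ) (s' := Icc 0 δ) (by norm_num)
      (fun x hx => by linarith) (fun τ hτ => ⟨by linarith [hτ.1], by linarith [hτ.2]⟩)
    have et : 1 * δ + (t - δ) = t := by ring
    obtain ⟨δ', hδ', c', v', hc', h0, hv⟩ := AchronalGraph.extends_of_differentiable (Or.inl rfl)
      hδ hg' (by simp only [et]; exact h₁) (by simp only [et]; exact hd)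
    simp only [et, one_smul] at h0 hv
    have hJ := hc'.comp_affine (σ' := 1) (k := 1) (q := -t) (s' := Icc t (t + δ')) (by norm_num)
      (fun x hx => by linarith) (fun τ hτ => ⟨by linarith [hτ.1], by linarith [hτ.2]⟩)
    have hle : t ≤ t + δ' := by linarith
    have hl := hA.isLightlikeGeodesicIn ordConnected_Icc (nontrivial_Icc (by linarith)) hJ
    have z : 1 * t + -t = 0 := by ring
    refine not_isGenerator_of_glue hA.mem_atlas (Or.inl ⟨ht, isLeast_Icc hle⟩) hl ?_ hp
      (IsGeodesicAt.of_isLightlikeGeodesicIn hA.mem_atlas hgen.1 ht.1 hp).1.1 ?_ hgen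
    · simp only [z, h0]; exact (e.left_inv hp).symm
    · have := (hJ t (left_mem_Icc.2 hle)).1
      simp only [z, hv, one_smul] at this
      refine this.congr (fun τ hτ => ?_) ?_
      · exact e.right_inv (hA.mem_target _ (hJ τ hτ).2.2.1)
      · exact e.right_inv (hA.mem_target _ (hJ t (left_mem_Icc.2 hle)).2.2.1)

end IsPicture

/-- A horizon is everywhere locally achronal and has graph charts at all of its points. -/
lemma Spacetime.IsHorizon.isTopologicalHypersurface_and_locallyAchronal (hH : S.IsHorizon H) :
    IsTopologicalHypersurface n H ∧ S.LocallyAchronal H := by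
  rcases hH with h | h <;> exact ⟨h.1, h.2.1⟩

lemma IsPicture.exists_forall_starts (hA : IsPicture S H e A) (hH : S.IsHorizon H) {U : Set M}
    (hach : S.AchronalIn H U) (hU : ∀ y ∈ A.ball, e.symm y ∈ U) :
    ∃ σ : ℝ, (σ = 1 ∨ σ = -1) ∧ ∀ y ∈ A.ball, A.height y = 0 → A.Starts σ y := by
  obtain ⟨h1, h2⟩ := hA.exists_starts hach hU
  rcases hH with h | h
  · exact ⟨1, Or.inl rfl, h1 h⟩
  · exact ⟨-1, Or.inr rfl, h2 h⟩

/-- If all null geodesics can be extended, null geodesics depart in one time direction if they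
depart in the other one. -/
lemma AchronalGraph.Starts.neg {σ : ℝ} {y : Coord n} (h : A.Starts σ y)
    (hext : ∀ (b' : ℝ) (c' v' : ℝ → Coord n), 0 < b' → A.IsNullGeodesic (-σ) c' v' (Icc 0 b') →
      A.Extends (-σ) c' v' b') : A.Starts (-σ) y := by
  obtain ⟨b, hb, c, v, hg, rfl⟩ := h
  obtain ⟨δ, hδ, c', v', hg', h0, -⟩ := hext b _ _ hb hg.reverse
  exact ⟨δ, hδ, c', v', hg', by simpa using h0⟩

/-- Differentiability on an open set excludes endpoints there: a null geodesic departs from each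
point in one time direction by the definition of a horizon, in the other one by
`AchronalGraph.starts_neg_of_differentiable`. -/
lemma not_isEndpoint_of_subset (hH : S.IsHorizon H) {O : Set M} (hO : IsOpen O)
    (hd : H ∩ O ⊆ S.differentiabilitySet H) {p : M} (hp : p ∈ H ∩ O) : ¬ S.IsEndpoint H p := by
  obtain ⟨ht, ha⟩ := hH.isTopologicalHypersurface_and_locallyAchronal
  obtain ⟨e, Ω, h, hg⟩ := exists_isGraphChart ht ha hp.1
  obtain ⟨U, hU, hpU, hach⟩ := ha p hp.1
  obtain ⟨A, hA, hctr, hh, hAU⟩ := exists_isPicture hg hp.1 (hU.inter hO) ⟨hpU, hp.2⟩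
    (hach.mono inter_subset_left)
  obtain ⟨σ, hσ, hst⟩ := hA.exists_forall_starts hH (hach.mono inter_subset_left) hAU
  have hpb : e p ∈ A.ball := by rw [← hctr]; exact Metric.mem_ball_self A.r_pos
  have hp0 : A.height (e p) = 0 := (hA.mem_iff _ hpb).1 (by rw [e.left_inv hg.2.1]; exact hp.1)
  have hdiff : ∀ y ∈ A.ball, A.height y = 0 → DifferentiableAt ℝ A.height y := by
    intro y hy hy0
    have hyt := hA.mem_target y hy
    have hx := hd ⟨(hA.mem_iff y hy).2 hy0, (hAU y hy).2⟩
    have h1 := hx.2.2 e Ω h ⟨hg.1, e.map_target hyt, hg.2.2⟩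
    rw [e.right_inv hyt] at h1
    rw [funext hh]
    exact (differentiableAt_height_iff y).2 h1
  have hst' : A.Starts (-σ) (e p) := by
    rw [← hctr]
    exact AchronalGraph.starts_neg_of_differentiable hσ (by rw [hctr]; exact hp0) hst hdiff
  have hdp := hdiff _ hpb hp0
  rcases hσ with rfl | rfl
  · exact hA.not_isEndpoint hg.2.1 hpb (hst _ hpb hp0) hst' hdp
  · rw [neg_neg] at hst'
    exact hA.not_isEndpoint hg.2.1 hpb hst' (hst _ hpb hp0) hdp

/-- Absence of endpoints implies `C^{1,1}` regularity, since all null geodesics extend. -/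
lemma isC11NearPoint_of_not_isEndpoint (hH : S.IsHorizon H) {O : Set M} (hO : IsOpen O)
    (hend : ∀ p ∈ H ∩ O, ¬ S.IsEndpoint H p) {p : M} (hp : p ∈ H ∩ O) : S.IsC11NearPoint H p := by
  obtain ⟨ht, ha⟩ := hH.isTopologicalHypersurface_and_locallyAchronal
  obtain ⟨U, hU, hpU, hach⟩ := ha p hp.1
  refine ⟨exists_isGraphChart ht ha hp.1, fun e Ω h hg => ?_⟩
  obtain ⟨A, hA, hctr, hh, hAU⟩ := exists_isPicture hg hp.1 (hU.inter hO) ⟨hpU, hp.2⟩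
    (hach.mono inter_subset_left)
  obtain ⟨σ, hσ, hst⟩ := hA.exists_forall_starts hH (hach.mono inter_subset_left) hAU
  have hpb : e p ∈ A.ball := by rw [← hctr]; exact Metric.mem_ball_self A.r_pos
  have hp0 : A.height (e p) = 0 := (hA.mem_iff _ hpb).1 (by rw [e.left_inv hg.2.1]; exact hp.1)
  have hext : ∀ σ : ℝ, (σ = 1 ∨ σ = -1) → ∀ (b' : ℝ) (c' v' : ℝ → Coord n), 0 < b' →
      A.IsNullGeodesic σ c' v' (Icc 0 b') → A.Extends σ c' v' b' := fun σ hσ b' c' v' hb' hg' =>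
    hA.extends_of_not_isEndpoint (fun y hy hy0 =>
      hend _ ⟨(hA.mem_iff y hy).2 hy0, (hAU y hy).2⟩) hσ hb' hg'
  have hst' : ∀ y ∈ A.ball, A.height y = 0 → A.Starts (-1) y := by
    rcases hσ with rfl | rfl
    · exact fun y hy hy0 => (hst y hy hy0).neg (hext (-1) (Or.inr rfl))
    · exact hst
  rw [← hctr]
  exact isC11Near_of_extends hh hA.e₀_eq (by rw [hctr]; exact hp0) hst' hext

lemma Spacetime.IsC11NearPoint.differentiableAtPoint {p : M} (h : S.IsC11NearPoint H p) :
    S.DifferentiableAtPoint H p := by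
  refine ⟨h.1, fun e Ω f hg => ?_⟩
  obtain ⟨W, -, hp, hd, -⟩ := h.2 e Ω f hg
  exact hd _ hp

lemma relInterior_eq_sdiff_closure {X : Type*} [TopologicalSpace X] {H D : Set X} :
    relInterior H D = H \ closure (H \ D) := by
  ext x
  have himg : (Subtype.val : H → X) '' ((Subtype.val : H → X) ⁻¹' D)ᶜ = H \ D := by
    ext z
    constructor
    · rintro ⟨⟨z, hz⟩, h1, rfl⟩; exact ⟨hz, h1⟩
    · rintro ⟨h1, h2⟩; exact ⟨⟨z, h1⟩, h2, rfl⟩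
  constructor
  · rintro ⟨⟨x, hx⟩, h1, rfl⟩
    refine ⟨hx, fun h2 => ?_⟩
    rw [interior_eq_compl_closure_compl] at h1
    refine h1 (closure_subtype.2 ?_)
    rwa [himg]
  · rintro ⟨h1, h2⟩
    refine ⟨⟨x, h1⟩, ?_, rfl⟩
    rw [interior_eq_compl_closure_compl]
    intro h3
    have := closure_subtype.1 h3
    rw [himg] at this
    exact h2 this

end NullHorizon

theorem mainTheorem10 {n : ℕ} (hn : 1 ≤ n) {M : Type*} [TopologicalSpace M] [T2Space M]
    [ParacompactSpace M] [ChartedSpace (NullHorizon.Coord n) M]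
    [IsManifold 𝓘(ℝ, NullHorizon.Coord n) 4 M]
    (S : NullHorizon.Spacetime n M) (H : Set M) (hH : S.IsHorizon H) :
    (∀ O : Set M, IsOpen O →
      ((H ∩ O ⊆ S.differentiabilitySet H ↔ ∀ p ∈ H ∩ O, ¬ S.IsEndpoint H p) ∧
        (H ∩ O ⊆ S.differentiabilitySet H → S.IsC11LocOn H (H ∩ O)))) ∧
    NullHorizon.relInterior H (S.differentiabilitySet H)
        = H \ closure (H \ S.differentiabilitySet H) ∧
    S.IsC11LocOn H (NullHorizon.relInterior H (S.differentiabilitySet H)) := by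
  have hC11 : ∀ O : Set M, IsOpen O → H ∩ O ⊆ S.differentiabilitySet H →
      S.IsC11LocOn H (H ∩ O) := fun O hO hd p hp =>
    NullHorizon.isC11NearPoint_of_not_isEndpoint hH hO
      (fun q hq => NullHorizon.not_isEndpoint_of_subset hH hO hd hq) hp
  have hint : NullHorizon.relInterior H (S.differentiabilitySet H)
      = H \ closure (H \ S.differentiabilitySet H) := NullHorizon.relInterior_eq_sdiff_closure
  refine ⟨fun O hO => ⟨⟨fun hd p hp => NullHorizon.not_isEndpoint_of_subset hH hO hd hp,
    fun hend p hp => ⟨hp.1, ?_⟩⟩, hC11 O hO⟩, hint, ?_⟩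
  · exact (NullHorizon.isC11NearPoint_of_not_isEndpoint hH hO hend hp).differentiableAtPoint
  · rw [hint]
    refine hC11 _ isClosed_closure.isOpen_compl fun x hx => ?_
    by_contra hxD
    exact hx.2 (subset_closure ⟨hx.1, hxD⟩)
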